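/- Let $\eta:\mathbb R\to\mathbb R$ be a smooth, positive, $1$-periodic function and let $\alpha>0$. For $\varepsilon>0$ with $1/\varepsilon\in\mathbb N$ set $$\tilde\Omega^\varepsilon=\{z=(z_1,z_2):\ z_1\in\mathbb R/\tfrac1\varepsilon\mathbb Z,\ z_2>\varepsilon^\alpha\eta(z_1)\},$$ and let $n$ be the unit normal to $\partial\tilde\Omega^\varepsilon$. For $v=(v_1,v_2)$ write $\operatorname{curl}v=\partial_1v_2-\partial_2v_1$. All norms take values in $[0,\infty]$, with the value $\infty$ when the function does not belong to the space; $H^{-1}$ is the dual of $H^1_0$, the $H^1$-closure of the smooth functions with compact support in $\tilde\Omega^\varepsilon$; $0\cdot\infty=0$ and $\ln\infty=\infty$. **Proposition C.2.** There exist $C$ and $\varepsilon_0>0$, depending only on $\eta$ and $\alpha$, such that for all $\varepsilon\le\varepsilon_0$ as above and all $v\in H^2(\tilde\Omega^\varepsilon)^2$ with $\operatorname{div}v=0$ in $\tilde\Omega^\varepsilon$ and $v\cdot n=0$ on $\partial\tilde\Omega^\varepsilon$ (in the sense of traces), $$\|v\|_{H^k(\tilde\Omega^\varepsilon)}\le C\Big(\|\operatorname{curl}v\|_{H^{k-1}(\tilde\Omega^\varepsilon)}+\|v\|_{L^2(\tilde\Omega^\varepsilon)}\Big)\qquad\text{for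 } k=0,1,2,3,$$ $$\|\nabla v\|_{L^\infty(\tilde\Omega^\varepsilon)}\le C\Big(\varepsilon^2+\big(\|\operatorname{curl}v\|_{L^\infty(\tilde\Omega^\varepsilon)}+\varepsilon^\alpha\|v\|_{W^{1,\infty}(\tilde\Omega^\varepsilon)}\big)\ln\big(2+\varepsilon^{-3}\|v\|_{H^3(\tilde\Omega^\varepsilon)}\big)\Big).$$ -/

import Mathlib

open MeasureTheory Filter Topology
open scoped ENNReal NNReal ContDiff

/-! Function spaces on the domain `{z₁ ∈ ℝ/Lℤ, z₂ > γ(z₁)}`, where `γ` is `L`-periodic.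

A function on the domain is represented by its values on the fundamental cell
`0 ≤ z₁ < L`, `z₂ > γ(z₁)`; its values elsewhere play no role.  Smooth functions are represented
by functions on the plane that are `L`-periodic in `z₁`; since all test functions are of this
kind, weak derivatives are those of functions on the periodic domain. -/
namespace RoughDomain

noncomputable section

/-- The domain, unrolled in the variable `z₁`. -/
def unrolled (γ : ℝ → ℝ) : Set (ℝ × ℝ) := {z | γ z.1 < z.2}

/-- The fundamental cell of the periodic domain. -/
def cell (L : ℝ) (γ : ℝ → ℝ) : Set (ℝ × ℝ) := {z | 0 ≤ z.1 ∧ z.1 < L ∧ γ z.1 < z.2}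

/-- Lebesgue measure on the periodic domain. -/
def cellMeasure (L : ℝ) (γ : ℝ → ℝ) : Measure (ℝ × ℝ) := volume.restrict (cell L γ)

/-- Classical partial derivative in `z₁`. -/
def pd1 (φ : ℝ × ℝ → ℝ) : ℝ × ℝ → ℝ := fun z => fderiv ℝ φ z (1, 0)

/-- Classical partial derivative in `z₂`. -/
def pd2 (φ : ℝ × ℝ → ℝ) : ℝ × ℝ → ℝ := fun z => fderiv ℝ φ z (0, 1)

/-- Classical derivative `∂₁^β₁ ∂₂^β₂ φ` for a multi-index `β`. -/
def pderiv (β : ℕ × ℕ) (φ : ℝ × ℝ → ℝ) : ℝ × ℝ → ℝ := pd1^[β.1] (pd2^[β.2] φ)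

/-- Smooth functions on the closed periodic domain, vanishing for large `z₂`
(restrictions of smooth functions on `ℝ/Lℤ × ℝ`). -/
structure IsSmoothUpToBdry (L : ℝ) (φ : ℝ × ℝ → ℝ) : Prop where
  smooth : ContDiff ℝ ∞ φ
  periodic : ∀ z : ℝ × ℝ, φ (z.1 + L, z.2) = φ z
  bounded_supp : ∃ R : ℝ, ∀ z : ℝ × ℝ, R ≤ z.2 → φ z = 0

/-- Test functions: smooth functions with compact support in the open periodic domain. -/
structure IsTest (L : ℝ) (γ : ℝ → ℝ) (φ : ℝ × ℝ → ℝ) : Prop extends IsSmoothUpToBdry L φ where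
  supp : tsupport φ ⊆ unrolled γ

/-- `f ∈ L¹_loc` of the open periodic domain. -/
def LocInt (L : ℝ) (γ : ℝ → ℝ) (f : ℝ × ℝ → ℝ) : Prop :=
  ∀ K : Set (ℝ × ℝ), IsCompact K → K ⊆ unrolled γ → IntegrableOn f (K ∩ cell L γ)

/-- `g` is the weak derivative `∂^β f` in the periodic domain. -/
structure IsWeakDeriv (L : ℝ) (γ : ℝ → ℝ) (β : ℕ × ℕ) (f g : ℝ × ℝ → ℝ) : Prop where
  locInt_left : LocInt L γ f
  locInt_right : LocInt L γ g
  integral_eq : ∀ φ : ℝ × ℝ → ℝ, IsTest L γ φ →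
    ∫ z, f z * pderiv β φ z ∂(cellMeasure L γ)
      = (-1) ^ (β.1 + β.2) * ∫ z, g z * φ z ∂(cellMeasure L γ)

/-- `‖∂^β f‖_{L^p}`, equal to `∞` if `f` has no weak derivative `∂^β f`.  (Weak derivatives are
unique almost everywhere, so the infimum runs over copies of a single value.) -/
def derivNorm (L : ℝ) (γ : ℝ → ℝ) (p : ℝ≥0∞) (β : ℕ × ℕ) (f : ℝ × ℝ → ℝ) : ℝ≥0∞ :=
  ⨅ g : ℝ × ℝ → ℝ, ⨅ _ : IsWeakDeriv L γ β f g, eLpNorm g p (cellMeasure L γ)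

/-- The norm of `H^k`, `k ≥ 0`:  `(∑_{|β| ≤ k} ‖∂^β f‖²_{L²})^{1/2}`; it is finite exactly when
`f ∈ H^k`. -/
def sobolevNorm (L : ℝ) (γ : ℝ → ℝ) (k : ℕ) (f : ℝ × ℝ → ℝ) : ℝ≥0∞ :=
  (∑ j ∈ Finset.range (k + 1), ∑ β ∈ Finset.HasAntidiagonal.antidiagonal j,
    derivNorm L γ 2 β f ^ 2) ^ (1 / 2 : ℝ)

/-- The norm of `H^s` for an integer `s`; for `s = -m < 0` it is the norm of the dual of the
closure of the test functions in `H^m`. -/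
def hNorm (L : ℝ) (γ : ℝ → ℝ) : ℤ → (ℝ × ℝ → ℝ) → ℝ≥0∞
  | Int.ofNat k, f => sobolevNorm L γ k f
  | Int.negSucc k, f =>
      ⨆ φ : ℝ × ℝ → ℝ, ⨆ _ : IsTest L γ φ, ⨆ _ : sobolevNorm L γ (k + 1) φ ≤ 1,
        ENNReal.ofReal |∫ z, f z * φ z ∂(cellMeasure L γ)|

/-- The norm of `H^s` for vector fields. -/
def hNormVec (L : ℝ) (γ : ℝ → ℝ) (s : ℤ) (v : ℝ × ℝ → ℝ × ℝ) : ℝ≥0∞ :=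
  (hNorm L γ s (fun z => (v z).1) ^ 2 + hNorm L γ s (fun z => (v z).2) ^ 2) ^ (1 / 2 : ℝ)

/-- `max_{i} max_{|β| = j} ‖∂^β v_i‖_{L^∞}`. -/
def derivSup (L : ℝ) (γ : ℝ → ℝ) (j : ℕ) (v : ℝ × ℝ → ℝ × ℝ) : ℝ≥0∞ :=
  (Finset.HasAntidiagonal.antidiagonal j).sup fun β =>
    max (derivNorm L γ ⊤ β fun z => (v z).1) (derivNorm L γ ⊤ β fun z => (v z).2)

/-- The norm of `W^{1,∞}` for vector fields. -/
def w1InftyNorm (L : ℝ) (γ : ℝ → ℝ) (v : ℝ × ℝ → ℝ × ℝ) : ℝ≥0∞ :=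
  derivSup L γ 0 v + derivSup L γ 1 v

/-- `div v = 0` in the weak sense. -/
structure IsDivFree (L : ℝ) (γ : ℝ → ℝ) (v : ℝ × ℝ → ℝ × ℝ) : Prop where
  locInt_fst : LocInt L γ fun z => (v z).1
  locInt_snd : LocInt L γ fun z => (v z).2
  integral_eq : ∀ φ : ℝ × ℝ → ℝ, IsTest L γ φ →
    ∫ z, ((v z).1 * pd1 φ z + (v z).2 * pd2 φ z) ∂(cellMeasure L γ) = 0

/-- `w = curl v = ∂₁ v₂ - ∂₂ v₁` in the weak sense. -/
structure IsCurl (L : ℝ) (γ : ℝ → ℝ) (v : ℝ × ℝ → ℝ × ℝ) (w : ℝ × ℝ → ℝ) : Prop where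
  locInt_fst : LocInt L γ fun z => (v z).1
  locInt_snd : LocInt L γ fun z => (v z).2
  locInt_curl : LocInt L γ w
  integral_eq : ∀ φ : ℝ × ℝ → ℝ, IsTest L γ φ →
    ∫ z, w z * φ z ∂(cellMeasure L γ)
      = - ∫ z, ((v z).2 * pd1 φ z - (v z).1 * pd2 φ z) ∂(cellMeasure L γ)

/-- `g` is the trace of `f ∈ H¹` on the boundary `z₂ = γ(z₁)`, parametrised by `z₁ ∈ [0, L)`:
`f` is the limit in `H¹` of functions smooth up to the boundary whose restrictions to the boundary
converge to `g` in `L²`.  (The length element `√(1 + γ'²) dz₁` and `dz₁` define the same `L²`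
space of the boundary, as `γ'` is bounded.) -/
def IsTrace (L : ℝ) (γ : ℝ → ℝ) (f : ℝ × ℝ → ℝ) (g : ℝ → ℝ) : Prop :=
  MemLp g 2 (volume.restrict (Set.Ico 0 L)) ∧
  ∃ F : ℕ → ℝ × ℝ → ℝ, (∀ n, IsSmoothUpToBdry L (F n)) ∧
    Tendsto (fun n => sobolevNorm L γ 1 (fun z => f z - F n z)) atTop (𝓝 0) ∧
    Tendsto (fun n => eLpNorm (fun s => F n (s, γ s) - g s) 2 (volume.restrict (Set.Ico 0 L)))
      atTop (𝓝 0)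

/-- The unit normal `n = (-γ', 1) / √(1 + γ'²)` at the boundary point `(s, γ(s))`. -/
def unitNormal (γ : ℝ → ℝ) (s : ℝ) : ℝ × ℝ :=
  (-deriv γ s / √(1 + deriv γ s ^ 2), 1 / √(1 + deriv γ s ^ 2))

/-- `v · n = 0` on the boundary, in the sense of traces. -/
def IsTangent (L : ℝ) (γ : ℝ → ℝ) (v : ℝ × ℝ → ℝ × ℝ) : Prop :=
  ∃ g₁ g₂ : ℝ → ℝ, IsTrace L γ (fun z => (v z).1) g₁ ∧ IsTrace L γ (fun z => (v z).2) g₂ ∧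
    ∀ᵐ s ∂(volume.restrict (Set.Ico 0 L)),
      g₁ s * (unitNormal γ s).1 + g₂ s * (unitNormal γ s).2 = 0

/-- The boundary profile `z₁ ↦ ε^α η(z₁)` of the rescaled rough domain. -/
def profile (η : ℝ → ℝ) (α ε : ℝ) : ℝ → ℝ := fun s => ε ^ α * η s

end

end RoughDomain

open RoughDomain

namespace RoughDomain

noncomputable section

section

/-! ### Calculus of the partial derivatives `pd1`, `pd2` -/

/-! Write γ = ε^α η and L = 1/ε; as L is an integer, γ is L-periodic. The shear (y₁, y₂) ↦ (y₁, y₂ +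
γ(y₁)) maps the flat periodic half plane onto the rough domain with Jacobian one. In flat
coordinates put V₁ = v₁ and V₂ = v₂ - γ' v₁. This field is again divergence free, V₂ = 0 on the
boundary is the condition v · n = 0, and ∂₁V₂ - ∂₂V₁ = w - γ'' V₁ - 2γ' ∂₁V₁ + γ'² ∂₂V₁
(`exists_flatField`). For small ε the coefficients of the first order terms are small, and all
derivatives of the coefficients are bounded uniformly in ε (`exists_goodProfile`).

Estimates in H^k. Since V₂ = 0 on the boundary, ∫ ∂₁V₁ ∂₂V₂ = ∫ ∂₂V₁ ∂₁V₂; with zero divergence this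
gives ‖∇V‖ = ‖curl V‖ in L² (`norm_sq_of_divCurl`), and the small first order terms are absorbed.
Horizontal translations respect the half plane, the boundary condition and the equations, so
difference quotients yield the regularity of ∂₁∇V (`FlatSystem.exists_weakDeriv`). The vertical
derivatives follow from ∂₂∂₁ = ∂₁∂₂, from the divergence and from the curl equation, which is
solvable for ∂₂V₁ because 1 + γ'² is invertible. Induction on the order gives
`FlatSystem.sobolevBound`, and the shear carries the bound back (`sobolevBound_of_curl`). The case k
= 0 is trivial, the L² norm of v being on the right.

Estimate of ∇v in L^∞. Reflect V₁ evenly and V₂ oddly across the boundary and extend periodically;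
after mollification this gives a smooth field U on the plane with zero divergence and bounded curl
W. Then ΔU is the rotated gradient of W, so ∂₁U is a singular integral of W. In place of the
singular integral, consider the means m(t) of ∂₁U against a radial kernel at scale t: the derivative
t m'(t) is a multiple of ‖W‖_∞, since two derivatives of W move to a potential of the kernel. So
passing from scale δ to scale T costs ‖W‖_∞ log(T/δ). Below δ the Hölder-1/2 bound of ∂₁U, and above
T the decay of the mean of a derivative, cost X √δ and X / T, where X is the H³ norm
(`RadialKernel.abs_mul_integral_le`, `exists_planeField_bound`). With T = r, δ = r⁻² and r of size 1
+ X/ε² both errors are of order ε², and the logarithm is the one claimed (`exists_scales`). Finally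
curl V differs from w by products of γ', γ'' with v and ∇v, which produces the term ε^α
‖v‖_{W^{1,∞}} (`gradient_bound_of_flat`). -/

theorem contDiff_pd1 {φ : ℝ × ℝ → ℝ} (h : ContDiff ℝ ∞ φ) : ContDiff ℝ ∞ (pd1 φ) :=
  (h.fderiv_right (m := ∞) (by simp)).clm_apply contDiff_const

theorem contDiff_pd2 {φ : ℝ × ℝ → ℝ} (h : ContDiff ℝ ∞ φ) : ContDiff ℝ ∞ (pd2 φ) :=
  (h.fderiv_right (m := ∞) (by simp)).clm_apply contDiff_const

theorem differentiable_of_smooth {φ : ℝ × ℝ → ℝ} (h : ContDiff ℝ ∞ φ) : Differentiable ℝ φ :=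
  h.differentiable (by simp)

theorem hasDerivAt_pd1 {φ : ℝ × ℝ → ℝ} (h : ContDiff ℝ ∞ φ) (x y : ℝ) :
    HasDerivAt (fun s => φ (s, y)) (pd1 φ (x, y)) x := by
  have h1 : HasDerivAt (fun s : ℝ => (s, y)) ((1 : ℝ), (0 : ℝ)) x :=
    (hasDerivAt_id x).prodMk (hasDerivAt_const x y)
  exact (differentiable_of_smooth h (x, y)).hasFDerivAt.comp_hasDerivAt x h1

theorem hasDerivAt_pd2 {φ : ℝ × ℝ → ℝ} (h : ContDiff ℝ ∞ φ) (x y : ℝ) :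
    HasDerivAt (fun s => φ (x, s)) (pd2 φ (x, y)) y := by
  have h1 : HasDerivAt (fun s : ℝ => (x, s)) ((0 : ℝ), (1 : ℝ)) y :=
    (hasDerivAt_const y x).prodMk (hasDerivAt_id y)
  exact (differentiable_of_smooth h (x, y)).hasFDerivAt.comp_hasDerivAt y h1

theorem hasDerivAt_path {φ : ℝ × ℝ → ℝ} (h : ContDiff ℝ ∞ φ) {p q : ℝ → ℝ} {p' q' t : ℝ}
    (hp : HasDerivAt p p' t) (hq : HasDerivAt q q' t) :
    HasDerivAt (fun s => φ (p s, q s))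
      (p' * pd1 φ (p t, q t) + q' * pd2 φ (p t, q t)) t := by
  have h1 := (differentiable_of_smooth h (p t, q t)).hasFDerivAt.comp_hasDerivAt t (hp.prodMk hq)
  have h2 : fderiv ℝ φ (p t, q t) (p', q')
      = p' * pd1 φ (p t, q t) + q' * pd2 φ (p t, q t) := by
    have : ((p', q') : ℝ × ℝ) = p' • ((1 : ℝ), (0 : ℝ)) + q' • ((0 : ℝ), (1 : ℝ)) := by simp
    rw [this, map_add, map_smul, map_smul]; rfl
  rw [h2] at h1
  exact h1

theorem pd1_eq {φ : ℝ × ℝ → ℝ} (h : ContDiff ℝ ∞ φ) {x y d : ℝ}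
    (hd : HasDerivAt (fun s => φ (s, y)) d x) : pd1 φ (x, y) = d :=
  (hasDerivAt_pd1 h x y).unique hd

theorem pd2_eq {φ : ℝ × ℝ → ℝ} (h : ContDiff ℝ ∞ φ) {x y d : ℝ}
    (hd : HasDerivAt (fun s => φ (x, s)) d y) : pd2 φ (x, y) = d :=
  (hasDerivAt_pd2 h x y).unique hd

theorem pd_comm {φ : ℝ × ℝ → ℝ} (h : ContDiff ℝ ∞ φ) : pd1 (pd2 φ) = pd2 (pd1 φ) := by
  funext z
  have hd : DifferentiableAt ℝ (fderiv ℝ φ) z :=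
    ((h.fderiv_right (m := ∞) (by simp)).differentiable (by simp)) z
  have hs : IsSymmSndFDerivAt ℝ φ z :=
    (h.contDiffAt (x := z)).isSymmSndFDerivAt (by
      simp only [minSmoothness_of_isRCLikeNormedField]; exact WithTop.coe_le_coe.2 le_top)
  have e1 : pd1 (pd2 φ) z = fderiv ℝ (fderiv ℝ φ) z (1, 0) (0, 1) := by
    change fderiv ℝ (fun y => fderiv ℝ φ y (0, 1)) z (1, 0) = _
    rw [fderiv_clm_apply hd (differentiableAt_const _)]
    simp
  have e2 : pd2 (pd1 φ) z = fderiv ℝ (fderiv ℝ φ) z (0, 1) (1, 0) := by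
    change fderiv ℝ (fun y => fderiv ℝ φ y (1, 0)) z (0, 1) = _
    rw [fderiv_clm_apply hd (differentiableAt_const _)]
    simp
  rw [e1, e2]; exact hs.eq _ _

theorem pd1_add {φ ψ : ℝ × ℝ → ℝ} (h : ContDiff ℝ ∞ φ) (h' : ContDiff ℝ ∞ ψ) :
    pd1 (fun z => φ z + ψ z) = fun z => pd1 φ z + pd1 ψ z := by
  funext ⟨x, y⟩
  exact pd1_eq (h.add h') ((hasDerivAt_pd1 h x y).add (hasDerivAt_pd1 h' x y))

theorem pd2_add {φ ψ : ℝ × ℝ → ℝ} (h : ContDiff ℝ ∞ φ) (h' : ContDiff ℝ ∞ ψ) :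
    pd2 (fun z => φ z + ψ z) = fun z => pd2 φ z + pd2 ψ z := by
  funext ⟨x, y⟩
  exact pd2_eq (h.add h') ((hasDerivAt_pd2 h x y).add (hasDerivAt_pd2 h' x y))

theorem pd1_const_mul {φ : ℝ × ℝ → ℝ} (h : ContDiff ℝ ∞ φ) (c : ℝ) :
    pd1 (fun z => c * φ z) = fun z => c * pd1 φ z := by
  funext ⟨x, y⟩
  exact pd1_eq (contDiff_const.mul h) ((hasDerivAt_pd1 h x y).const_mul c)

theorem pd2_const_mul {φ : ℝ × ℝ → ℝ} (h : ContDiff ℝ ∞ φ) (c : ℝ) :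
    pd2 (fun z => c * φ z) = fun z => c * pd2 φ z := by
  funext ⟨x, y⟩
  exact pd2_eq (contDiff_const.mul h) ((hasDerivAt_pd2 h x y).const_mul c)

theorem pd1_mul {φ ψ : ℝ × ℝ → ℝ} (h : ContDiff ℝ ∞ φ) (h' : ContDiff ℝ ∞ ψ) :
    pd1 (fun z => φ z * ψ z) = fun z => pd1 φ z * ψ z + φ z * pd1 ψ z := by
  funext ⟨x, y⟩
  exact pd1_eq (h.mul h') ((hasDerivAt_pd1 h x y).mul (hasDerivAt_pd1 h' x y))

theorem pd2_mul {φ ψ : ℝ × ℝ → ℝ} (h : ContDiff ℝ ∞ φ) (h' : ContDiff ℝ ∞ ψ) :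
    pd2 (fun z => φ z * ψ z) = fun z => pd2 φ z * ψ z + φ z * pd2 ψ z := by
  funext ⟨x, y⟩
  exact pd2_eq (h.mul h') ((hasDerivAt_pd2 h x y).mul (hasDerivAt_pd2 h' x y))

theorem contDiff_comp_fst {c : ℝ → ℝ} (hc : ContDiff ℝ ∞ c) :
    ContDiff ℝ ∞ (fun z : ℝ × ℝ => c z.1) := hc.comp contDiff_fst

theorem hasDerivAt_of_smooth {c : ℝ → ℝ} (hc : ContDiff ℝ ∞ c) (x : ℝ) :
    HasDerivAt c (deriv c x) x :=
  (hc.differentiable (by simp) x).hasDerivAt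

theorem contDiff_deriv {c : ℝ → ℝ} (hc : ContDiff ℝ ∞ c) : ContDiff ℝ ∞ (deriv c) := by
  have := (contDiff_infty_iff_deriv (𝕜 := ℝ)).1 hc
  exact this.2

theorem pd1_comp_fst {c : ℝ → ℝ} (hc : ContDiff ℝ ∞ c) :
    pd1 (fun z : ℝ × ℝ => c z.1) = fun z => deriv c z.1 := by
  funext ⟨x, y⟩
  exact pd1_eq (contDiff_comp_fst hc) (hasDerivAt_of_smooth hc x)

theorem pd2_comp_fst {c : ℝ → ℝ} (hc : ContDiff ℝ ∞ c) :
    pd2 (fun z : ℝ × ℝ => c z.1) = fun _ => 0 := by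
  funext ⟨x, y⟩
  exact pd2_eq (contDiff_comp_fst hc) (hasDerivAt_const y (c x))

/-- The shear `(y₁, y₂) ↦ (y₁, y₂ + κ(y₁))`. -/
def shear (κ : ℝ → ℝ) (z : ℝ × ℝ) : ℝ × ℝ := (z.1, z.2 + κ z.1)

theorem contDiff_shear {κ : ℝ → ℝ} (hκ : ContDiff ℝ ∞ κ) : ContDiff ℝ ∞ (shear κ) :=
  contDiff_fst.prodMk (contDiff_snd.add (contDiff_comp_fst hκ))

theorem shear_neg_shear (κ : ℝ → ℝ) (z : ℝ × ℝ) : shear (-κ) (shear κ z) = z := by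
  simp [shear]

theorem shear_shear_neg (κ : ℝ → ℝ) (z : ℝ × ℝ) : shear κ (shear (-κ) z) = z := by
  simp [shear]

theorem pd1_shear {φ : ℝ × ℝ → ℝ} {κ : ℝ → ℝ} (h : ContDiff ℝ ∞ φ) (hκ : ContDiff ℝ ∞ κ) :
    pd1 (fun z => φ (shear κ z))
      = fun z => pd1 φ (shear κ z) + deriv κ z.1 * pd2 φ (shear κ z) := by
  funext ⟨x, y⟩
  refine pd1_eq (h.comp (contDiff_shear hκ)) ?_
  have := hasDerivAt_path h (hasDerivAt_id x) ((hasDerivAt_of_smooth hκ x).const_add y)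
  simpa [shear] using this

theorem pd2_shear {φ : ℝ × ℝ → ℝ} {κ : ℝ → ℝ} (h : ContDiff ℝ ∞ φ) (hκ : ContDiff ℝ ∞ κ) :
    pd2 (fun z => φ (shear κ z)) = fun z => pd2 φ (shear κ z) := by
  funext ⟨x, y⟩
  refine pd2_eq (h.comp (contDiff_shear hκ)) ?_
  have := hasDerivAt_path h (hasDerivAt_const y x) ((hasDerivAt_id y).add_const (κ x))
  simpa [shear] using this

theorem contDiff_affine {φ : ℝ × ℝ → ℝ} (h : ContDiff ℝ ∞ φ) (a b c d : ℝ) :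
    ContDiff ℝ ∞ (fun z : ℝ × ℝ => φ (a + b * z.1, c + d * z.2)) :=
  h.comp ((contDiff_const.add (contDiff_const.mul contDiff_fst)).prodMk
    (contDiff_const.add (contDiff_const.mul contDiff_snd)))

theorem pd1_affine {φ : ℝ × ℝ → ℝ} (h : ContDiff ℝ ∞ φ) (a b c d : ℝ) :
    pd1 (fun z : ℝ × ℝ => φ (a + b * z.1, c + d * z.2))
      = fun z => b * pd1 φ (a + b * z.1, c + d * z.2) := by
  funext ⟨x, y⟩
  refine pd1_eq (contDiff_affine h a b c d) ?_
  have := hasDerivAt_path h (((hasDerivAt_id x).const_mul b).const_add a)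
    (hasDerivAt_const x (c + d * y))
  simpa using this

theorem pd2_affine {φ : ℝ × ℝ → ℝ} (h : ContDiff ℝ ∞ φ) (a b c d : ℝ) :
    pd2 (fun z : ℝ × ℝ => φ (a + b * z.1, c + d * z.2))
      = fun z => d * pd2 φ (a + b * z.1, c + d * z.2) := by
  funext ⟨x, y⟩
  refine pd2_eq (contDiff_affine h a b c d) ?_
  have := hasDerivAt_path h (hasDerivAt_const y (a + b * x))
    (((hasDerivAt_id y).const_mul d).const_add c)
  simpa using this

theorem tsupport_pd1_subset (φ : ℝ × ℝ → ℝ) : tsupport (pd1 φ) ⊆ tsupport φ := by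
  refine (closure_mono ?_).trans (tsupport_fderiv_subset ℝ (f := φ))
  intro z hz h0
  apply hz
  have : fderiv ℝ φ z = 0 := h0
  simp [pd1, this]

theorem tsupport_pd2_subset (φ : ℝ × ℝ → ℝ) : tsupport (pd2 φ) ⊆ tsupport φ := by
  refine (closure_mono ?_).trans (tsupport_fderiv_subset ℝ (f := φ))
  intro z hz h0
  apply hz
  have : fderiv ℝ φ z = 0 := h0
  simp [pd2, this]

/-! ### Closure properties of smooth functions and test functions -/

variable {L : ℝ} {γ : ℝ → ℝ}

namespace IsSmoothUpToBdry

variable {φ ψ : ℝ × ℝ → ℝ}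

theorem shift1 (h : IsSmoothUpToBdry L φ) (t : ℝ) :
    IsSmoothUpToBdry L (fun z => φ (z.1 + t, z.2)) where
  smooth := by simpa [add_comm] using contDiff_affine h.smooth t 1 0 1
  periodic z := by
    have := h.periodic (z.1 + t, z.2)
    simpa [add_right_comm] using this
  bounded_supp := h.bounded_supp.imp fun R hR z hz => hR _ hz

theorem pd1_shift (h : ContDiff ℝ ∞ φ) (t : ℝ) :
    pd1 (fun z => φ (z.1 + t, z.2)) = fun z => pd1 φ (z.1 + t, z.2) := by
  simpa [add_comm] using pd1_affine h t 1 0 1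

theorem pd2_shift (h : ContDiff ℝ ∞ φ) (t : ℝ) :
    pd2 (fun z => φ (z.1 + t, z.2)) = fun z => pd2 φ (z.1 + t, z.2) := by
  simpa [add_comm] using pd2_affine h t 1 0 1

theorem pd1 (h : IsSmoothUpToBdry L φ) : IsSmoothUpToBdry L (pd1 φ) where
  smooth := contDiff_pd1 h.smooth
  periodic z := by
    have e := pd1_shift h.smooth L
    have e' : (fun z : ℝ × ℝ => φ (z.1 + L, z.2)) = φ := funext h.periodic
    rw [e'] at e
    exact (congrFun e z).symm
  bounded_supp := by
    obtain ⟨R, hR⟩ := h.bounded_supp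
    refine ⟨R, fun ⟨x, y⟩ hz => pd1_eq h.smooth ?_⟩
    have : (fun s => φ (s, y)) = fun _ => 0 := funext fun s => hR (s, y) hz
    rw [this]; exact hasDerivAt_const _ _

theorem pd2 (h : IsSmoothUpToBdry L φ) : IsSmoothUpToBdry L (pd2 φ) where
  smooth := contDiff_pd2 h.smooth
  periodic z := by
    have e := pd2_shift h.smooth L
    have e' : (fun z : ℝ × ℝ => φ (z.1 + L, z.2)) = φ := funext h.periodic
    rw [e'] at e
    exact (congrFun e z).symm
  bounded_supp := by
    obtain ⟨R, hR⟩ := h.bounded_supp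
    refine ⟨R + 1, fun ⟨x, y⟩ hz => pd2_eq h.smooth ?_⟩
    have : (fun s => φ (x, s)) =ᶠ[𝓝 y] fun _ => 0 := by
      filter_upwards [eventually_gt_nhds (show R < y by dsimp at hz; linarith)] with s hs
      exact hR (x, s) hs.le
    exact (hasDerivAt_const y (0 : ℝ)).congr_of_eventuallyEq this

theorem add (h : IsSmoothUpToBdry L φ) (h' : IsSmoothUpToBdry L ψ) :
    IsSmoothUpToBdry L (fun z => φ z + ψ z) where
  smooth := h.smooth.add h'.smooth
  periodic z := by rw [h.periodic, h'.periodic]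
  bounded_supp := by
    obtain ⟨R, hR⟩ := h.bounded_supp
    obtain ⟨R', hR'⟩ := h'.bounded_supp
    refine ⟨max R R', fun z hz => ?_⟩
    rw [hR z (le_trans (le_max_left _ _) hz), hR' z (le_trans (le_max_right _ _) hz), add_zero]

theorem smooth_mul {c : ℝ × ℝ → ℝ} (hc : ContDiff ℝ ∞ c)
    (hp : ∀ z : ℝ × ℝ, c (z.1 + L, z.2) = c z) (h : IsSmoothUpToBdry L φ) :
    IsSmoothUpToBdry L (fun z => c z * φ z) where
  smooth := hc.mul h.smooth
  periodic z := by rw [h.periodic, hp]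
  bounded_supp := h.bounded_supp.imp fun R hR z hz => by rw [hR z hz, mul_zero]

theorem mul (h : IsSmoothUpToBdry L φ) (h' : IsSmoothUpToBdry L ψ) :
    IsSmoothUpToBdry L (fun z => φ z * ψ z) := smooth_mul h.smooth h.periodic h'

theorem const_mul (h : IsSmoothUpToBdry L φ) (c : ℝ) :
    IsSmoothUpToBdry L (fun z => c * φ z) :=
  smooth_mul (c := fun _ => c) contDiff_const (fun _ => rfl) h

theorem coeff_mul {c : ℝ → ℝ} (hc : ContDiff ℝ ∞ c) (hp : ∀ x, c (x + L) = c x)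
    (h : IsSmoothUpToBdry L φ) : IsSmoothUpToBdry L (fun z => c z.1 * φ z) :=
  smooth_mul (contDiff_comp_fst hc) (fun _ => hp _) h

/-- A periodic function bounded above on bounded sets is bounded above. -/
theorem _root_.RoughDomain.exists_bound_of_periodic {c : ℝ → ℝ} (hL : 0 < L) (hc : Continuous c)
    (hp : ∀ x, c (x + L) = c x) : ∃ A, ∀ x, |c x| ≤ A := by
  obtain ⟨A, hA⟩ := isCompact_Icc.exists_bound_of_continuousOn (s := Set.Icc 0 L) hc.continuousOn
  refine ⟨A, fun x => ?_⟩
  have hp' : Function.Periodic c L := hp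
  obtain ⟨y, hy, e⟩ := hp'.exists_mem_Ico₀ hL x
  rw [e]; exact hA y ⟨hy.1, hy.2.le⟩

theorem comp_shear (hL : 0 < L) {κ : ℝ → ℝ} (hκ : ContDiff ℝ ∞ κ) (hp : ∀ x, κ (x + L) = κ x)
    (h : IsSmoothUpToBdry L φ) : IsSmoothUpToBdry L (fun z => φ (shear κ z)) where
  smooth := h.smooth.comp (contDiff_shear hκ)
  periodic z := by
    have := h.periodic (shear κ z)
    simpa [shear, hp] using this
  bounded_supp := by
    obtain ⟨R, hR⟩ := h.bounded_supp
    obtain ⟨A, hA⟩ := exists_bound_of_periodic hL hκ.continuous hp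
    refine ⟨R + A, fun z hz => hR _ ?_⟩
    have := (abs_le.1 (hA z.1)).1
    simp only [shear]; linarith

/-- Periodicity and vanishing for large z₂ leave a compact rectangle. A lower bound on z₂ is needed
because nothing is known about φ as z₂ → -∞. -/
theorem exists_bound (hL : 0 < L) (h : IsSmoothUpToBdry L φ) (b : ℝ) :
    ∃ C, 0 ≤ C ∧ ∀ z : ℝ × ℝ, b ≤ z.2 → |φ z| ≤ C := by
  obtain ⟨R, hR⟩ := h.bounded_supp
  obtain ⟨A, hA⟩ := (isCompact_Icc.prod isCompact_Icc).exists_bound_of_continuousOn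
    (s := Set.Icc 0 L ×ˢ Set.Icc b R) h.smooth.continuous.continuousOn
  refine ⟨max A 0, le_max_right _ _, fun z hz => ?_⟩
  have hp' : Function.Periodic (fun x => φ (x, z.2)) L := fun x => h.periodic (x, z.2)
  obtain ⟨y, hy, e⟩ := hp'.exists_mem_Ico₀ hL z.1
  have e' : φ z = φ (y, z.2) := e
  rcases le_or_gt R z.2 with h1 | h1
  · rw [hR z h1]; simp
  · rw [e']; exact (hA (y, z.2) ⟨⟨hy.1, hy.2.le⟩, hz, h1.le⟩).trans (le_max_left _ _)

end IsSmoothUpToBdry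

namespace IsTest

variable {φ ψ : ℝ × ℝ → ℝ}

theorem of_support {c : ℝ × ℝ → ℝ} (h : IsTest L γ φ) (hs : IsSmoothUpToBdry L c)
    (hc : tsupport c ⊆ tsupport φ) : IsTest L γ c :=
  ⟨hs, hc.trans h.supp⟩

theorem pd1 (h : IsTest L γ φ) : IsTest L γ (pd1 φ) :=
  h.of_support h.toIsSmoothUpToBdry.pd1 (tsupport_pd1_subset φ)

theorem pd2 (h : IsTest L γ φ) : IsTest L γ (pd2 φ) :=
  h.of_support h.toIsSmoothUpToBdry.pd2 (tsupport_pd2_subset φ)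

theorem add (h : IsTest L γ φ) (h' : IsTest L γ ψ) : IsTest L γ (fun z => φ z + ψ z) :=
  ⟨h.toIsSmoothUpToBdry.add h'.toIsSmoothUpToBdry,
    (tsupport_add φ ψ).trans (Set.union_subset h.supp h'.supp)⟩

theorem smooth_mul {c : ℝ × ℝ → ℝ} (hc : ContDiff ℝ ∞ c)
    (hp : ∀ z : ℝ × ℝ, c (z.1 + L, z.2) = c z) (h : IsTest L γ φ) :
    IsTest L γ (fun z => c z * φ z) :=
  h.of_support (h.toIsSmoothUpToBdry.smooth_mul hc hp) (tsupport_mul_subset_right (f := c))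

theorem const_mul (h : IsTest L γ φ) (c : ℝ) : IsTest L γ (fun z => c * φ z) :=
  smooth_mul (c := fun _ => c) contDiff_const (fun _ => rfl) h

theorem coeff_mul {c : ℝ → ℝ} (hc : ContDiff ℝ ∞ c) (hp : ∀ x, c (x + L) = c x)
    (h : IsTest L γ φ) : IsTest L γ (fun z => c z.1 * φ z) :=
  smooth_mul (contDiff_comp_fst hc) (fun _ => hp _) h

theorem zero : IsTest L γ (fun _ => 0) :=
  ⟨⟨contDiff_const, fun _ => rfl, 0, fun _ _ => rfl⟩, by simp [tsupport]⟩

theorem comp_shear (hL : 0 < L) {κ : ℝ → ℝ} (hκ : ContDiff ℝ ∞ κ) (hp : ∀ x, κ (x + L) = κ x)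
    (h : IsTest L (γ + κ) φ) : IsTest L γ (fun z => φ (shear κ z)) := by
  refine ⟨h.toIsSmoothUpToBdry.comp_shear hL hκ hp, fun z hz => ?_⟩
  have h1 : shear κ z ∈ tsupport φ :=
    tsupport_comp_subset_preimage φ (contDiff_shear hκ).continuous hz
  have h2 := h.supp h1
  simpa [unrolled, shear] using h2

theorem shift1 (h : IsTest L 0 φ) (t : ℝ) : IsTest L 0 (fun z => φ (z.1 + t, z.2)) := by
  refine ⟨h.toIsSmoothUpToBdry.shift1 t, fun z hz => ?_⟩
  have h1 : (z.1 + t, z.2) ∈ tsupport φ :=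
    tsupport_comp_subset_preimage φ (f := fun z : ℝ × ℝ => (z.1 + t, z.2)) (by fun_prop) hz
  have h2 := h.supp h1
  exact h2

end IsTest

end

section

variable {L : ℝ} {γ : ℝ → ℝ}

/-! ### Cell measures, shears and shifts -/

theorem measurableSet_cell (hγ : Continuous γ) : MeasurableSet (cell L γ) := by
  have h1 : MeasurableSet {z : ℝ × ℝ | 0 ≤ z.1} := measurableSet_le measurable_const measurable_fst
  have h2 : MeasurableSet {z : ℝ × ℝ | z.1 < L} := measurableSet_lt measurable_fst measurable_const
  have h3 : MeasurableSet {z : ℝ × ℝ | γ z.1 < z.2} :=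
    measurableSet_lt (hγ.measurable.comp measurable_fst) measurable_snd
  exact h1.inter (h2.inter h3)

theorem ae_mem_cell (hγ : Continuous γ) : ∀ᵐ z ∂cellMeasure L γ, z ∈ cell L γ :=
  ae_restrict_mem (measurableSet_cell hγ)

theorem cell_zero : cell L 0 = Set.Ico 0 L ×ˢ Set.Ioi 0 := by
  ext z; simp [cell, and_assoc]

theorem cellMeasure_zero :
    cellMeasure L 0 = (volume.restrict (Set.Ico 0 L)).prod (volume.restrict (Set.Ioi 0)) := by
  rw [cellMeasure, cell_zero, Measure.prod_restrict]; rfl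

/-- A shear is a skew product of the identity with translations of the fibres. Hence flattening the
boundary leaves all L^p norms unchanged. -/
theorem measurePreserving_shear_volume {κ : ℝ → ℝ} (hκ : Continuous κ) :
    MeasurePreserving (shear κ) volume volume := by
  have h := (MeasurePreserving.id (volume : Measure ℝ)).skew_product
    (μc := (volume : Measure ℝ)) (μd := volume) (g := fun x y : ℝ => y + κ x)
    (by fun_prop) (ae_of_all _ fun x => (measurePreserving_add_right volume (κ x)).map_eq)
  exact h

theorem measurePreserving_shear {κ : ℝ → ℝ} (hγ : Continuous γ) (hκ : Continuous κ) :
    MeasurePreserving (shear κ) (cellMeasure L γ) (cellMeasure L (γ + κ)) := by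
  have h := (measurePreserving_shear_volume hκ).restrict_preimage
    (measurableSet_cell (L := L) (hγ.add hκ))
  have e : shear κ ⁻¹' cell L (γ + κ) = cell L γ := by
    ext z; simp [cell, shear]
  rw [e] at h
  exact h

/-- The shear as a homeomorphism. -/
def shearHomeo {κ : ℝ → ℝ} (hκ : Continuous κ) : ℝ × ℝ ≃ₜ ℝ × ℝ where
  toFun := shear κ
  invFun := shear (-κ)
  left_inv := shear_neg_shear κ
  right_inv := shear_shear_neg κ
  continuous_toFun := by unfold shear; fun_prop
  continuous_invFun := by unfold shear; simp only [Pi.neg_apply]; fun_prop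

theorem measurableEmbedding_shear {κ : ℝ → ℝ} (hκ : Continuous κ) :
    MeasurableEmbedding (shear κ) := (shearHomeo hκ).measurableEmbedding

/-- The representative of `x` modulo `L` in `[0, L)`. -/
def wrap (L x : ℝ) : ℝ := Int.fract (x / L) * L

theorem wrap_of_mem {x : ℝ} (hx : x ∈ Set.Ico 0 L) : wrap L x = x := by
  have hL : 0 < L := hx.1.trans_lt hx.2
  rw [wrap, Int.fract_eq_self.2 ⟨by have := hx.1; positivity, (div_lt_one hL).2 hx.2⟩,
    div_mul_cancel₀ _ hL.ne']

theorem wrap_eq_sub (hL : 0 < L) (x : ℝ) : wrap L x = x - ⌊x / L⌋ * L := by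
  rw [wrap, Int.fract, sub_mul, div_mul_cancel₀ _ hL.ne']

theorem measurable_wrap : Measurable (wrap L) := by
  unfold wrap; exact (measurable_fract.comp (measurable_id.div_const L)).mul_const L

theorem apply_wrap {α : Type*} (hL : 0 < L) {c : ℝ → α} (hp : ∀ x, c (x + L) = c x) (x : ℝ) :
    c (wrap L x) = c x := by
  have hp' : Function.Periodic c L := hp
  rw [wrap_eq_sub hL]
  have := hp'.sub_zsmul_eq (x := x) ⌊x / L⌋
  simpa using this

theorem wrap_add_period (hL : 0 < L) (x : ℝ) (k : ℤ) : wrap L (x + k * L) = wrap L x := by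
  rw [wrap, wrap, add_div, mul_div_cancel_right₀ _ hL.ne', Int.fract_add_intCast]

/-- On the circle ℝ/Lℤ this is invariance of Haar measure under rotation; [0, L) is a fundamental
domain. -/
theorem measurePreserving_wrap_add (hL : 0 < L) (t : ℝ) :
    MeasurePreserving (fun x => wrap L (x + t)) (volume.restrict (Set.Ico 0 L))
      (volume.restrict (Set.Ico 0 L)) := by
  have : Fact (0 < L) := ⟨hL⟩
  have h1 : MeasurePreserving ((↑) : ℝ → AddCircle L) (volume.restrict (Set.Ico 0 L)) volume := by
    have := AddCircle.measurePreserving_mk L 0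
    rwa [zero_add, ← Measure.restrict_congr_set Ico_ae_eq_Ioc] at this
  have h2 := measurePreserving_add_right (volume : Measure (AddCircle L)) (t : AddCircle L)
  have h3 : Measurable (fun θ : AddCircle L => ((AddCircle.equivIco L 0 θ : Set.Ico 0 (0 + L)) : ℝ)) :=
    measurable_subtype_coe.comp (AddCircle.measurableEquivIco L 0).measurable
  have e : ∀ x : ℝ, ((AddCircle.equivIco L 0 (x : AddCircle L) : Set.Ico 0 (0 + L)) : ℝ)
      = wrap L x := fun x => AddCircle.coe_equivIco_mk_apply L x
  have h4 : MeasurePreserving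
      (fun θ : AddCircle L => ((AddCircle.equivIco L 0 θ : Set.Ico 0 (0 + L)) : ℝ))
      volume (volume.restrict (Set.Ico 0 L)) := by
    refine ⟨h3, ?_⟩
    rw [← h1.map_eq, Measure.map_map h3 h1.measurable]
    have : (fun θ : AddCircle L => ((AddCircle.equivIco L 0 θ : Set.Ico 0 (0 + L)) : ℝ)) ∘
        ((↑) : ℝ → AddCircle L) =ᵐ[volume.restrict (Set.Ico 0 L)] id := by
      filter_upwards [ae_restrict_mem measurableSet_Ico] with x hx
      simp only [Function.comp, e, wrap_of_mem hx, id]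
    rw [Measure.map_congr this, Measure.map_id]
  have h5 := h4.comp (h2.comp h1)
  convert! h5 using 1
  funext x
  simp only [Function.comp]
  rw [← AddCircle.coe_add, e]

/-- The horizontal translation of the periodic half plane. -/
def shift (L t : ℝ) (z : ℝ × ℝ) : ℝ × ℝ := (wrap L (z.1 + t), z.2)

theorem measurePreserving_shift (hL : 0 < L) (t : ℝ) :
    MeasurePreserving (shift L t) (cellMeasure L 0) (cellMeasure L 0) := by
  rw [cellMeasure_zero]
  exact (measurePreserving_wrap_add hL t).prod (MeasurePreserving.id _)

theorem apply_shift {α : Type*} (hL : 0 < L) {φ : ℝ × ℝ → α}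
    (hp : ∀ z : ℝ × ℝ, φ (z.1 + L, z.2) = φ z) (t : ℝ) (z : ℝ × ℝ) :
    φ (shift L t z) = φ (z.1 + t, z.2) :=
  apply_wrap hL (c := fun x => φ (x, z.2)) (fun x => hp (x, z.2)) (z.1 + t)

theorem wrap_wrap_add (hL : 0 < L) (x t : ℝ) : wrap L (wrap L x + t) = wrap L (x + t) := by
  rw [wrap_eq_sub hL x]
  have := wrap_add_period hL (x + t) (-⌊x / L⌋)
  rw [← this]; congr 1; push_cast; ring

theorem shift_shift (hL : 0 < L) (s t : ℝ) (z : ℝ × ℝ) :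
    shift L t (shift L s z) = shift L (s + t) z := by
  simp only [shift, wrap_wrap_add hL, add_assoc]

theorem shift_zero {z : ℝ × ℝ} (hz : z ∈ cell L 0) : shift L 0 z = z := by
  simp [shift, wrap_of_mem (⟨hz.1, hz.2.1⟩ : z.1 ∈ Set.Ico 0 L)]

/-! ### Integrability -/

/-- Within the cell, γ is bounded below on [0, L], so f lives on a rectangle of finite measure. -/
theorem memLp_of_bound_of_supp (hγ : Continuous γ) {f : ℝ × ℝ → ℝ} {R C : ℝ} (hf : Measurable f)
    (hR : ∀ z ∈ cell L γ, R ≤ z.2 → f z = 0) (hC : ∀ z ∈ cell L γ, |f z| ≤ C) (p : ℝ≥0∞) :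
    MemLp f p (cellMeasure L γ) := by
  obtain ⟨A, hA⟩ := isCompact_Icc.exists_bound_of_continuousOn (s := Set.Icc 0 L) hγ.continuousOn
  set B : Set (ℝ × ℝ) := Set.Icc 0 L ×ˢ Set.Icc (-A) R with hB
  have hBm : MeasurableSet B := measurableSet_Icc.prod measurableSet_Icc
  have hBf : volume B < ⊤ := (isCompact_Icc.prod isCompact_Icc).measure_lt_top
  have e : f =ᵐ[cellMeasure L γ] B.indicator f := by
    filter_upwards [ae_mem_cell hγ] with z hz
    by_cases h : z ∈ B
    · rw [Set.indicator_of_mem h]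
    · rw [Set.indicator_of_notMem h]
      apply hR z hz
      by_contra hlt
      apply h
      have h1 := (abs_le.1 (hA z.1 ⟨hz.1, hz.2.1.le⟩)).1
      have h2 := hz.2.2
      exact ⟨⟨hz.1, hz.2.1.le⟩, by linarith, by linarith⟩
  rw [memLp_congr_ae e, memLp_indicator_iff_restrict hBm]
  have : IsFiniteMeasure ((cellMeasure L γ).restrict B) := by
    refine ⟨?_⟩
    rw [Measure.restrict_apply_univ]
    exact (Measure.restrict_apply_le _ _).trans_lt hBf
  refine MemLp.of_bound hf.aestronglyMeasurable C ?_
  exact ae_restrict_of_ae ((ae_mem_cell hγ).mono hC)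

theorem IsSmoothUpToBdry.memLp (hL : 0 < L) (hγ : Continuous γ) {φ : ℝ × ℝ → ℝ}
    (h : IsSmoothUpToBdry L φ) (p : ℝ≥0∞) : MemLp φ p (cellMeasure L γ) := by
  obtain ⟨A, hA⟩ := isCompact_Icc.exists_bound_of_continuousOn (s := Set.Icc 0 L) hγ.continuousOn
  obtain ⟨C, -, hC⟩ := h.exists_bound hL (-A)
  obtain ⟨R, hR⟩ := h.bounded_supp
  refine memLp_of_bound_of_supp hγ h.smooth.continuous.measurable (fun z _ hz => hR z hz)
    (C := C) (fun z hz => hC z ?_) p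
  have h1 := (abs_le.1 (hA z.1 ⟨hz.1, hz.2.1.le⟩)).1
  have h2 := hz.2.2
  linarith

theorem MemLp.integrable_mul_smooth (hL : 0 < L) (hγ : Continuous γ) {f φ : ℝ × ℝ → ℝ}
    (hf : MemLp f 2 (cellMeasure L γ)) (h : IsSmoothUpToBdry L φ) :
    Integrable (fun z => f z * φ z) (cellMeasure L γ) :=
  MemLp.integrable_mul hf (h.memLp hL hγ 2)

theorem isOpen_unrolled (hγ : Continuous γ) : IsOpen (unrolled γ) :=
  isOpen_lt (hγ.comp continuous_fst) continuous_snd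

theorem locInt_of_memLp {f : ℝ × ℝ → ℝ} {p : ℝ≥0∞} (hp : 1 ≤ p) (hf : MemLp f p (cellMeasure L γ)) :
    LocInt L γ f := by
  intro K hK _
  have : IsFiniteMeasure ((cellMeasure L γ).restrict K) := by
    refine ⟨?_⟩
    rw [Measure.restrict_apply_univ]
    exact (Measure.restrict_apply_le _ _).trans_lt hK.measure_lt_top
  have h1 : MemLp f 1 ((cellMeasure L γ).restrict K) := (hf.restrict K).mono_exponent hp
  rw [memLp_one_iff_integrable, cellMeasure, Measure.restrict_restrict hK.measurableSet] at h1
  exact h1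

theorem LocInt.add {f g : ℝ × ℝ → ℝ} (hf : LocInt L γ f) (hg : LocInt L γ g) :
    LocInt L γ (fun z => f z + g z) := fun K hK hKs => (hf K hK hKs).add (hg K hK hKs)

theorem LocInt.sub {f g : ℝ × ℝ → ℝ} (hf : LocInt L γ f) (hg : LocInt L γ g) :
    LocInt L γ (fun z => f z - g z) := fun K hK hKs => (hf K hK hKs).sub (hg K hK hKs)

theorem LocInt.continuous_mul {f c : ℝ × ℝ → ℝ} (hγ : Continuous γ) (hc : Continuous c)
    (hf : LocInt L γ f) : LocInt L γ (fun z => c z * f z) := by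
  intro K hK hKs
  obtain ⟨A, hA⟩ := hK.exists_bound_of_continuousOn hc.continuousOn
  refine (hf K hK hKs).bdd_mul (c := A) hc.aestronglyMeasurable ?_
  filter_upwards [ae_restrict_mem (hK.measurableSet.inter (measurableSet_cell hγ))] with z hz
  exact hA z hz.1

theorem LocInt.congr {f g : ℝ × ℝ → ℝ} (hf : LocInt L γ f) (h : f =ᵐ[cellMeasure L γ] g) :
    LocInt L γ g := by
  intro K hK hKs
  exact (hf K hK hKs).congr (ae_restrict_of_ae_restrict_of_subset Set.inter_subset_right h)

theorem LocInt.comp_shear {f : ℝ × ℝ → ℝ} {κ : ℝ → ℝ} (hκ : Continuous κ)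
    (hf : LocInt L (γ + κ) f) : LocInt L γ (fun z => f (shear κ z)) := by
  intro K hK hKs
  have hK' : IsCompact (shear κ '' K) := hK.image (shearHomeo hκ).continuous
  have hs : shear κ '' K ⊆ unrolled (γ + κ) := by
    rintro _ ⟨z, hz, rfl⟩
    have := hKs hz
    simpa [unrolled, shear] using this
  have h := hf _ hK' hs
  rw [← (measurePreserving_shear_volume hκ).integrableOn_comp_preimage
    (measurableEmbedding_shear hκ)] at h
  have e : shear κ ⁻¹' (shear κ '' K ∩ cell L (γ + κ)) = K ∩ cell L γ := by
    have e0 : shear κ ⁻¹' (shear κ '' K) = K :=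
      Set.preimage_image_eq _ (shearHomeo hκ).injective
    rw [Set.preimage_inter, e0]
    congr 1
    ext z; simp [cell, shear]
  rw [e] at h
  exact h

/-- The support of a test function is periodic, hence not compact in the unrolled plane; only its
part over one period is. This is what makes local integrability sufficient for pairing with test
functions. -/
theorem IsTest.exists_compact (hγ : Continuous γ) {φ : ℝ × ℝ → ℝ}
    (h : IsTest L γ φ) : ∃ K : Set (ℝ × ℝ), IsCompact K ∧ K ⊆ unrolled γ ∧
      ∀ z ∈ cell L γ, z ∉ K → φ z = 0 := by
  obtain ⟨A, hA⟩ := isCompact_Icc.exists_bound_of_continuousOn (s := Set.Icc 0 L) hγ.continuousOn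
  obtain ⟨R, hR⟩ := h.bounded_supp
  refine ⟨tsupport φ ∩ (Set.Icc 0 L ×ˢ Set.Icc (-A) R),
    (isCompact_Icc.prod isCompact_Icc).inter_left (isClosed_tsupport φ),
    Set.inter_subset_left.trans h.supp, fun z hz hK => ?_⟩
  by_contra h0
  apply hK
  have h1 := (abs_le.1 (hA z.1 ⟨hz.1, hz.2.1.le⟩)).1
  have h2 := hz.2.2
  refine ⟨subset_tsupport φ h0, ⟨hz.1, hz.2.1.le⟩, by linarith, ?_⟩
  by_contra h3
  exact h0 (hR z (by linarith))

theorem LocInt.integrable_mul (hγ : Continuous γ) {f φ : ℝ × ℝ → ℝ}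
    (hf : LocInt L γ f) (h : IsTest L γ φ) :
    Integrable (fun z => f z * φ z) (cellMeasure L γ) := by
  obtain ⟨K, hK, hKs, h0⟩ := h.exists_compact hγ
  have h1 : IntegrableOn (fun z => f z * φ z) (K ∩ cell L γ) := by
    have := (hf.continuous_mul hγ h.smooth.continuous) K hK hKs
    simpa only [mul_comm] using this
  have h2 : IntegrableOn (fun z => f z * φ z) (cell L γ) := by
    refine IntegrableOn.of_forall_sdiff_eq_zero h1 (measurableSet_cell hγ) fun z hz => ?_
    rw [h0 z hz.1 (fun hk => hz.2 ⟨hk, hz.1⟩), mul_zero]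
  exact h2

/-! ### The divergence theorem on the periodic half plane -/

theorem integral_pd1_eq_zero (hL : 0 < L) {G : ℝ × ℝ → ℝ} (h : IsSmoothUpToBdry L G) :
    ∫ z, pd1 G z ∂cellMeasure L 0 = 0 := by
  have hi : Integrable (pd1 G) (cellMeasure L 0) :=
    memLp_one_iff_integrable.1 (h.pd1.memLp hL continuous_const 1)
  rw [cellMeasure_zero] at hi ⊢
  rw [integral_prod_symm _ hi]
  refine integral_eq_zero_of_ae (ae_of_all _ fun y => ?_)
  simp only [Pi.zero_apply]
  rw [integral_Ico_eq_integral_Ioc, ← intervalIntegral.integral_of_le hL.le,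
    intervalIntegral.integral_eq_sub_of_hasDerivAt (f := fun x => G (x, y))
      (fun x _ => hasDerivAt_pd1 h.smooth x y)]
  · have := h.periodic (0, y)
    simp only [zero_add] at this
    rw [this, sub_self]
  · exact ((contDiff_pd1 h.smooth).continuous.comp (by fun_prop :
      Continuous fun x : ℝ => (x, y))).intervalIntegrable _ _

theorem integral_pd2_eq (hL : 0 < L) {G : ℝ × ℝ → ℝ} (h : IsSmoothUpToBdry L G) :
    ∫ z, pd2 G z ∂cellMeasure L 0 = - ∫ x in Set.Ico 0 L, G (x, 0) := by
  have hi : Integrable (pd2 G) (cellMeasure L 0) :=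
    memLp_one_iff_integrable.1 (h.pd2.memLp hL continuous_const 1)
  rw [cellMeasure_zero] at hi ⊢
  rw [integral_prod _ hi, ← integral_neg]
  refine integral_congr_ae (ae_of_all _ fun x => ?_)
  dsimp only
  obtain ⟨R, hR⟩ := h.pd2.bounded_supp
  obtain ⟨R', hR'⟩ := h.bounded_supp
  have hc : Continuous fun y : ℝ => pd2 G (x, y) :=
    (contDiff_pd2 h.smooth).continuous.comp (by fun_prop)
  have hint : IntegrableOn (fun y => pd2 G (x, y)) (Set.Ioi 0) := by
    have h1 : IntegrableOn (fun y => pd2 G (x, y)) (Set.Icc 0 R) :=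
      hc.continuousOn.integrableOn_Icc
    refine h1.of_forall_sdiff_eq_zero measurableSet_Ioi fun y hy => hR _ ?_
    by_contra hlt
    exact hy.2 ⟨le_of_lt hy.1, (not_le.1 hlt).le⟩
  rw [integral_Ioi_of_hasDerivAt_of_tendsto' (f := fun y => G (x, y)) (m := 0)
    (fun y _ => hasDerivAt_pd2 h.smooth x y) hint, zero_sub]
  refine tendsto_const_nhds.congr' ?_
  filter_upwards [eventually_ge_atTop R'] with y hy
  exact (hR' (x, y) hy).symm

theorem integral_mul_pd1 (hL : 0 < L) {F G : ℝ × ℝ → ℝ} (hF : IsSmoothUpToBdry L F)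
    (hG : IsSmoothUpToBdry L G) :
    ∫ z, F z * pd1 G z ∂cellMeasure L 0 = - ∫ z, pd1 F z * G z ∂cellMeasure L 0 := by
  have h := integral_pd1_eq_zero hL (hF.mul hG)
  rw [pd1_mul hF.smooth hG.smooth, integral_add] at h
  · linarith
  · exact MemLp.integrable_mul_smooth hL continuous_const (hF.pd1.memLp hL continuous_const 2) hG
  · exact MemLp.integrable_mul_smooth hL continuous_const (hF.memLp hL continuous_const 2) hG.pd1

theorem integral_mul_pd2 (hL : 0 < L) {F G : ℝ × ℝ → ℝ} (hF : IsSmoothUpToBdry L F)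
    (hG : IsSmoothUpToBdry L G) :
    ∫ z, F z * pd2 G z ∂cellMeasure L 0 = - ∫ z, pd2 F z * G z ∂cellMeasure L 0
      - ∫ x in Set.Ico 0 L, F (x, 0) * G (x, 0) := by
  have h := integral_pd2_eq hL (hF.mul hG)
  rw [pd2_mul hF.smooth hG.smooth, integral_add] at h
  · linarith
  · exact MemLp.integrable_mul_smooth hL continuous_const (hF.pd2.memLp hL continuous_const 2) hG
  · exact MemLp.integrable_mul_smooth hL continuous_const (hF.memLp hL continuous_const 2) hG.pd2

end

section

variable {L : ℝ} {γ : ℝ → ℝ}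

/-! ### Periodisation -/

/-- The sum of the translates of a compactly supported function by multiples of `L`. -/
def periodize (L : ℝ) (φ : ℝ × ℝ → ℝ) (z : ℝ × ℝ) : ℝ := ∑' k : ℤ, φ (z.1 + k * L, z.2)

/-- The number N depends only on the compact set, so one finite sum represents the periodisations of
φ and of its derivatives simultaneously. -/
theorem exists_forall_notMem_eq_zero (hL : 0 < L) {K : Set (ℝ × ℝ)} (hK : IsCompact K) (A : ℝ) :
    ∃ N : ℕ, ∀ φ : ℝ × ℝ → ℝ, Function.support φ ⊆ K → ∀ z : ℝ × ℝ, |z.1| ≤ A →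
      ∀ k : ℤ, k ∉ Finset.Icc (-N : ℤ) N → φ (z.1 + k * L, z.2) = 0 := by
  obtain ⟨B, hB⟩ := (hK.image continuous_fst).isBounded.exists_norm_le
  obtain ⟨N, hN⟩ := exists_nat_gt ((A + B) / L)
  refine ⟨N, fun φ hφ z hz k hk => ?_⟩
  by_contra h0
  have h1 : |z.1 + k * L| ≤ B := hB _ ⟨_, hφ h0, rfl⟩
  rw [div_lt_iff₀ hL] at hN
  apply hk
  rw [Finset.mem_Icc]
  have h2 := abs_le.1 h1
  have h3 := abs_le.1 hz
  constructor
  · by_contra hlt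
    have : (k : ℝ) ≤ -N := by exact_mod_cast (not_le.1 hlt).le
    nlinarith
  · by_contra hlt
    have : (N : ℝ) ≤ k := by exact_mod_cast (not_le.1 hlt).le
    nlinarith

theorem exists_periodize_eq_sum (hL : 0 < L) {K : Set (ℝ × ℝ)} (hK : IsCompact K) (A : ℝ) :
    ∃ N : ℕ, ∀ φ : ℝ × ℝ → ℝ, Function.support φ ⊆ K → ∀ z : ℝ × ℝ, |z.1| ≤ A →
      periodize L φ z = ∑ k ∈ Finset.Icc (-N : ℤ) N, φ (z.1 + k * L, z.2) := by
  obtain ⟨N, hN⟩ := exists_forall_notMem_eq_zero hL hK A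
  exact ⟨N, fun φ hφ z hz => tsum_eq_sum (hN φ hφ z hz)⟩

theorem exists_periodize_eventuallyEq (hL : 0 < L) {K : Set (ℝ × ℝ)} (hK : IsCompact K)
    (z : ℝ × ℝ) : ∃ s : Finset ℤ, ∀ φ : ℝ × ℝ → ℝ, Function.support φ ⊆ K →
      periodize L φ =ᶠ[𝓝 z] fun z => ∑ k ∈ s, φ (z.1 + k * L, z.2) := by
  obtain ⟨N, hN⟩ := exists_periodize_eq_sum hL hK (|z.1| + 1)
  refine ⟨Finset.Icc (-N : ℤ) N, fun φ hφ => ?_⟩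
  have : ∀ᶠ y : ℝ × ℝ in 𝓝 z, |y.1| < |z.1| + 1 :=
    (continuous_abs.comp continuous_fst).continuousAt.eventually_lt continuousAt_const
      (by simp)
  filter_upwards [this] with y hy using hN φ hφ y hy.le

theorem contDiff_shift {φ : ℝ × ℝ → ℝ} (h : ContDiff ℝ ∞ φ) (t : ℝ) :
    ContDiff ℝ ∞ (fun z : ℝ × ℝ => φ (z.1 + t, z.2)) := by
  simpa [add_comm] using contDiff_affine h t 1 0 1

theorem contDiff_periodize (hL : 0 < L) {φ : ℝ × ℝ → ℝ} (hφ : HasCompactSupport φ)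
    (h : ContDiff ℝ ∞ φ) : ContDiff ℝ ∞ (periodize L φ) := by
  rw [contDiff_iff_contDiffAt]
  intro z
  obtain ⟨s, hs⟩ := exists_periodize_eventuallyEq hL hφ z
  refine ContDiffAt.congr_of_eventuallyEq ?_ (hs φ (subset_tsupport φ))
  exact (ContDiff.sum fun k _ => contDiff_shift h _).contDiffAt

theorem periodize_isSmoothUpToBdry (hL : 0 < L) {φ : ℝ × ℝ → ℝ} (hφ : HasCompactSupport φ)
    (h : ContDiff ℝ ∞ φ) : IsSmoothUpToBdry L (periodize L φ) where
  smooth := contDiff_periodize hL hφ h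
  periodic z := by
    simp only [periodize]
    rw [← (Equiv.addRight (1 : ℤ)).tsum_eq (fun k : ℤ => φ (z.1 + k * L, z.2))]
    refine tsum_congr fun k => ?_
    simp only [Equiv.coe_addRight]
    push_cast
    congr 2; ring
  bounded_supp := by
    obtain ⟨B, hB⟩ := (hφ.isCompact.image continuous_snd).isBounded.exists_norm_le
    refine ⟨B + 1, fun z hz => ?_⟩
    have : ∀ k : ℤ, φ (z.1 + k * L, z.2) = 0 := by
      intro k
      by_contra h0
      have h1 : |z.2| ≤ B := hB _ ⟨_, subset_tsupport φ h0, rfl⟩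
      linarith [le_abs_self z.2]
    simp [periodize, this]

theorem pd1_sum {ι : Type*} (s : Finset ι) {f : ι → ℝ × ℝ → ℝ} (h : ∀ k, ContDiff ℝ ∞ (f k)) :
    pd1 (fun z => ∑ k ∈ s, f k z) = fun z => ∑ k ∈ s, pd1 (f k) z := by
  funext z
  simp only [pd1]
  rw [fderiv_fun_sum fun k _ => differentiable_of_smooth (h k) z]
  simp

theorem pd2_sum {ι : Type*} (s : Finset ι) {f : ι → ℝ × ℝ → ℝ} (h : ∀ k, ContDiff ℝ ∞ (f k)) :
    pd2 (fun z => ∑ k ∈ s, f k z) = fun z => ∑ k ∈ s, pd2 (f k) z := by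
  funext z
  simp only [pd2]
  rw [fderiv_fun_sum fun k _ => differentiable_of_smooth (h k) z]
  simp

theorem pd1_periodize (hL : 0 < L) {φ : ℝ × ℝ → ℝ} (hφ : HasCompactSupport φ)
    (h : ContDiff ℝ ∞ φ) : pd1 (periodize L φ) = periodize L (pd1 φ) := by
  funext z
  obtain ⟨s, hs⟩ := exists_periodize_eventuallyEq hL hφ z
  have e1 : pd1 (periodize L φ) z = pd1 (fun z => ∑ k ∈ s, φ (z.1 + k * L, z.2)) z := by
    simp only [pd1, (hs φ (subset_tsupport φ)).fderiv_eq]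
  rw [e1, (hs (pd1 φ) ((subset_tsupport _).trans (tsupport_pd1_subset φ))).eq_of_nhds,
    pd1_sum s fun k : ℤ => contDiff_shift h (k * L)]
  simp only [IsSmoothUpToBdry.pd1_shift h]

theorem pd2_periodize (hL : 0 < L) {φ : ℝ × ℝ → ℝ} (hφ : HasCompactSupport φ)
    (h : ContDiff ℝ ∞ φ) : pd2 (periodize L φ) = periodize L (pd2 φ) := by
  funext z
  obtain ⟨s, hs⟩ := exists_periodize_eventuallyEq hL hφ z
  have e1 : pd2 (periodize L φ) z = pd2 (fun z => ∑ k ∈ s, φ (z.1 + k * L, z.2)) z := by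
    simp only [pd2, (hs φ (subset_tsupport φ)).fderiv_eq]
  rw [e1, (hs (pd2 φ) ((subset_tsupport _).trans (tsupport_pd2_subset φ))).eq_of_nhds,
    pd2_sum s fun k : ℤ => contDiff_shift h (k * L)]
  simp only [IsSmoothUpToBdry.pd2_shift h]

theorem periodize_isTest (hL : 0 < L) (hp : ∀ x, γ (x + L) = γ x) {φ : ℝ × ℝ → ℝ}
    (hφ : HasCompactSupport φ) (h : ContDiff ℝ ∞ φ) (hs : tsupport φ ⊆ unrolled γ) :
    IsTest L γ (periodize L φ) := by
  refine ⟨periodize_isSmoothUpToBdry hL hφ h, fun z hz => ?_⟩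
  by_contra hn
  refine (notMem_tsupport_iff_eventuallyEq.2 ?_) hz
  obtain ⟨s, hs'⟩ := exists_periodize_eventuallyEq hL hφ z
  have h1 : ∀ k ∈ s, ∀ᶠ y : ℝ × ℝ in 𝓝 z, φ (y.1 + k * L, y.2) = 0 := by
    intro k _
    have h2 : (z.1 + k * L, z.2) ∉ tsupport φ := by
      intro hmem
      apply hn
      have h3 : γ (z.1 + k * L) < z.2 := hs hmem
      have hp' : Function.Periodic γ L := hp
      have h4 : γ (z.1 + k * L) = γ z.1 := by simpa using hp'.int_mul k z.1
      rwa [h4] at h3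
    have h5 : Continuous fun y : ℝ × ℝ => (y.1 + k * L, y.2) := by fun_prop
    exact (h5.tendsto z).eventually (notMem_tsupport_iff_eventuallyEq.1 h2)
  filter_upwards [hs' φ (subset_tsupport φ), (Finset.eventually_all s).2 h1] with y hy hy'
  rw [hy]
  exact Finset.sum_eq_zero hy'

/-! ### The fundamental lemma of the calculus of variations -/

theorem ae_fst_ne (a : ℝ) : ∀ᵐ z : ℝ × ℝ, z.1 ≠ a :=
  Measure.quasiMeasurePreserving_fst.ae (μa := (volume : Measure (ℝ × ℝ)))
    (μb := (volume : Measure ℝ)) (Measure.ae_ne volume a)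

/-- The usual fundamental lemma applies in the interior of the cell: a bump supported there
periodises to a test function that agrees with it on the cell. The omitted line z₁ = 0 is null. -/
theorem ae_eq_zero_of_test (hL : 0 < L) (hγ : Continuous γ) (hp : ∀ x, γ (x + L) = γ x)
    {f : ℝ × ℝ → ℝ} (hf : LocInt L γ f)
    (h : ∀ φ, IsTest L γ φ → ∫ z, f z * φ z ∂cellMeasure L γ = 0) :
    f =ᵐ[cellMeasure L γ] 0 := by
  set U : Set (ℝ × ℝ) := {z | 0 < z.1 ∧ z.1 < L ∧ γ z.1 < z.2} with hU
  have hUo : IsOpen U := (isOpen_lt continuous_const continuous_fst).inter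
    ((isOpen_lt continuous_fst continuous_const).inter
      (isOpen_lt (hγ.comp continuous_fst) continuous_snd))
  have hUc : U ⊆ cell L γ := fun z hz => ⟨hz.1.le, hz.2⟩
  have hloc : LocallyIntegrableOn f U volume := by
    rw [locallyIntegrableOn_iff hUo.isLocallyClosed]
    intro K hK hKc
    have := hf K hKc (fun z hz => (hK hz).2.2)
    rwa [Set.inter_eq_left.2 (hK.trans hUc)] at this
  have key := hUo.ae_eq_zero_of_integral_contDiff_smul_eq_zero hloc fun g hg hgc hgs => ?_
  · rw [EventuallyEq, cellMeasure, ae_restrict_iff' (measurableSet_cell hγ)]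
    filter_upwards [key, ae_fst_ne 0] with z hz h0 hc
    exact hz ⟨lt_of_le_of_ne hc.1 h0.symm, hc.2⟩
  · have ht := periodize_isTest hL hp hgc hg (hgs.trans fun z hz => hz.2.2)
    have hg0 : ∀ z, z ∉ cell L γ → g z = 0 := fun z hz => by
      by_contra h0
      exact hz (hUc (hgs (subset_tsupport g h0)))
    rw [← setIntegral_eq_integral_of_forall_compl_eq_zero (s := cell L γ)
      (fun z hz => by rw [hg0 z hz, zero_smul]), ← h _ ht]
    refine setIntegral_congr_fun (measurableSet_cell hγ) fun z hz => ?_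
    -- A translate by a nonzero multiple of L leaves the strip 0 < z₁ < L that contains the support
    -- of g.
    have e : periodize L g z = g z := by
      rw [periodize, tsum_eq_single 0]
      · simp
      · intro k hk
        by_contra h0
        have h1 := hgs (subset_tsupport g h0)
        have h2 : 0 < z.1 + k * L := h1.1
        have h3 : z.1 + k * L < L := h1.2.1
        have h4 := hz.1
        have h5 := hz.2.1
        rcases lt_or_gt_of_ne hk with hk | hk
        · have : (k : ℝ) ≤ -1 := by exact_mod_cast Int.le_sub_one_of_lt hk
          nlinarith
        · have : (1 : ℝ) ≤ k := by exact_mod_cast hk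
          nlinarith
    simp only [smul_eq_mul]
    rw [e, mul_comm]

end

section

variable {L : ℝ} {γ : ℝ → ℝ}

/-! ### Calculus of weak derivatives -/

theorem IsTest.pderiv {φ : ℝ × ℝ → ℝ} (h : IsTest L γ φ) (β : ℕ × ℕ) :
    IsTest L γ (RoughDomain.pderiv β φ) := by
  have h2 : ∀ n, IsTest L γ (RoughDomain.pd2^[n] φ) := by
    intro n
    induction n with
    | zero => exact h
    | succ n ih => rw [Function.iterate_succ_apply']; exact ih.pd2
  have h1 : ∀ n, IsTest L γ (RoughDomain.pd1^[n] (RoughDomain.pd2^[β.2] φ)) := by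
    intro n
    induction n with
    | zero => exact h2 _
    | succ n ih => rw [Function.iterate_succ_apply']; exact ih.pd1
  exact h1 _

theorem pderiv_succ_fst (a b : ℕ) (φ : ℝ × ℝ → ℝ) :
    pderiv (a + 1, b) φ = pd1 (pderiv (a, b) φ) :=
  Function.iterate_succ_apply' pd1 a _

theorem pderiv_succ_snd (a b : ℕ) {φ : ℝ × ℝ → ℝ} (h : IsTest L γ φ) :
    pderiv (a, b + 1) φ = pd2 (pderiv (a, b) φ) := by
  induction a with
  | zero => exact Function.iterate_succ_apply' pd2 b φ
  | succ a ih =>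
    rw [pderiv_succ_fst, pderiv_succ_fst, ih, pd_comm (h.pderiv (a, b)).smooth]

namespace IsWeakDeriv

variable {f f' g g' : ℝ × ℝ → ℝ} {β : ℕ × ℕ}

theorem int1 (h : IsWeakDeriv L γ (1, 0) f g) {φ : ℝ × ℝ → ℝ} (hφ : IsTest L γ φ) :
    ∫ z, f z * pd1 φ z ∂cellMeasure L γ = - ∫ z, g z * φ z ∂cellMeasure L γ := by
  have := h.integral_eq φ hφ
  simpa [RoughDomain.pderiv] using this

theorem int2 (h : IsWeakDeriv L γ (0, 1) f g) {φ : ℝ × ℝ → ℝ} (hφ : IsTest L γ φ) :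
    ∫ z, f z * pd2 φ z ∂cellMeasure L γ = - ∫ z, g z * φ z ∂cellMeasure L γ := by
  have := h.integral_eq φ hφ
  simpa [RoughDomain.pderiv] using this

theorem mk1 (hf : LocInt L γ f) (hg : LocInt L γ g) (h : ∀ φ, IsTest L γ φ →
    ∫ z, f z * RoughDomain.pd1 φ z ∂cellMeasure L γ = - ∫ z, g z * φ z ∂cellMeasure L γ) :
    IsWeakDeriv L γ (1, 0) f g :=
  ⟨hf, hg, fun φ hφ => by simpa [RoughDomain.pderiv] using h φ hφ⟩

theorem mk2 (hf : LocInt L γ f) (hg : LocInt L γ g) (h : ∀ φ, IsTest L γ φ →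
    ∫ z, f z * RoughDomain.pd2 φ z ∂cellMeasure L γ = - ∫ z, g z * φ z ∂cellMeasure L γ) :
    IsWeakDeriv L γ (0, 1) f g :=
  ⟨hf, hg, fun φ hφ => by simpa [RoughDomain.pderiv] using h φ hφ⟩

theorem zero_order (hf : LocInt L γ f) : IsWeakDeriv L γ (0, 0) f f :=
  ⟨hf, hf, fun φ _ => by simp [RoughDomain.pderiv]⟩

theorem congr (h : IsWeakDeriv L γ β f g) (e : f =ᵐ[cellMeasure L γ] f')
    (e' : g =ᵐ[cellMeasure L γ] g') : IsWeakDeriv L γ β f' g' where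
  locInt_left := h.locInt_left.congr e
  locInt_right := h.locInt_right.congr e'
  integral_eq φ hφ := by
    have := h.integral_eq φ hφ
    rw [integral_congr_ae (e.mono fun z hz => by simp only [hz] :
        (fun z => f z * RoughDomain.pderiv β φ z) =ᵐ[cellMeasure L γ]
          fun z => f' z * RoughDomain.pderiv β φ z),
      integral_congr_ae (e'.mono fun z hz => by simp only [hz] :
        (fun z => g z * φ z) =ᵐ[cellMeasure L γ] fun z => g' z * φ z)] at this
    exact this

theorem add (hγ : Continuous γ) (h : IsWeakDeriv L γ β f g) (h' : IsWeakDeriv L γ β f' g') :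
    IsWeakDeriv L γ β (fun z => f z + f' z) (fun z => g z + g' z) where
  locInt_left := h.locInt_left.add h'.locInt_left
  locInt_right := h.locInt_right.add h'.locInt_right
  integral_eq φ hφ := by
    simp only [add_mul]
    rw [integral_add (h.locInt_left.integrable_mul hγ (hφ.pderiv β))
        (h'.locInt_left.integrable_mul hγ (hφ.pderiv β)),
      integral_add (h.locInt_right.integrable_mul hγ hφ)
        (h'.locInt_right.integrable_mul hγ hφ), h.integral_eq φ hφ, h'.integral_eq φ hφ, mul_add]

theorem const_mul (hγ : Continuous γ) (c : ℝ) (h : IsWeakDeriv L γ β f g) :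
    IsWeakDeriv L γ β (fun z => c * f z) (fun z => c * g z) where
  locInt_left := h.locInt_left.continuous_mul (c := fun _ => c) hγ continuous_const
  locInt_right := h.locInt_right.continuous_mul (c := fun _ => c) hγ continuous_const
  integral_eq φ hφ := by
    simp only [mul_assoc]
    rw [integral_const_mul, integral_const_mul, h.integral_eq φ hφ]; ring

theorem sub (hγ : Continuous γ) (h : IsWeakDeriv L γ β f g) (h' : IsWeakDeriv L γ β f' g') :
    IsWeakDeriv L γ β (fun z => f z - f' z) (fun z => g z - g' z) := by
  have := h.add hγ (h'.const_mul hγ (-1))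
  simpa only [neg_mul, one_mul, ← sub_eq_add_neg] using this

/-- By this uniqueness the infimum in `derivNorm` is a single value, and equations between functions
can be differentiated by comparing weak derivatives of both sides. -/
theorem ae_unique (hL : 0 < L) (hγ : Continuous γ) (hp : ∀ x, γ (x + L) = γ x)
    (h : IsWeakDeriv L γ β f g) (h' : IsWeakDeriv L γ β f g') :
    g =ᵐ[cellMeasure L γ] g' := by
  have := ae_eq_zero_of_test hL hγ hp (h.locInt_right.sub h'.locInt_right) fun φ hφ => by
    simp only [sub_mul]
    rw [integral_sub (h.locInt_right.integrable_mul hγ hφ)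
      (h'.locInt_right.integrable_mul hγ hφ), sub_eq_zero]
    have e := (h.integral_eq φ hφ).symm.trans (h'.integral_eq φ hφ)
    exact mul_left_cancel₀ (pow_ne_zero _ (by norm_num)) e
  filter_upwards [this] with z hz
  simpa [sub_eq_zero] using hz

theorem comp1 (h : IsWeakDeriv L γ (1, 0) f f') (h' : IsWeakDeriv L γ β f' g) :
    IsWeakDeriv L γ (β.1 + 1, β.2) f g where
  locInt_left := h.locInt_left
  locInt_right := h'.locInt_right
  integral_eq φ hφ := by
    rw [pderiv_succ_fst, h.int1 (hφ.pderiv (β.1, β.2)), h'.integral_eq φ hφ]; ring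

theorem comp2 (h : IsWeakDeriv L γ (0, 1) f f') (h' : IsWeakDeriv L γ β f' g) :
    IsWeakDeriv L γ (β.1, β.2 + 1) f g where
  locInt_left := h.locInt_left
  locInt_right := h'.locInt_right
  integral_eq φ hφ := by
    rw [pderiv_succ_snd _ _ hφ, h.int2 (hφ.pderiv (β.1, β.2)), h'.integral_eq φ hφ]; ring

/-- Cancels one derivative on the left. It converts derivatives indexed by multi-indices into the
recursive form of `SobolevBound`. -/
theorem of_comp1 (h : IsWeakDeriv L γ (1, 0) f f') (h' : IsWeakDeriv L γ (β.1 + 1, β.2) f g) :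
    IsWeakDeriv L γ β f' g where
  locInt_left := h.locInt_right
  locInt_right := h'.locInt_right
  integral_eq φ hφ := by
    have h1 := h'.integral_eq φ hφ
    rw [pderiv_succ_fst, h.int1 (hφ.pderiv (β.1, β.2))] at h1
    rw [← neg_inj, h1]; ring

theorem of_comp2 (h : IsWeakDeriv L γ (0, 1) f f') (h' : IsWeakDeriv L γ (β.1, β.2 + 1) f g) :
    IsWeakDeriv L γ β f' g where
  locInt_left := h.locInt_right
  locInt_right := h'.locInt_right
  integral_eq φ hφ := by
    have h1 := h'.integral_eq φ hφ
    rw [pderiv_succ_snd _ _ hφ, h.int2 (hφ.pderiv (β.1, β.2))] at h1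
    rw [← neg_inj, h1]; ring

theorem coeff_mul1 (hγ : Continuous γ) {c : ℝ → ℝ} (hc : ContDiff ℝ ∞ c)
    (hp : ∀ x, c (x + L) = c x) (h : IsWeakDeriv L γ (1, 0) f g) :
    IsWeakDeriv L γ (1, 0) (fun z => c z.1 * f z) (fun z => c z.1 * g z + deriv c z.1 * f z) := by
  have l1 := h.locInt_left.continuous_mul hγ (contDiff_comp_fst hc).continuous
  have l2 := h.locInt_right.continuous_mul hγ (contDiff_comp_fst hc).continuous
  have l3 := h.locInt_left.continuous_mul hγ (contDiff_comp_fst (contDiff_deriv hc)).continuous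
  refine mk1 l1 (l2.add l3) fun φ hφ => ?_
  have h1 := h.int1 (hφ.coeff_mul hc hp)
  rw [pd1_mul (contDiff_comp_fst hc) hφ.smooth, pd1_comp_fst hc] at h1
  have e1 : ∀ z : ℝ × ℝ, f z * (deriv c z.1 * φ z + c z.1 * RoughDomain.pd1 φ z)
      = (deriv c z.1 * f z) * φ z + (c z.1 * f z) * RoughDomain.pd1 φ z := fun z => by ring
  have e2 : ∀ z : ℝ × ℝ, g z * (c z.1 * φ z) = (c z.1 * g z) * φ z := fun z => by ring
  simp only [e1, e2] at h1
  rw [integral_add (l3.integrable_mul hγ hφ) (l1.integrable_mul hγ hφ.pd1)] at h1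
  simp only [add_mul]
  rw [integral_add (l2.integrable_mul hγ hφ) (l3.integrable_mul hγ hφ)]
  linarith

theorem coeff_mul2 (hγ : Continuous γ) {c : ℝ → ℝ} (hc : ContDiff ℝ ∞ c)
    (hp : ∀ x, c (x + L) = c x) (h : IsWeakDeriv L γ (0, 1) f g) :
    IsWeakDeriv L γ (0, 1) (fun z => c z.1 * f z) (fun z => c z.1 * g z) := by
  have l1 := h.locInt_left.continuous_mul hγ (contDiff_comp_fst hc).continuous
  have l2 := h.locInt_right.continuous_mul hγ (contDiff_comp_fst hc).continuous
  refine mk2 l1 l2 fun φ hφ => ?_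
  have h1 := h.int2 (hφ.coeff_mul hc hp)
  rw [pd2_mul (contDiff_comp_fst hc) hφ.smooth, pd2_comp_fst hc] at h1
  have e1 : ∀ z : ℝ × ℝ, f z * (0 * φ z + c z.1 * RoughDomain.pd2 φ z)
      = (c z.1 * f z) * RoughDomain.pd2 φ z := fun z => by ring
  have e2 : ∀ z : ℝ × ℝ, g z * (c z.1 * φ z) = (c z.1 * g z) * φ z := fun z => by ring
  simp only [e1, e2] at h1
  exact h1

theorem _root_.RoughDomain.integral_comp_shear (hγ : Continuous γ) {κ : ℝ → ℝ} (hκ : Continuous κ)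
    (F : ℝ × ℝ → ℝ) :
    ∫ z, F (shear κ z) ∂cellMeasure L γ = ∫ z, F z ∂cellMeasure L (γ + κ) :=
  (measurePreserving_shear hγ hκ).integral_comp (measurableEmbedding_shear hκ) F

theorem comp_shear2 (hL : 0 < L) (hγ : Continuous γ) {κ : ℝ → ℝ} (hκ : ContDiff ℝ ∞ κ)
    (hp : ∀ x, κ (x + L) = κ x) (h : IsWeakDeriv L (γ + κ) (0, 1) f g) :
    IsWeakDeriv L γ (0, 1) (fun z => f (shear κ z)) (fun z => g (shear κ z)) := by
  refine mk2 (h.locInt_left.comp_shear hκ.continuous) (h.locInt_right.comp_shear hκ.continuous)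
    fun φ hφ => ?_
  have hφ' : IsTest L (γ + κ + -κ) φ := by simpa using hφ
  have hn : ContDiff ℝ ∞ (-κ) := hκ.neg
  have hψ := hφ'.comp_shear hL hn (fun x => by simp [hp x])
  have h1 := h.int2 hψ
  rw [← integral_comp_shear hγ hκ.continuous, ← integral_comp_shear hγ hκ.continuous,
    pd2_shear hφ.smooth hn] at h1
  simpa only [shear_neg_shear] using h1

/-- The chain rule is obtained by testing with φ composed with the inverse shear. The horizontal
derivative of that test function contains a vertical one, which is why ∂₂f must exist too. -/
theorem comp_shear1 (hL : 0 < L) (hγ : Continuous γ) {κ : ℝ → ℝ} (hκ : ContDiff ℝ ∞ κ)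
    (hp : ∀ x, κ (x + L) = κ x) (h : IsWeakDeriv L (γ + κ) (1, 0) f f')
    (h' : IsWeakDeriv L (γ + κ) (0, 1) f g) :
    IsWeakDeriv L γ (1, 0) (fun z => f (shear κ z))
      (fun z => f' (shear κ z) + deriv κ z.1 * g (shear κ z)) := by
  have hκ' := contDiff_deriv hκ
  have hp' : ∀ x, deriv κ (x + L) = deriv κ x := fun x => by
    rw [← deriv_comp_add_const]; simp only [hp]
  have l1 := h.locInt_right.comp_shear hκ.continuous
  have l2 := (h'.locInt_right.comp_shear hκ.continuous).continuous_mul hγ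
    (contDiff_comp_fst hκ').continuous
  refine mk1 (h.locInt_left.comp_shear hκ.continuous) (l1.add l2) fun φ hφ => ?_
  have hφ' : IsTest L (γ + κ + -κ) φ := by simpa using hφ
  have hn : ContDiff ℝ ∞ (-κ) := hκ.neg
  have hψ := hφ'.comp_shear hL hn (fun x => by simp [hp x])
  have h1 := h.int1 hψ
  -- Integrates by parts, in the vertical direction, the term with κ' ∂₂φ that the inverse shear
  -- produces.
  have h2 := (h'.coeff_mul2 (hγ.add hκ.continuous) hκ' hp').int2 hψ
  rw [← integral_comp_shear hγ hκ.continuous, ← integral_comp_shear hγ hκ.continuous,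
    pd1_shear hφ.smooth hn] at h1
  rw [← integral_comp_shear hγ hκ.continuous, ← integral_comp_shear hγ hκ.continuous,
    pd2_shear hφ.smooth hn] at h2
  simp only [shear_neg_shear] at h1 h2
  have e0 : ∀ x, deriv (-κ) x = - deriv κ x := fun x => by
    simp
  have e : ∀ z : ℝ × ℝ, f (shear κ z) * (RoughDomain.pd1 φ z
      + deriv (-κ) (shear κ z).1 * RoughDomain.pd2 φ z)
      = f (shear κ z) * RoughDomain.pd1 φ z
        - deriv κ (shear κ z).1 * f (shear κ z) * RoughDomain.pd2 φ z := fun z => by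
    rw [e0]; ring
  simp only [e] at h1
  have e3 : ∀ z : ℝ × ℝ, (shear κ z).1 = z.1 := fun z => rfl
  simp only [e3] at h1 h2
  have l0 := h.locInt_left.comp_shear hκ.continuous
  rw [integral_sub (l0.integrable_mul hγ hφ.pd1)
    ((l0.continuous_mul hγ (contDiff_comp_fst hκ').continuous).integrable_mul hγ hφ.pd2)] at h1
  simp only [add_mul]
  rw [integral_add (l1.integrable_mul hγ hφ) (l2.integrable_mul hγ hφ)]
  linarith

end IsWeakDeriv

theorem deriv_periodic {c : ℝ → ℝ} (hp : ∀ x, c (x + L) = c x) (x : ℝ) :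
    deriv c (x + L) = deriv c x := by
  rw [← deriv_comp_add_const]; simp only [hp]

theorem IsTest.apply_bdry {φ : ℝ × ℝ → ℝ} (h : IsTest L γ φ) {z : ℝ × ℝ} (hz : z.2 ≤ γ z.1) :
    φ z = 0 := by
  by_contra h0
  have := h.supp (subset_tsupport φ h0)
  exact absurd this (not_lt.2 hz)

theorem IsSmoothUpToBdry.isWeakDeriv1 (hL : 0 < L) {F : ℝ × ℝ → ℝ} (h : IsSmoothUpToBdry L F) :
    IsWeakDeriv L 0 (1, 0) F (RoughDomain.pd1 F) :=
  .mk1 (locInt_of_memLp le_rfl (h.memLp hL continuous_const 1))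
    (locInt_of_memLp le_rfl (h.pd1.memLp hL continuous_const 1)) fun _ hφ =>
      integral_mul_pd1 hL h hφ.toIsSmoothUpToBdry

theorem IsSmoothUpToBdry.isWeakDeriv2 (hL : 0 < L) {F : ℝ × ℝ → ℝ} (h : IsSmoothUpToBdry L F) :
    IsWeakDeriv L 0 (0, 1) F (RoughDomain.pd2 F) :=
  .mk2 (locInt_of_memLp le_rfl (h.memLp hL continuous_const 1))
    (locInt_of_memLp le_rfl (h.pd2.memLp hL continuous_const 1)) fun φ hφ => by
      rw [integral_mul_pd2 hL h hφ.toIsSmoothUpToBdry]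
      simp [hφ.apply_bdry (z := (_, 0)) le_rfl]

theorem derivNorm_eq (hL : 0 < L) (hγ : Continuous γ) (hp : ∀ x, γ (x + L) = γ x)
    {p : ℝ≥0∞} {β : ℕ × ℕ} {f g : ℝ × ℝ → ℝ} (h : IsWeakDeriv L γ β f g) :
    derivNorm L γ p β f = eLpNorm g p (cellMeasure L γ) := by
  refine le_antisymm (iInf₂_le g h) (le_iInf₂ fun g' hg' => ?_)
  exact (eLpNorm_congr_ae (h.ae_unique hL hγ hp hg')).le

theorem exists_isWeakDeriv_of_derivNorm_lt_top {p : ℝ≥0∞} {β : ℕ × ℕ} {f : ℝ × ℝ → ℝ}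
    (h : derivNorm L γ p β f < ⊤) : ∃ g, IsWeakDeriv L γ β f g := by
  by_contra hn
  push Not at hn
  have : derivNorm L γ p β f = ⊤ := by
    simp only [derivNorm, iInf_eq_top]
    exact fun g hg => absurd hg (hn g)
  exact h.ne this

/-- The open domain is a countable union of compact sets, and the function is integrable on the part
of each in the cell. -/
theorem LocInt.aestronglyMeasurable (hγ : Continuous γ) {f : ℝ × ℝ → ℝ} (h : LocInt L γ f) :
    AEStronglyMeasurable f (cellMeasure L γ) := by
  have hO : IsOpen (unrolled γ) := isOpen_unrolled hγ
  obtain ⟨K, hKc, hKU⟩ : ∃ K : ℕ → Set (ℝ × ℝ), (∀ n, IsCompact (K n) ∧ K n ⊆ unrolled γ) ∧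
      ⋃ n, K n = unrolled γ := by
    obtain ⟨F, hF1, hF2, hF3, -⟩ := hO.exists_iUnion_isClosed
    refine ⟨fun n => ⋃ i ∈ Finset.range n, F i ∩ Metric.closedBall 0 n, fun n => ⟨?_, ?_⟩, ?_⟩
    · exact (Finset.range n).isCompact_biUnion fun i _ =>
        (isCompact_closedBall _ _).inter_left (hF1 i)
    · exact Set.iUnion₂_subset fun i _ => Set.inter_subset_left.trans (hF2 i)
    · refine Set.Subset.antisymm (Set.iUnion_subset fun n => Set.iUnion₂_subset fun i _ =>
        Set.inter_subset_left.trans (hF2 i)) fun z hz => ?_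
      rw [← hF3] at hz
      obtain ⟨i, hi⟩ := Set.mem_iUnion.1 hz
      obtain ⟨n, hn⟩ := exists_nat_ge ‖z‖
      refine Set.mem_iUnion.2 ⟨max n (i + 1), Set.mem_iUnion₂.2 ⟨i, ?_, hi, ?_⟩⟩
      · simp
      · rw [mem_closedBall_zero_iff]
        exact hn.trans (by exact_mod_cast le_max_left _ _)
  have e : cell L γ = ⋃ n, K n ∩ cell L γ := by
    rw [← Set.iUnion_inter, hKU]
    exact (Set.inter_eq_right.2 fun z hz => hz.2.2).symm
  rw [cellMeasure, e]
  exact AEStronglyMeasurable.iUnion fun n => (h _ (hKc n).1 (hKc n).2).aestronglyMeasurable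

end

section

variable {L : ℝ} {γ : ℝ → ℝ}

/-! ### Quantitative Sobolev regularity -/

/-- `SobolevBound L γ k f B`: all weak derivatives of `f` of order at most `k` exist and have `L²` norm at
most `B`. -/
def SobolevBound (L : ℝ) (γ : ℝ → ℝ) : ℕ → (ℝ × ℝ → ℝ) → ℝ≥0 → Prop
  | 0, f, B => AEStronglyMeasurable f (cellMeasure L γ) ∧ eLpNorm f 2 (cellMeasure L γ) ≤ B
  | k + 1, f, B => (AEStronglyMeasurable f (cellMeasure L γ) ∧ eLpNorm f 2 (cellMeasure L γ) ≤ B) ∧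
      ∃ f₁ f₂, IsWeakDeriv L γ (1, 0) f f₁ ∧ IsWeakDeriv L γ (0, 1) f f₂ ∧
        SobolevBound L γ k f₁ B ∧ SobolevBound L γ k f₂ B

/-- A smooth periodic function whose derivatives up to order `k` are bounded by `A`. -/
structure CoeffBound (L : ℝ) (k : ℕ) (A : ℝ≥0) (c : ℝ → ℝ) : Prop where
  smooth : ContDiff ℝ ∞ c
  periodic : ∀ x, c (x + L) = c x
  bound : ∀ j ≤ k, ∀ x, |iteratedDeriv j c x| ≤ A

namespace CoeffBound

variable {k : ℕ} {A : ℝ≥0} {c : ℝ → ℝ}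

theorem abs_le (h : CoeffBound L k A c) (x : ℝ) : |c x| ≤ A := by
  simpa using h.bound 0 (Nat.zero_le _) x

theorem deriv (h : CoeffBound L (k + 1) A c) : CoeffBound L k A (deriv c) where
  smooth := contDiff_deriv h.smooth
  periodic := deriv_periodic h.periodic
  bound j hj x := by
    rw [← iteratedDeriv_succ']; exact h.bound (j + 1) (by omega) x

theorem of_le (h : CoeffBound L k A c) {k' : ℕ} (hk : k' ≤ k) : CoeffBound L k' A c :=
  ⟨h.smooth, h.periodic, fun j hj => h.bound j (hj.trans hk)⟩

end CoeffBound

namespace SobolevBound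

variable {k : ℕ} {f g : ℝ × ℝ → ℝ} {B B' : ℝ≥0}

theorem base (h : SobolevBound L γ k f B) :
    AEStronglyMeasurable f (cellMeasure L γ) ∧ eLpNorm f 2 (cellMeasure L γ) ≤ B := by
  cases k with
  | zero => exact h
  | succ k => exact h.1

theorem memLp (h : SobolevBound L γ k f B) : MemLp f 2 (cellMeasure L γ) :=
  ⟨h.base.1, h.base.2.trans_lt ENNReal.coe_lt_top⟩

theorem pred (h : SobolevBound L γ (k + 1) f B) : SobolevBound L γ k f B := by
  induction k generalizing f with
  | zero => exact h.1
  | succ k ih =>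
    obtain ⟨h0, f₁, f₂, w1, w2, s1, s2⟩ := h
    exact ⟨h0, f₁, f₂, w1, w2, ih s1, ih s2⟩

theorem of_le (h : SobolevBound L γ k f B) {k' : ℕ} (hk : k' ≤ k) : SobolevBound L γ k' f B := by
  induction hk with
  | refl => exact h
  | step _ ih => exact ih h.pred

theorem mono (h : SobolevBound L γ k f B) (hB : B ≤ B') : SobolevBound L γ k f B' := by
  induction k generalizing f with
  | zero => exact ⟨h.1, h.2.trans (ENNReal.coe_le_coe.2 hB)⟩
  | succ k ih =>
    obtain ⟨h0, f₁, f₂, w1, w2, s1, s2⟩ := h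
    exact ⟨⟨h0.1, h0.2.trans (ENNReal.coe_le_coe.2 hB)⟩, f₁, f₂, w1, w2, ih s1, ih s2⟩

theorem congr (h : SobolevBound L γ k f B) (e : f =ᵐ[cellMeasure L γ] g) : SobolevBound L γ k g B := by
  have h0 : AEStronglyMeasurable g (cellMeasure L γ) ∧ eLpNorm g 2 (cellMeasure L γ) ≤ B :=
    ⟨h.base.1.congr e, (eLpNorm_congr_ae e).symm.le.trans h.base.2⟩
  cases k with
  | zero => exact h0
  | succ k =>
    obtain ⟨-, f₁, f₂, w1, w2, s1, s2⟩ := h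
    exact ⟨h0, f₁, f₂, w1.congr e ae_eq_rfl, w2.congr e ae_eq_rfl, s1, s2⟩

theorem add (hγ : Continuous γ) (h : SobolevBound L γ k f B) (h' : SobolevBound L γ k g B') :
    SobolevBound L γ k (fun z => f z + g z) (B + B') := by
  have h0 : ∀ {f g : ℝ × ℝ → ℝ}, (AEStronglyMeasurable f (cellMeasure L γ) ∧
      eLpNorm f 2 (cellMeasure L γ) ≤ B) → (AEStronglyMeasurable g (cellMeasure L γ) ∧
      eLpNorm g 2 (cellMeasure L γ) ≤ B') →
      (AEStronglyMeasurable (fun z => f z + g z) (cellMeasure L γ) ∧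
      eLpNorm (fun z => f z + g z) 2 (cellMeasure L γ) ≤ (B + B' : ℝ≥0)) := by
    intro f g hf hg
    refine ⟨hf.1.add hg.1, (eLpNorm_add_le hf.1 hg.1 (by norm_num)).trans ?_⟩
    rw [ENNReal.coe_add]
    exact add_le_add hf.2 hg.2
  induction k generalizing f g with
  | zero => exact h0 h h'
  | succ k ih =>
    obtain ⟨hf, f₁, f₂, w1, w2, s1, s2⟩ := h
    obtain ⟨hg, g₁, g₂, w1', w2', s1', s2'⟩ := h'
    exact ⟨h0 hf hg, _, _, w1.add hγ w1', w2.add hγ w2', ih s1 s1', ih s2 s2'⟩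

theorem _root_.RoughDomain.eLpNorm_coeff_mul_le {A : ℝ≥0} {c : ℝ × ℝ → ℝ} (hA : ∀ x, |c x| ≤ A)
    (p : ℝ≥0∞) (μ : Measure (ℝ × ℝ)) : eLpNorm (fun z => c z * f z) p μ ≤ A * eLpNorm f p μ := by
  refine eLpNorm_le_nnreal_smul_eLpNorm_of_ae_le_mul (ae_of_all _ fun z => ?_) p
  have : |c z * f z| ≤ A * |f z| := by
    rw [abs_mul]; exact mul_le_mul_of_nonneg_right (hA z) (abs_nonneg _)
  exact_mod_cast this

/-- Each application of the product rule at most doubles the number of terms, which accounts for the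
factor 2 ^ k. -/
theorem coeff_mul (hγ : Continuous γ) {A : ℝ≥0} {c : ℝ → ℝ} (hc : CoeffBound L k A c)
    (h : SobolevBound L γ k f B) :
    SobolevBound L γ k (fun z => c z.1 * f z) (2 ^ k * A * B) := by
  have h0 : ∀ {f : ℝ × ℝ → ℝ} {c : ℝ → ℝ} (k : ℕ), (∀ x, |c x| ≤ A) → ContDiff ℝ ∞ c →
      (AEStronglyMeasurable f (cellMeasure L γ) ∧
      eLpNorm f 2 (cellMeasure L γ) ≤ B) → 
      (AEStronglyMeasurable (fun z => c z.1 * f z) (cellMeasure L γ) ∧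
      eLpNorm (fun z => c z.1 * f z) 2 (cellMeasure L γ) ≤ (2 ^ k * A * B : ℝ≥0)) := by
    intro f c k hA hc hf
    refine ⟨(contDiff_comp_fst hc).continuous.aestronglyMeasurable.mul hf.1,
      (eLpNorm_coeff_mul_le (c := fun z => c z.1) (fun z => hA z.1) _ _).trans ?_⟩
    calc (A : ℝ≥0∞) * eLpNorm f 2 (cellMeasure L γ) ≤ A * B := by gcongr; exact hf.2
      _ ≤ (2 ^ k * A * B : ℝ≥0) := by
        rw [← ENNReal.coe_mul, ENNReal.coe_le_coe, mul_assoc]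
        exact le_mul_of_one_le_left (by positivity) (one_le_pow₀ (by norm_num))
  induction k generalizing f c with
  | zero => exact h0 0 hc.abs_le hc.smooth h
  | succ k ih =>
    have hpred := h.pred
    obtain ⟨hf, f₁, f₂, w1, w2, s1, s2⟩ := h
    refine ⟨h0 _ hc.abs_le hc.smooth hf, _, _, w1.coeff_mul1 hγ hc.smooth hc.periodic,
      w2.coeff_mul2 hγ hc.smooth hc.periodic, ?_, ?_⟩
    · refine ((ih (hc.of_le (Nat.le_succ k)) s1).add hγ (ih hc.deriv hpred)).mono (le_of_eq ?_)
      ring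
    · refine (ih (hc.of_le (Nat.le_succ k)) s2).mono ?_
      gcongr <;> norm_num

theorem const_mul (hγ : Continuous γ) (c : ℝ) (h : SobolevBound L γ k f B) :
    SobolevBound L γ k (fun z => c * f z) (‖c‖₊ * B) := by
  have h0 : ∀ {f : ℝ × ℝ → ℝ}, (AEStronglyMeasurable f (cellMeasure L γ) ∧
      eLpNorm f 2 (cellMeasure L γ) ≤ B) → 
      (AEStronglyMeasurable (fun z => c * f z) (cellMeasure L γ) ∧
      eLpNorm (fun z => c * f z) 2 (cellMeasure L γ) ≤ (‖c‖₊ * B : ℝ≥0)) := by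
    intro f hf
    refine ⟨hf.1.const_mul c,
      (eLpNorm_coeff_mul_le (c := fun _ => c) (A := ‖c‖₊) (fun z => le_rfl) _ _).trans ?_⟩
    rw [ENNReal.coe_mul]; gcongr; exact hf.2
  induction k generalizing f with
  | zero => exact h0 h
  | succ k ih =>
    obtain ⟨hf, f₁, f₂, w1, w2, s1, s2⟩ := h
    exact ⟨h0 hf, _, _, w1.const_mul hγ c, w2.const_mul hγ c, ih s1, ih s2⟩

theorem neg (hγ : Continuous γ) (h : SobolevBound L γ k f B) :
    SobolevBound L γ k (fun z => - f z) B := by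
  have := h.const_mul hγ (-1)
  simpa using this

theorem sub (hγ : Continuous γ) (h : SobolevBound L γ k f B) (h' : SobolevBound L γ k g B') :
    SobolevBound L γ k (fun z => f z - g z) (B + B') := by
  simpa only [sub_eq_add_neg] using h.add hγ (h'.neg hγ)

/-- The constant is chosen before L, γ, κ and f and depends only on k and on the bound A for κ. This
uniformity lets the final constant be independent of ε. -/
theorem comp_shear (k : ℕ) (A : ℝ≥0) : ∃ C : ℝ≥0, 1 ≤ C ∧ ∀ {L : ℝ} {γ κ : ℝ → ℝ} {f : ℝ × ℝ → ℝ}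
    {B : ℝ≥0}, 0 < L → Continuous γ → CoeffBound L k A κ → SobolevBound L (γ + κ) k f B →
    SobolevBound L γ k (fun z => f (shear κ z)) (C * B) := by
  have h0 : ∀ {L : ℝ} {γ κ : ℝ → ℝ} {f : ℝ × ℝ → ℝ} {B C : ℝ≥0}, Continuous γ → Continuous κ →
      1 ≤ C → (AEStronglyMeasurable f (cellMeasure L (γ + κ)) ∧
      eLpNorm f 2 (cellMeasure L (γ + κ)) ≤ B) →
      (AEStronglyMeasurable (fun z => f (shear κ z)) (cellMeasure L γ) ∧
      eLpNorm (fun z => f (shear κ z)) 2 (cellMeasure L γ) ≤ (C * B : ℝ≥0)) := by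
    intro L γ κ f B C hγ hκ hC hf
    have hm := measurePreserving_shear (L := L) hγ hκ
    refine ⟨hf.1.comp_measurePreserving hm, ?_⟩
    have := eLpNorm_comp_measurePreserving (p := 2) hf.1 hm
    refine this.le.trans (hf.2.trans ?_)
    exact ENNReal.coe_le_coe.2 (le_mul_of_one_le_left (by positivity) hC)
  induction k with
  | zero => exact ⟨1, le_rfl, fun hL hγ hκ h => h0 hγ hκ.smooth.continuous le_rfl h⟩
  | succ k ih =>
    obtain ⟨C, hC1, hC⟩ := ih
    -- The factor collects f₁ and κ' f₂, the two terms of the chain rule for ∂₁.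
    have hC' : C ≤ C * (1 + 2 ^ k * A) := le_mul_of_one_le_right (by positivity) (by simp)
    refine ⟨C * (1 + 2 ^ k * A), hC1.trans hC', fun {L γ κ f B} hL hγ hκ h => ?_⟩
    obtain ⟨hf, f₁, f₂, w1, w2, s1, s2⟩ := h
    have hκ0 := hκ.of_le (Nat.le_succ k)
    refine ⟨h0 hγ hκ.smooth.continuous (hC1.trans hC') hf, _, _,
      w1.comp_shear1 hL hγ hκ.smooth hκ.periodic w2,
      w2.comp_shear2 hL hγ hκ.smooth hκ.periodic, ?_, ?_⟩
    · have e := hC hL hγ hκ0 (s1.add (hγ.add hκ.smooth.continuous)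
        (s2.coeff_mul (hγ.add hκ.smooth.continuous) hκ.deriv))
      refine e.mono (le_of_eq ?_)
      ring
    · exact (hC hL hγ hκ0 s2).mono (by gcongr)

theorem exists_isWeakDeriv (h : SobolevBound L γ k f B) {β : ℕ × ℕ} (hβ : β.1 + β.2 ≤ k)
    (hf : LocInt L γ f) :
    ∃ g, IsWeakDeriv L γ β f g ∧ eLpNorm g 2 (cellMeasure L γ) ≤ B := by
  induction k generalizing f β with
  | zero =>
    have : β = (0, 0) := by ext <;> simp <;> omega
    subst this
    exact ⟨f, .zero_order hf, h.2⟩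
  | succ k ih =>
    obtain ⟨h0, f₁, f₂, w1, w2, s1, s2⟩ := h
    obtain ⟨a, b⟩ := β
    cases a with
    | succ a =>
      obtain ⟨g, hg, hB⟩ := ih s1 (β := (a, b)) (by simp at hβ ⊢; omega) w1.locInt_right
      exact ⟨g, w1.comp1 hg, hB⟩
    | zero =>
      cases b with
      | zero => exact ⟨f, .zero_order hf, h0.2⟩
      | succ b =>
        obtain ⟨g, hg, hB⟩ := ih s2 (β := (0, b)) (by simp at hβ ⊢; omega) w2.locInt_right
        exact ⟨g, w2.comp2 hg, hB⟩

theorem of_derivs (hL : 0 < L) (hγ : Continuous γ) (hp : ∀ x, γ (x + L) = γ x)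
    (h : ∀ β : ℕ × ℕ, β.1 + β.2 ≤ k → ∃ g, IsWeakDeriv L γ β f g ∧
      eLpNorm g 2 (cellMeasure L γ) ≤ B) : SobolevBound L γ k f B := by
  induction k generalizing f with
  | zero =>
    obtain ⟨g, hg, hB⟩ := h (0, 0) le_rfl
    have e := hg.ae_unique hL hγ hp (.zero_order hg.locInt_left)
    exact ⟨hg.locInt_left.aestronglyMeasurable hγ, (eLpNorm_congr_ae e).symm.le.trans hB⟩
  | succ k ih =>
    obtain ⟨g, hg, hB⟩ := h (0, 0) (by simp)
    have e := hg.ae_unique hL hγ hp (.zero_order hg.locInt_left)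
    obtain ⟨f₁, w1, -⟩ := h (1, 0) (by simp)
    obtain ⟨f₂, w2, -⟩ := h (0, 1) (by simp)
    refine ⟨⟨hg.locInt_left.aestronglyMeasurable hγ, (eLpNorm_congr_ae e).symm.le.trans hB⟩,
      f₁, f₂, w1, w2, ih fun β hβ => ?_, ih fun β hβ => ?_⟩
    · obtain ⟨q, hq, hB⟩ := h (β.1 + 1, β.2) (by simp; omega)
      exact ⟨q, w1.of_comp1 hq, hB⟩
    · obtain ⟨q, hq, hB⟩ := h (β.1, β.2 + 1) (by simp; omega)
      exact ⟨q, w2.of_comp2 hq, hB⟩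

end SobolevBound

theorem derivNorm_le_sobolevNorm {f : ℝ × ℝ → ℝ} {k : ℕ} {β : ℕ × ℕ} (hβ : β.1 + β.2 ≤ k) :
    derivNorm L γ 2 β f ≤ sobolevNorm L γ k f := by
  have h1 : derivNorm L γ 2 β f ^ 2 ≤ ∑ j ∈ Finset.range (k + 1),
      ∑ β ∈ Finset.HasAntidiagonal.antidiagonal j, derivNorm L γ 2 β f ^ 2 := by
    refine le_trans ?_ (Finset.single_le_sum (fun _ _ => zero_le)
      (Finset.mem_range.2 (Nat.lt_succ_of_le hβ)))
    exact Finset.single_le_sum (f := fun β => derivNorm L γ 2 β f ^ 2) (fun _ _ => zero_le)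
      (Finset.HasAntidiagonal.mem_antidiagonal.2 rfl)
  calc derivNorm L γ 2 β f = (derivNorm L γ 2 β f ^ 2) ^ (1 / 2 : ℝ) := by
        rw [← ENNReal.rpow_natCast, ← ENNReal.rpow_mul]; norm_num
    _ ≤ _ := ENNReal.rpow_le_rpow h1 (by norm_num)

theorem rpow_half_sq (x : ℝ≥0∞) : (x ^ 2) ^ (1 / 2 : ℝ) = x := by
  rw [← ENNReal.rpow_natCast, ← ENNReal.rpow_mul]; norm_num

theorem sobolevBound_of_sobolevNorm_le (hL : 0 < L) (hγ : Continuous γ) (hp : ∀ x, γ (x + L) = γ x)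
    {f : ℝ × ℝ → ℝ} {k : ℕ} {B : ℝ≥0} (h : sobolevNorm L γ k f ≤ B) : SobolevBound L γ k f B := by
  refine SobolevBound.of_derivs hL hγ hp fun β hβ => ?_
  have h1 := (derivNorm_le_sobolevNorm hβ).trans h
  obtain ⟨g, hg⟩ := exists_isWeakDeriv_of_derivNorm_lt_top (h1.trans_lt ENNReal.coe_lt_top)
  exact ⟨g, hg, (derivNorm_eq hL hγ hp hg).symm.le.trans h1⟩

/-- The constant is the number of multi-indices of order at most k. -/
theorem sobolevNorm_le_of_sobolevBound (k : ℕ) : ∃ C : ℝ≥0, ∀ {L : ℝ} {γ : ℝ → ℝ}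
    {f : ℝ × ℝ → ℝ} {B : ℝ≥0}, SobolevBound L γ k f B →
    sobolevNorm L γ k f ≤ C * B := by
  set N : ℕ := ∑ j ∈ Finset.range (k + 1), (Finset.HasAntidiagonal.antidiagonal j).card with hN
  have hN1 : 1 ≤ N := by
    rw [hN, Finset.sum_range_succ']
    simp
  refine ⟨N, fun {L γ f B} h => ?_⟩
  have h1 : ∑ j ∈ Finset.range (k + 1), ∑ β ∈ Finset.HasAntidiagonal.antidiagonal j,
      derivNorm L γ 2 β f ^ 2 ≤ (N * B) ^ 2 := by
    calc _ ≤ ∑ j ∈ Finset.range (k + 1), ∑ β ∈ Finset.HasAntidiagonal.antidiagonal j,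
          (B : ℝ≥0∞) ^ 2 := by
          refine Finset.sum_le_sum fun j hj => Finset.sum_le_sum fun β hβ => ?_
          have hβ' : β.1 + β.2 ≤ k := by
            rw [Finset.HasAntidiagonal.mem_antidiagonal.1 hβ]; exact Nat.lt_succ_iff.1 (Finset.mem_range.1 hj)
          obtain ⟨g, hg, hB⟩ := h.exists_isWeakDeriv hβ' (locInt_of_memLp (by norm_num) h.memLp)
          exact pow_le_pow_left' ((iInf₂_le g hg).trans hB) 2
      _ = N * (B : ℝ≥0∞) ^ 2 := by
          simp only [Finset.sum_const, nsmul_eq_mul, ← Finset.sum_mul, hN]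
          push_cast; rfl
      _ ≤ (N * B) ^ 2 := by
          rw [mul_pow]
          gcongr
          exact_mod_cast Nat.le_self_pow (by norm_num) N
  calc sobolevNorm L γ k f ≤ ((N * B : ℝ≥0∞) ^ 2) ^ (1 / 2 : ℝ) :=
        ENNReal.rpow_le_rpow h1 (by norm_num)
    _ = _ := by rw [rpow_half_sq]; push_cast; rfl

theorem le_hNormVec_fst (s : ℤ) (v : ℝ × ℝ → ℝ × ℝ) :
    hNorm L γ s (fun z => (v z).1) ≤ hNormVec L γ s v := by
  rw [← rpow_half_sq (hNorm L γ s fun z => (v z).1)]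
  exact ENNReal.rpow_le_rpow (le_add_right le_rfl) (by norm_num)

theorem le_hNormVec_snd (s : ℤ) (v : ℝ × ℝ → ℝ × ℝ) :
    hNorm L γ s (fun z => (v z).2) ≤ hNormVec L γ s v := by
  rw [← rpow_half_sq (hNorm L γ s fun z => (v z).2)]
  exact ENNReal.rpow_le_rpow (le_add_left le_rfl) (by norm_num)

theorem hNormVec_le_add (s : ℤ) (v : ℝ × ℝ → ℝ × ℝ) :
    hNormVec L γ s v ≤ hNorm L γ s (fun z => (v z).1) + hNorm L γ s (fun z => (v z).2) := by
  rw [← rpow_half_sq (_ + _)]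
  refine ENNReal.rpow_le_rpow ?_ (by norm_num)
  rw [add_sq]
  exact add_le_add (le_add_right le_rfl) le_rfl

end

section

open scoped RealInnerProductSpace

variable {L : ℝ}

/-! ### Translations in `L²` of the periodic half plane -/

/-- The space `L²` of the periodic half plane. -/
abbrev FlatL2 (L : ℝ) : Type := Lp ℝ 2 (cellMeasure L 0)

open Classical in
/-- The class in `L²` of a function, zero if the function is not square integrable. -/
def toL2 (L : ℝ) (f : ℝ × ℝ → ℝ) : FlatL2 L :=
  if h : MemLp f 2 (cellMeasure L 0) then h.toLp f else 0

theorem coeFn_toL2 {f : ℝ × ℝ → ℝ} (h : MemLp f 2 (cellMeasure L 0)) :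
    toL2 L f =ᵐ[cellMeasure L 0] f := by
  rw [toL2, dif_pos h]; exact h.coeFn_toLp

theorem toL2_coeFn (u : FlatL2 L) : toL2 L u = u := by
  rw [toL2, dif_pos (Lp.memLp u), Lp.toLp_coeFn]

theorem norm_toL2 {f : ℝ × ℝ → ℝ} (h : MemLp f 2 (cellMeasure L 0)) :
    ‖toL2 L f‖ = (eLpNorm f 2 (cellMeasure L 0)).toReal := by
  rw [toL2, dif_pos h, Lp.norm_toLp]

theorem toL2_congr {f g : ℝ × ℝ → ℝ} (hf : MemLp f 2 (cellMeasure L 0))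
    (h : f =ᵐ[cellMeasure L 0] g) : toL2 L f = toL2 L g := by
  have hg := (memLp_congr_ae h).1 hf
  exact Lp.ext ((coeFn_toL2 hf).trans (h.trans (coeFn_toL2 hg).symm))

theorem eq_toL2 {u : FlatL2 L} {f : ℝ × ℝ → ℝ} (h : u =ᵐ[cellMeasure L 0] f) : u = toL2 L f := by
  rw [← toL2_congr (Lp.memLp u) h, toL2_coeFn]

theorem inner_toL2 (u : FlatL2 L) {f : ℝ × ℝ → ℝ} (h : MemLp f 2 (cellMeasure L 0)) :
    ⟪u, toL2 L f⟫ = ∫ z, u z * f z ∂cellMeasure L 0 := by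
  rw [L2.inner_def]
  refine integral_congr_ae ?_
  filter_upwards [coeFn_toL2 h] with z hz
  rw [hz]; simp [mul_comm]

theorem toL2_add {f g : ℝ × ℝ → ℝ} (hf : MemLp f 2 (cellMeasure L 0))
    (hg : MemLp g 2 (cellMeasure L 0)) : toL2 L (fun z => f z + g z) = toL2 L f + toL2 L g := by
  refine (eq_toL2 ?_).symm
  filter_upwards [Lp.coeFn_add (toL2 L f) (toL2 L g), coeFn_toL2 hf, coeFn_toL2 hg] with z h1 h2 h3
  rw [h1, Pi.add_apply, h2, h3]

theorem toL2_const_mul {f : ℝ × ℝ → ℝ} (hf : MemLp f 2 (cellMeasure L 0)) (c : ℝ) :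
    toL2 L (fun z => c * f z) = c • toL2 L f := by
  refine (eq_toL2 ?_).symm
  filter_upwards [Lp.coeFn_smul c (toL2 L f), coeFn_toL2 hf] with z h1 h2
  rw [h1, Pi.smul_apply, h2, smul_eq_mul]

theorem IsSmoothUpToBdry.memLp_flat (hL : 0 < L) {φ : ℝ × ℝ → ℝ} (h : IsSmoothUpToBdry L φ) :
    MemLp φ 2 (cellMeasure L 0) := h.memLp hL continuous_const 2

/-- The space of test functions. -/
def testSpace (L : ℝ) (γ : ℝ → ℝ) : Submodule ℝ (ℝ × ℝ → ℝ) where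
  carrier := {φ | IsTest L γ φ}
  add_mem' h h' := h.add h'
  zero_mem' := IsTest.zero
  smul_mem' c _ h := h.const_mul c

variable [hL : Fact (0 < L)]

theorem IsTest.memLp_flat {φ : ℝ × ℝ → ℝ} (h : IsTest L 0 φ) :
    MemLp φ 2 (cellMeasure L 0) := h.toIsSmoothUpToBdry.memLp_flat hL.out

/-- The embedding of the test functions in `L²`. -/
def testToL2 (L : ℝ) [Fact (0 < L)] : testSpace L 0 →ₗ[ℝ] FlatL2 L where
  toFun φ := toL2 L φ
  map_add' φ ψ := toL2_add (IsTest.memLp_flat φ.2) (IsTest.memLp_flat ψ.2)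
  map_smul' c φ := toL2_const_mul (IsTest.memLp_flat φ.2) c

/-- An element orthogonal to all test functions vanishes, by the fundamental lemma. -/
theorem denseRange_testToL2 : DenseRange (testToL2 L) := by
  have h : Dense (LinearMap.range (testToL2 L) : Set (FlatL2 L)) := by
    rw [Submodule.dense_iff_topologicalClosure_eq_top, Submodule.topologicalClosure_eq_top_iff,
      Submodule.eq_bot_iff]
    intro u hu
    have h1 : u =ᵐ[cellMeasure L 0] 0 := by
      refine ae_eq_zero_of_test hL.out (γ := 0) continuous_const (fun _ => rfl)
        (locInt_of_memLp (by norm_num) (Lp.memLp u)) fun φ hφ => ?_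
      rw [← inner_toL2 u hφ.memLp_flat, real_inner_comm]
      exact hu _ ⟨⟨φ, hφ⟩, rfl⟩
    exact Lp.eq_zero_iff_ae_eq_zero.2 h1
  exact h

theorem norm_le_of_test {u : FlatL2 L} {M : ℝ} (hM : 0 ≤ M)
    (h : ∀ φ, IsTest L 0 φ → |⟪u, toL2 L φ⟫| ≤ M * ‖toL2 L φ‖) : ‖u‖ ≤ M := by
  have h1 : ∀ x : FlatL2 L, |⟪u, x⟫| ≤ M * ‖x‖ := fun x =>
    denseRange_testToL2.induction_on (p := fun x => |⟪u, x⟫| ≤ M * ‖x‖) x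
      (isClosed_le (by fun_prop) (by fun_prop)) fun φ => h φ φ.2
  have h2 := h1 u
  rw [real_inner_self_eq_norm_sq, abs_of_nonneg (sq_nonneg _)] at h2
  rcases eq_or_lt_of_le (norm_nonneg u) with h0 | h0
  · rw [← h0]; exact hM
  · nlinarith

/-- Translation by `t` in the first variable. -/
def translate (L : ℝ) [hL : Fact (0 < L)] (t : ℝ) : FlatL2 L →ₗᵢ[ℝ] FlatL2 L :=
  Lp.compMeasurePreservingₗᵢ ℝ (shift L t) (measurePreserving_shift hL.out t)

theorem coeFn_translate (t : ℝ) (u : FlatL2 L) :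
    translate L t u =ᵐ[cellMeasure L 0] fun z => u (shift L t z) :=
  Lp.coeFn_compMeasurePreserving u (measurePreserving_shift hL.out t)

theorem translate_toL2_shift {f : ℝ × ℝ → ℝ} (t : ℝ) (hf : MemLp f 2 (cellMeasure L 0)) :
    translate L t (toL2 L f) = toL2 L (fun z => f (shift L t z)) := by
  refine eq_toL2 ((coeFn_translate t _).trans ?_)
  exact (measurePreserving_shift hL.out t).quasiMeasurePreserving.ae_eq_comp (coeFn_toL2 hf)

theorem translate_toL2 {φ : ℝ × ℝ → ℝ} (t : ℝ) (hφ : IsSmoothUpToBdry L φ) :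
    translate L t (toL2 L φ) = toL2 L (fun z => φ (z.1 + t, z.2)) := by
  rw [translate_toL2_shift t (hφ.memLp_flat hL.out)]
  congr 1
  funext z
  exact apply_shift hL.out hφ.periodic t z

theorem translate_translate (s t : ℝ) (u : FlatL2 L) :
    translate L s (translate L t u) = translate L (s + t) u := by
  refine Lp.ext ?_
  have h1 := (measurePreserving_shift hL.out s).quasiMeasurePreserving.ae_eq_comp
    (coeFn_translate t u)
  filter_upwards [coeFn_translate s (translate L t u), coeFn_translate (s + t) u, h1]
    with z h1 h2 h3
  rw [h1, h2]
  simp only [Function.comp] at h3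
  rw [h3, shift_shift hL.out]

theorem translate_zero (u : FlatL2 L) : translate L 0 u = u := by
  refine Lp.ext ?_
  filter_upwards [coeFn_translate 0 u, ae_mem_cell (γ := 0) continuous_const] with z h1 h2
  rw [h1, shift_zero h2]

theorem inner_translate (t : ℝ) (u x : FlatL2 L) :
    ⟪translate L t u, x⟫ = ⟪u, translate L (-t) x⟫ := by
  rw [← (translate L t).inner_map_map u (translate L (-t) x), translate_translate]
  simp [translate_zero]

/-- The derivative in t falls on the smooth factor only, so no regularity of u is needed. -/
theorem hasDerivAt_inner_translate (u : FlatL2 L) {φ : ℝ × ℝ → ℝ} (hφ : IsSmoothUpToBdry L φ)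
    (t : ℝ) : HasDerivAt (fun t => ⟪u, translate L t (toL2 L φ)⟫)
      ⟪u, translate L t (toL2 L (pd1 φ))⟫ t := by
  have e : ∀ (ψ : ℝ × ℝ → ℝ), IsSmoothUpToBdry L ψ → ∀ t, ⟪u, translate L t (toL2 L ψ)⟫
      = ∫ z, u z * ψ (z.1 + t, z.2) ∂cellMeasure L 0 := fun ψ hψ t => by
    rw [translate_toL2 t hψ, inner_toL2 _ ((hψ.shift1 t).memLp_flat hL.out)]
  rw [e _ hφ.pd1 t, funext (e φ hφ)]
  obtain ⟨C, hC0, hC⟩ := hφ.pd1.exists_bound hL.out 0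
  obtain ⟨R, hR⟩ := hφ.pd1.bounded_supp
  -- A dominating function valid for all translates at once: ∂₁φ is bounded by C and vanishes above
  -- height R, and horizontal translation changes neither.
  set b : ℝ × ℝ → ℝ := {z : ℝ × ℝ | z.2 < R}.indicator (fun _ => C) with hb
  have hbm : MemLp b 2 (cellMeasure L 0) := by
    refine memLp_of_bound_of_supp (γ := 0) (R := R) (C := C) continuous_const ?_ ?_ ?_ 2
    · exact measurable_const.indicator (measurableSet_lt measurable_snd measurable_const)
    · intro z _ hz
      exact Set.indicator_of_notMem (by simpa using hz) _
    · intro z _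
      simp only [hb, Set.indicator]
      split_ifs <;> simp [abs_of_nonneg hC0, hC0]
  refine (hasDerivAt_integral_of_dominated_loc_of_deriv_le (s := Set.univ)
    (bound := fun z => |u z| * b z) (μ := cellMeasure L 0) (x₀ := t)
    (F := fun t z => u z * φ (z.1 + t, z.2)) (F' := fun t z => u z * pd1 φ (z.1 + t, z.2)) univ_mem
    (Eventually.of_forall fun s => ?_) ?_ ?_ ?_ ?_ ?_).2
  · exact (Lp.aestronglyMeasurable u).mul (hφ.shift1 s).smooth.continuous.aestronglyMeasurable
  · exact MemLp.integrable_mul_smooth hL.out continuous_const (Lp.memLp u) (hφ.shift1 t)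
  · exact (Lp.aestronglyMeasurable u).mul
      (hφ.pd1.shift1 t).smooth.continuous.aestronglyMeasurable
  · filter_upwards [ae_mem_cell (γ := 0) continuous_const] with z hz s _
    rw [Real.norm_eq_abs, abs_mul]
    refine mul_le_mul_of_nonneg_left ?_ (abs_nonneg _)
    by_cases h : z.2 < R
    · rw [hb, Set.indicator_of_mem (by exact h)]
      exact hC _ hz.2.2.le
    · rw [hR (z.1 + s, z.2) (not_lt.1 h), abs_zero, hb, Set.indicator_of_notMem (by exact h)]
  · exact MemLp.integrable_mul (p := 2) (q := 2) (Lp.memLp u).abs hbm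
  · refine ae_of_all _ fun z s _ => HasDerivAt.const_mul _ ?_
    have := hasDerivAt_path hφ.smooth ((hasDerivAt_id s).const_add z.1) (hasDerivAt_const s z.2)
    simpa using this

/-! ### Difference quotients -/

theorem inner_pd1_translate {u u' : FlatL2 L} (h : IsWeakDeriv L 0 (1, 0) u u') {φ : ℝ × ℝ → ℝ}
    (hφ : IsTest L 0 φ) (t : ℝ) :
    ⟪u, translate L t (toL2 L (pd1 φ))⟫ = - ⟪u', translate L t (toL2 L φ)⟫ := by
  rw [translate_toL2 t hφ.pd1.toIsSmoothUpToBdry, translate_toL2 t hφ.toIsSmoothUpToBdry,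
    inner_toL2 _ (hφ.pd1.shift1 t).memLp_flat, inner_toL2 _ (hφ.shift1 t).memLp_flat,
    ← h.int1 (hφ.shift1 t), IsSmoothUpToBdry.pd1_shift hφ.smooth]

theorem hasDerivAt_translate_inner {u u' : FlatL2 L} (h : IsWeakDeriv L 0 (1, 0) u u')
    {φ : ℝ × ℝ → ℝ} (hφ : IsTest L 0 φ) (t : ℝ) :
    HasDerivAt (fun t => ⟪translate L t u, toL2 L φ⟫) ⟪translate L t u', toL2 L φ⟫ t := by
  have h1 := (hasDerivAt_inner_translate u hφ.toIsSmoothUpToBdry (-t)).comp t (hasDerivAt_neg t)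
  rw [inner_pd1_translate h hφ] at h1
  simp only [inner_translate]
  simpa [Function.comp_def] using h1

/-- The mean value inequality for t ↦ ⟪translate t u, φ⟫, followed by duality against the dense set
of test functions. -/
theorem norm_translate_sub_le {u u' : FlatL2 L} (h : IsWeakDeriv L 0 (1, 0) u u') (t : ℝ) :
    ‖translate L t u - u‖ ≤ |t| * ‖u'‖ := by
  refine norm_le_of_test (by positivity) fun φ hφ => ?_
  have := Convex.norm_image_sub_le_of_norm_hasDerivWithin_le (s := Set.univ)
    (C := ‖u'‖ * ‖toL2 L φ‖) (x := 0) (y := t)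
    (fun s _ => (hasDerivAt_translate_inner h hφ s).hasDerivWithinAt) (fun s _ => ?_) convex_univ
    (Set.mem_univ _) (Set.mem_univ _)
  · rw [translate_zero, ← inner_sub_left, sub_zero, Real.norm_eq_abs, Real.norm_eq_abs] at this
    linarith
  · refine (norm_inner_le_norm _ _).trans ?_
    rw [LinearIsometry.norm_map]

/-- The difference quotient of step `t`. -/
def diffQuot (L : ℝ) [Fact (0 < L)] (t : ℝ) : FlatL2 L →ₗ[ℝ] FlatL2 L :=
  t⁻¹ • ((translate L t).toLinearMap - LinearMap.id)

theorem diffQuot_apply (t : ℝ) (u : FlatL2 L) :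
    diffQuot L t u = t⁻¹ • (translate L t u - u) := rfl

theorem norm_diffQuot_le {u u' : FlatL2 L} (h : IsWeakDeriv L 0 (1, 0) u u') (t : ℝ) :
    ‖diffQuot L t u‖ ≤ ‖u'‖ := by
  rw [diffQuot_apply, norm_smul, norm_inv, Real.norm_eq_abs]
  rcases eq_or_ne t 0 with rfl | ht
  · simp
  · rw [inv_mul_le_iff₀ (abs_pos.2 ht)]
    exact norm_translate_sub_le h t

/-- Weak convergence of difference quotients: it holds against test functions by differentiation
under the integral, and extends by density because the quotients stay bounded by ‖u'‖. -/
theorem tendsto_inner_diffQuot {u u' : FlatL2 L} (h : IsWeakDeriv L 0 (1, 0) u u')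
    (x : FlatL2 L) :
    Tendsto (fun t => ⟪diffQuot L t u, x⟫) (𝓝[≠] 0) (𝓝 ⟪u', x⟫) := by
  rw [Metric.tendsto_nhds]
  intro ε hε
  -- The tolerance is chosen so that the error ‖d‖ ‖x - φ‖, with ‖d‖ ≤ 2 ‖u'‖, stays below ε / 2.
  obtain ⟨_, hφ, φ, rfl⟩ := Metric.dense_iff.1 (denseRange_testToL2 (L := L)) x
    (ε / (4 * (‖u'‖ + 1))) (by positivity)
  have h1 := hasDerivAt_iff_tendsto_slope.1 (hasDerivAt_translate_inner h φ.2 0)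
  filter_upwards [Metric.tendsto_nhds.1 h1 (ε / 2) (by positivity)] with t ht
  rw [slope_def_module, translate_zero, translate_zero, sub_zero, ← inner_sub_left,
    smul_eq_mul, ← real_inner_smul_left, ← diffQuot_apply, Real.dist_eq, ← inner_sub_left] at ht
  rw [Real.dist_eq, ← inner_sub_left]
  set d := diffQuot L t u - u'
  have h2 : ‖d‖ ≤ 2 * ‖u'‖ := by
    refine (norm_sub_le _ _).trans ?_
    linarith [norm_diffQuot_le h t]
  have h3 : ‖x - toL2 L φ‖ < ε / (4 * (‖u'‖ + 1)) := by
    have := Metric.mem_ball.1 hφ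
    rwa [dist_comm, dist_eq_norm] at this
  have h4 : |⟪d, x - toL2 L φ⟫| ≤ 2 * ‖u'‖ * (ε / (4 * (‖u'‖ + 1))) :=
    (abs_real_inner_le_norm _ _).trans (mul_le_mul h2 h3.le (norm_nonneg _) (by positivity))
  have h5 : 2 * ‖u'‖ * (ε / (4 * (‖u'‖ + 1))) ≤ ε / 2 := by
    rw [mul_div_assoc', div_le_iff₀ (by positivity)]
    nlinarith [norm_nonneg u']
  have h6 : ⟪d, x⟫ = ⟪d, toL2 L φ⟫ + ⟪d, x - toL2 L φ⟫ := by
    rw [← inner_add_right]; simp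
  rw [h6]
  refine (abs_add_le _ _).trans_lt ?_
  linarith

theorem inner_diffQuot_left (t : ℝ) (u x : FlatL2 L) :
    ⟪diffQuot L t u, x⟫ = - ⟪u, diffQuot L (-t) x⟫ := by
  rw [diffQuot_apply, diffQuot_apply, real_inner_smul_left, real_inner_smul_right, inner_sub_left,
    inner_sub_right, inner_translate, inv_neg]
  ring

/-- Extends integration by parts from test functions to smooth functions that need not vanish on the
boundary. Horizontal translations preserve the half plane, so both sides are limits of the same
difference quotients and no boundary term arises. -/
theorem inner_pd1_of_isWeakDeriv {u u' : FlatL2 L} (h : IsWeakDeriv L 0 (1, 0) u u')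
    {φ : ℝ × ℝ → ℝ} (hφ : IsSmoothUpToBdry L φ) :
    ⟪u, toL2 L (pd1 φ)⟫ = - ⟪u', toL2 L φ⟫ := by
  have h1 := tendsto_inner_diffQuot h (toL2 L φ)
  have h2 := ((hasDerivAt_inner_translate u hφ (-0)).comp 0 (hasDerivAt_neg 0))
  have h3 := hasDerivAt_iff_tendsto_slope.1 h2
  have e : ∀ t, slope ((fun t => ⟪u, translate L t (toL2 L φ)⟫) ∘ Neg.neg) 0 t
      = ⟪diffQuot L t u, toL2 L φ⟫ := by
    intro t
    rw [slope_def_module, sub_zero, smul_eq_mul, diffQuot_apply, real_inner_smul_left,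
      inner_sub_left, inner_translate]
    simp [translate_zero]
  have h4 := tendsto_nhds_unique (h3.congr e) h1
  rw [← h4]
  simp [translate_zero]

/-- The bound on the quotients makes φ ↦ -⟪u, ∂₁φ⟫ continuous for the L² norm; its Riesz
representative is the weak derivative. -/
theorem exists_isWeakDeriv_of_diffQuot {u : FlatL2 L} {M : ℝ} (hM : 0 ≤ M)
    (h : ∀ t, ‖diffQuot L t u‖ ≤ M) :
    ∃ u' : FlatL2 L, IsWeakDeriv L 0 (1, 0) u u' ∧ ‖u'‖ ≤ M := by
  have key : ∀ φ, IsTest L 0 φ → |⟪u, toL2 L (pd1 φ)⟫| ≤ M * ‖toL2 L φ‖ := by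
    intro φ hφ
    have h1 := hasDerivAt_iff_tendsto_slope.1
      (hasDerivAt_inner_translate u hφ.toIsSmoothUpToBdry 0)
    have h2 := h1.abs
    rw [translate_zero] at h2
    refine le_of_tendsto h2 (Eventually.of_forall fun t => ?_)
    -- The difference quotient of the test function is moved onto u, which reverses the step.
    have e : slope (fun t => ⟪u, translate L t (toL2 L φ)⟫) 0 t
        = - ⟪diffQuot L (-t) u, toL2 L φ⟫ := by
      rw [inner_diffQuot_left, slope_def_module, sub_zero, smul_eq_mul, neg_neg, neg_neg,
        diffQuot_apply, real_inner_smul_right, inner_sub_right, translate_zero]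
    rw [e, abs_neg]
    exact (abs_real_inner_le_norm _ _).trans (by gcongr; exact h _)
  let D : testSpace L 0 →ₗ[ℝ] ℝ :=
    { toFun := fun φ => - ⟪u, toL2 L (pd1 φ)⟫
      map_add' := fun φ ψ => by
        have e : pd1 ((φ + ψ : testSpace L 0) : ℝ × ℝ → ℝ) = fun z => pd1 φ z + pd1 ψ z :=
          pd1_add φ.2.smooth ψ.2.smooth
        rw [e, toL2_add (IsTest.pd1 φ.2).memLp_flat (IsTest.pd1 ψ.2).memLp_flat, inner_add_right]
        ring
      map_smul' := fun c φ => by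
        have e : pd1 ((c • φ : testSpace L 0) : ℝ × ℝ → ℝ) = fun z => c * pd1 φ z :=
          pd1_const_mul φ.2.smooth c
        rw [e, toL2_const_mul (IsTest.pd1 φ.2).memLp_flat, real_inner_smul_right]
        simp }
  have hD : ∀ φ, ‖D φ‖ ≤ M * ‖testToL2 L φ‖ := fun φ => by
    change |- ⟪u, toL2 L (pd1 φ)⟫| ≤ _
    rw [abs_neg]; exact key φ φ.2
  refine ⟨(InnerProductSpace.toDual ℝ (FlatL2 L)).symm (D.extendOfNorm (testToL2 L)), ?_, ?_⟩
  · refine .mk1 (locInt_of_memLp (by norm_num) (Lp.memLp _))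
      (locInt_of_memLp (by norm_num) (Lp.memLp _)) fun φ hφ => ?_
    rw [← inner_toL2 _ hφ.pd1.memLp_flat, ← inner_toL2 _ hφ.memLp_flat,
      InnerProductSpace.toDual_symm_apply]
    have := LinearMap.extendOfNorm_eq denseRange_testToL2 ⟨M, hD⟩ (⟨φ, hφ⟩ : testSpace L 0)
    have e : (testToL2 L) ⟨φ, hφ⟩ = toL2 L φ := rfl
    rw [← e, this]
    simp [D]
  · rw [LinearIsometryEquiv.norm_map]
    exact LinearMap.opNorm_extendOfNorm_le denseRange_testToL2 hM hD

end

section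

open scoped RealInnerProductSpace

variable {L : ℝ}

/-! ### Multiplication by functions of the first variable -/

/-- Multiplication by a function of the first variable. -/
def mulCoeff (c : ℝ → ℝ) (u : FlatL2 L) : FlatL2 L := toL2 L (fun z => c z.1 * u z)

namespace CoeffBound

variable {k : ℕ} {A : ℝ≥0} {c : ℝ → ℝ}

theorem memLp_mul (h : CoeffBound L k A c) {f : ℝ × ℝ → ℝ} {γ : ℝ → ℝ}
    (hf : MemLp f 2 (cellMeasure L γ)) :
    MemLp (fun z => c z.1 * f z) 2 (cellMeasure L γ) :=
  ⟨(contDiff_comp_fst h.smooth).continuous.aestronglyMeasurable.mul hf.1,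
    (eLpNorm_coeff_mul_le (c := fun z => c z.1) (fun z => h.abs_le z.1) _ _).trans_lt
      (ENNReal.mul_lt_top ENNReal.coe_lt_top hf.2)⟩

theorem coeFn_mulCoeff (h : CoeffBound L k A c) (u : FlatL2 L) :
    mulCoeff c u =ᵐ[cellMeasure L 0] fun z => c z.1 * u z :=
  coeFn_toL2 (h.memLp_mul (Lp.memLp u))

theorem norm_mulCoeff_le (h : CoeffBound L k A c) (u : FlatL2 L) : ‖mulCoeff c u‖ ≤ A * ‖u‖ := by
  rw [mulCoeff, norm_toL2 (h.memLp_mul (Lp.memLp u)), Lp.norm_def]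
  have := eLpNorm_coeff_mul_le (c := fun z => c z.1) (f := u) (fun z => h.abs_le z.1) 2
    (cellMeasure L 0)
  refine (ENNReal.toReal_mono (ENNReal.mul_ne_top ENNReal.coe_ne_top (Lp.eLpNorm_ne_top u))
    this).trans ?_
  rw [ENNReal.toReal_mul, ENNReal.coe_toReal]

theorem abs_sub_le (h : CoeffBound L (k + 1) A c) (x t : ℝ) : |c (x + t) - c x| ≤ A * |t| := by
  have := Convex.norm_image_sub_le_of_norm_hasDerivWithin_le (s := Set.univ) (C := A) (x := x)
    (y := x + t) (fun y _ => (hasDerivAt_of_smooth h.smooth y).hasDerivWithinAt)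
    (fun y _ => h.deriv.abs_le y) convex_univ (Set.mem_univ _) (Set.mem_univ _)
  simpa using this

/-- Discrete product rule: D_t(cu) = c(· + t) D_t u + (D_t c) u, where |D_t c| ≤ A by the mean value
inequality. -/
theorem norm_diffQuot_mulCoeff_le [hL : Fact (0 < L)] (h : CoeffBound L (k + 1) A c)
    (u : FlatL2 L) (t : ℝ) :
    ‖diffQuot L t (mulCoeff c u)‖ ≤ A * ‖diffQuot L t u‖ + A * ‖u‖ := by
  have hs : CoeffBound L 0 A (fun x => c (x + t)) :=
    ⟨h.smooth.comp (contDiff_id.add contDiff_const),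
      fun x => by have := h.periodic (x + t); rwa [add_right_comm] at this,
      fun j hj x => by
        obtain rfl : j = 0 := by omega
        simpa using h.abs_le (x + t)⟩
  have e : diffQuot L t (mulCoeff c u) = mulCoeff (fun x => c (x + t)) (diffQuot L t u)
      + toL2 L (fun z => (t⁻¹ * (c (z.1 + t) - c z.1)) * u z) := by
    have hd : MemLp (fun z : ℝ × ℝ => (t⁻¹ * (c (z.1 + t) - c z.1)) * u z) 2 (cellMeasure L 0) := by
      have h1 := ((hs.memLp_mul (Lp.memLp u)).sub (h.memLp_mul (Lp.memLp u))).const_mul t⁻¹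
      refine h1.congr_norm ?_ (ae_of_all _ fun z => ?_)
      · have hc1 := (contDiff_comp_fst hs.smooth).continuous
        have hc2 := (contDiff_comp_fst h.smooth).continuous
        exact ((hc1.sub hc2).const_mul t⁻¹ |>.aestronglyMeasurable).mul (Lp.aestronglyMeasurable u)
      · simp only [Pi.sub_apply]; congr 1; ring
    rw [diffQuot_apply, diffQuot_apply]
    refine Lp.ext ?_
    have e1 := (measurePreserving_shift hL.out t).quasiMeasurePreserving.ae_eq_comp
      (h.coeFn_mulCoeff u)
    filter_upwards [Lp.coeFn_smul t⁻¹ (translate L t (mulCoeff c u) - mulCoeff c u),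
      Lp.coeFn_sub (translate L t (mulCoeff c u)) (mulCoeff c u), coeFn_translate t (mulCoeff c u),
      h.coeFn_mulCoeff u, e1, Lp.coeFn_add (mulCoeff (fun x => c (x + t))
        (t⁻¹ • (translate L t u - u))) (toL2 L (fun z => (t⁻¹ * (c (z.1 + t) - c z.1)) * u z)),
      hs.coeFn_mulCoeff (t⁻¹ • (translate L t u - u)), coeFn_toL2 hd,
      Lp.coeFn_smul t⁻¹ (translate L t u - u), Lp.coeFn_sub (translate L t u) u,
      coeFn_translate t u] with z h1 h2 h3 h4 h5 h6 h7 h8 h9 h10 h11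
    simp only [Function.comp] at h5
    have h12 : c (shift L t z).1 = c (z.1 + t) := apply_wrap hL.out h.periodic _
    rw [h1, Pi.smul_apply, h2, Pi.sub_apply, h3, h4, h5, h6, Pi.add_apply, h7, h8, h9,
      Pi.smul_apply, h10, Pi.sub_apply, h11, h12]
    simp only [smul_eq_mul]; ring
  rw [e]
  refine (norm_add_le _ _).trans (add_le_add (hs.norm_mulCoeff_le _) ?_)
  have hb : ∀ z : ℝ × ℝ, |t⁻¹ * (c (z.1 + t) - c z.1)| ≤ A := by
    intro z
    rw [abs_mul, abs_inv]
    rcases eq_or_ne t 0 with rfl | ht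
    · simp
    · rw [inv_mul_le_iff₀ (abs_pos.2 ht), mul_comm]; exact h.abs_sub_le _ _
  have h1 := eLpNorm_coeff_mul_le (f := u) hb 2 (cellMeasure L 0)
  have h2 := ENNReal.mul_lt_top (ENNReal.coe_lt_top (r := A)) (Lp.memLp u).2
  by_cases hm : MemLp (fun z : ℝ × ℝ => (t⁻¹ * (c (z.1 + t) - c z.1)) * u z) 2 (cellMeasure L 0)
  · rw [norm_toL2 hm, Lp.norm_def]
    refine (ENNReal.toReal_mono h2.ne h1).trans ?_
    rw [ENNReal.toReal_mul, ENNReal.coe_toReal]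
  · rw [toL2, dif_neg hm, norm_zero]; positivity

theorem isWeakDeriv_mulCoeff (h : CoeffBound L (k + 1) A c) {u u' : FlatL2 L}
    (hu : IsWeakDeriv L 0 (1, 0) u u') :
    IsWeakDeriv L 0 (1, 0) (mulCoeff c u)
      (mulCoeff c u' + mulCoeff (_root_.deriv c) u : FlatL2 L) := by
  refine (hu.coeff_mul1 continuous_const h.smooth h.periodic).congr (h.coeFn_mulCoeff u).symm ?_
  filter_upwards [Lp.coeFn_add (mulCoeff c u') (mulCoeff (_root_.deriv c) u), h.coeFn_mulCoeff u',
    h.deriv.coeFn_mulCoeff u] with z h1 h2 h3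
  rw [h1, Pi.add_apply, h2, h3]

theorem sobolevBound_mulCoeff (h : CoeffBound L k A c) {u : FlatL2 L} {B : ℝ≥0}
    (hu : SobolevBound L 0 k u B) : SobolevBound L 0 k (mulCoeff c u) (2 ^ k * A * B) :=
  (hu.coeff_mul continuous_const h).congr (h.coeFn_mulCoeff u).symm

end CoeffBound

theorem IsWeakDeriv.lp_add {β : ℕ × ℕ} {u u' v v' : FlatL2 L} (h : IsWeakDeriv L 0 β u u')
    (h' : IsWeakDeriv L 0 β v v') :
    IsWeakDeriv L 0 β (u + v : FlatL2 L) (u' + v' : FlatL2 L) :=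
  (h.add continuous_const h').congr (Lp.coeFn_add u v).symm (Lp.coeFn_add u' v').symm

theorem IsWeakDeriv.lp_sub {β : ℕ × ℕ} {u u' v v' : FlatL2 L} (h : IsWeakDeriv L 0 β u u')
    (h' : IsWeakDeriv L 0 β v v') :
    IsWeakDeriv L 0 β (u - v : FlatL2 L) (u' - v' : FlatL2 L) :=
  (h.sub continuous_const h').congr (Lp.coeFn_sub u v).symm (Lp.coeFn_sub u' v').symm

theorem IsWeakDeriv.lp_unique [hL : Fact (0 < L)] {β : ℕ × ℕ} {u u' u'' : FlatL2 L}
    (h : IsWeakDeriv L 0 β u u') (h' : IsWeakDeriv L 0 β u u'') : u' = u'' :=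
  Lp.ext (h.ae_unique hL.out continuous_const (fun _ => rfl) h')

theorem SobolevBound.lp_add {k : ℕ} {u v : FlatL2 L} {B B' : ℝ≥0} (h : SobolevBound L 0 k u B)
    (h' : SobolevBound L 0 k v B') : SobolevBound L 0 k (u + v : FlatL2 L) (B + B') :=
  (h.add continuous_const h').congr (Lp.coeFn_add u v).symm

theorem SobolevBound.lp_sub {k : ℕ} {u v : FlatL2 L} {B B' : ℝ≥0} (h : SobolevBound L 0 k u B)
    (h' : SobolevBound L 0 k v B') : SobolevBound L 0 k (u - v : FlatL2 L) (B + B') :=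
  (h.sub continuous_const h').congr (Lp.coeFn_sub u v).symm

theorem sobolevBound_zero_iff {u : FlatL2 L} {B : ℝ≥0} : SobolevBound L 0 0 u B ↔ ‖u‖ ≤ B := by
  have e : SobolevBound L 0 0 u B ↔ (AEStronglyMeasurable u (cellMeasure L 0) ∧
    eLpNorm u 2 (cellMeasure L 0) ≤ B) := Iff.rfl
  rw [e, Lp.norm_def, ← ENNReal.toReal_le_toReal (Lp.eLpNorm_ne_top u) ENNReal.coe_ne_top]
  simp [Lp.aestronglyMeasurable u]

theorem SobolevBound.norm_le {k : ℕ} {u : FlatL2 L} {B : ℝ≥0} (h : SobolevBound L 0 k u B) :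
    ‖u‖ ≤ B := sobolevBound_zero_iff.1 (h.of_le (Nat.zero_le k))

/-! ### The div-curl system in the flat half plane -/

/-- `(b₁, b₂)` is a gradient whose potential vanishes on the boundary, in the weak sense. -/
def IsTangentPair (b₁ b₂ : FlatL2 L) : Prop :=
  ∀ φ, IsSmoothUpToBdry L φ → ⟪b₂, toL2 L (pd1 φ)⟫ = ⟪b₁, toL2 L (pd2 φ)⟫

/-- `(a₁, a₂)` is a gradient, in the weak sense up to the boundary. -/
def IsGradPair (a₁ a₂ : FlatL2 L) : Prop :=
  ∀ b₁ b₂, IsTangentPair b₁ b₂ → ⟪a₁, b₂⟫ = ⟪a₂, b₁⟫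

/-- Expand 0 = ‖a₁ + b₂‖² and ‖b₁ - a₂‖². The cross terms cancel by the hypothesis on inner
products, which for gradients says that ∫ det ∇V = 0. This is the basic elliptic estimate, with
constant one. -/
theorem norm_sq_of_divCurl {E : Type*} [NormedAddCommGroup E] [InnerProductSpace ℝ E]
    {a₁ a₂ b₁ b₂ : E} (hdiv : a₁ + b₂ = 0) (h : ⟪a₁, b₂⟫ = ⟪a₂, b₁⟫) :
    ‖a₁‖ ^ 2 + ‖a₂‖ ^ 2 + ‖b₁‖ ^ 2 + ‖b₂‖ ^ 2 = ‖b₁ - a₂‖ ^ 2 := by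
  have h1 := norm_add_sq_real a₁ b₂
  have h2 := norm_sub_sq_real b₁ a₂
  rw [hdiv, norm_zero] at h1
  rw [real_inner_comm] at h2
  linarith

theorem norm_le_of_divCurl {E : Type*} [NormedAddCommGroup E] [InnerProductSpace ℝ E]
    {a₁ a₂ b₁ b₂ : E} (hdiv : a₁ + b₂ = 0) (h : ⟪a₁, b₂⟫ = ⟪a₂, b₁⟫) :
    ‖a₁‖ ≤ ‖b₁ - a₂‖ ∧ ‖a₂‖ ≤ ‖b₁ - a₂‖ ∧ ‖b₁‖ ≤ ‖b₁ - a₂‖ ∧ ‖b₂‖ ≤ ‖b₁ - a₂‖ := by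
  have h1 := norm_sq_of_divCurl hdiv h
  refine ⟨?_, ?_, ?_, ?_⟩ <;> refine abs_le_of_sq_le_sq' ?_ (norm_nonneg _) |>.2 <;>
    nlinarith [sq_nonneg ‖a₁‖, sq_nonneg ‖a₂‖, sq_nonneg ‖b₁‖, sq_nonneg ‖b₂‖]

/-- The gradients `a` and `b` of the components of a divergence free vector field that is tangent
to the boundary of the flat half plane, with perturbed curl `f`. -/
structure FlatSystem (c₁ c₂ : ℝ → ℝ) (a₁ a₂ b₁ b₂ f : FlatL2 L) : Prop where
  grad : IsGradPair a₁ a₂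
  tangent : IsTangentPair b₁ b₂
  div : a₁ + b₂ = 0
  curl : b₁ - a₂ = f + mulCoeff c₁ a₁ + mulCoeff c₂ a₂

/-- The perturbation contributes at most (1/4 + 1/4) ‖curl‖, which is absorbed on the left and
leaves the factor 2. -/
theorem FlatSystem.norm_le {c₁ c₂ : ℝ → ℝ} {a₁ a₂ b₁ b₂ f : FlatL2 L}
    (h : FlatSystem c₁ c₂ a₁ a₂ b₁ b₂ f) (h₁ : CoeffBound L 1 (1 / 4) c₁)
    (h₂ : CoeffBound L 1 (1 / 4) c₂) :
    ‖a₁‖ ≤ 2 * ‖f‖ ∧ ‖a₂‖ ≤ 2 * ‖f‖ ∧ ‖b₁‖ ≤ 2 * ‖f‖ ∧ ‖b₂‖ ≤ 2 * ‖f‖ := by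
  obtain ⟨e1, e2, e3, e4⟩ := norm_le_of_divCurl h.div (h.grad _ _ h.tangent)
  have e5 : ‖b₁ - a₂‖ ≤ ‖f‖ + 1 / 4 * ‖a₁‖ + 1 / 4 * ‖a₂‖ := by
    rw [h.curl]
    refine (norm_add_le _ _).trans (add_le_add ((norm_add_le _ _).trans (add_le_add le_rfl ?_)) ?_)
    · simpa using h₁.norm_mulCoeff_le a₁
    · simpa using h₂.norm_mulCoeff_le a₂
  refine ⟨?_, ?_, ?_, ?_⟩ <;> linarith

section

variable [hL : Fact (0 < L)]

theorem IsTangentPair.translate {b₁ b₂ : FlatL2 L} (h : IsTangentPair b₁ b₂) (t : ℝ) :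
    IsTangentPair (translate L t b₁) (translate L t b₂) := by
  intro φ hφ
  have := h _ (hφ.shift1 (-t))
  rw [inner_translate, inner_translate, translate_toL2 _ hφ.pd1, translate_toL2 _ hφ.pd2]
  rwa [IsSmoothUpToBdry.pd1_shift hφ.smooth, IsSmoothUpToBdry.pd2_shift hφ.smooth] at this

theorem IsTangentPair.diffQuot {b₁ b₂ : FlatL2 L} (h : IsTangentPair b₁ b₂) (t : ℝ) :
    IsTangentPair (diffQuot L t b₁) (diffQuot L t b₂) := by
  intro φ hφ
  simp only [diffQuot_apply, real_inner_smul_left, inner_sub_left, h.translate t φ hφ, h φ hφ]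

/-- The quotient moves to the tangent pair against which one tests, and tangency is invariant under
horizontal translation. -/
theorem IsGradPair.diffQuot {a₁ a₂ : FlatL2 L} (h : IsGradPair a₁ a₂) (t : ℝ) :
    IsGradPair (diffQuot L t a₁) (diffQuot L t a₂) := by
  intro b₁ b₂ hb
  rw [inner_diffQuot_left, inner_diffQuot_left, h _ _ (hb.diffQuot (-t))]

/-- Test with ∂₁φ and integrate by parts horizontally, which is allowed up to the boundary. -/
theorem IsTangentPair.weakDeriv {b₁ b₂ b₁' b₂' : FlatL2 L} (h : IsTangentPair b₁ b₂)
    (h1 : IsWeakDeriv L 0 (1, 0) b₁ b₁') (h2 : IsWeakDeriv L 0 (1, 0) b₂ b₂') :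
    IsTangentPair b₁' b₂' := by
  intro φ hφ
  have e := h _ hφ.pd1
  rw [← pd_comm hφ.smooth, inner_pd1_of_isWeakDeriv h2 hφ.pd1,
    inner_pd1_of_isWeakDeriv h1 hφ.pd2] at e
  linarith

theorem IsGradPair.weakDeriv {a₁ a₂ a₁' a₂' : FlatL2 L} (h : IsGradPair a₁ a₂)
    (h1 : IsWeakDeriv L 0 (1, 0) a₁ a₁') (h2 : IsWeakDeriv L 0 (1, 0) a₂ a₂') :
    IsGradPair a₁' a₂' := by
  intro b₁ b₂ hb
  refine tendsto_nhds_unique (tendsto_inner_diffQuot h1 b₂) ?_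
  refine (tendsto_inner_diffQuot h2 b₁).congr fun t => ?_
  exact ((h.diffQuot t) b₁ b₂ hb).symm

/-- The gradient of a test function is a tangent pair; pairing with it says ∂₂a₁ = ∂₁a₂. A vertical
derivative is thus obtained from a horizontal one. -/
theorem IsGradPair.isWeakDeriv2 {a₁ a₂ a₂' : FlatL2 L} (h : IsGradPair a₁ a₂)
    (h2 : IsWeakDeriv L 0 (1, 0) a₂ a₂') : IsWeakDeriv L 0 (0, 1) a₁ a₂' := by
  refine .mk2 (locInt_of_memLp (by norm_num) (Lp.memLp _)) h2.locInt_right fun φ hφ => ?_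
  have ht : IsTangentPair (toL2 L (pd1 φ)) (toL2 L (pd2 φ)) := by
    intro ψ hψ
    rw [real_inner_comm, real_inner_comm (toL2 L (pd2 ψ)), inner_toL2 _ hφ.pd2.memLp_flat,
      inner_toL2 _ hφ.pd1.memLp_flat]
    have e1 : ∀ F, IsSmoothUpToBdry L F → ∀ G : ℝ × ℝ → ℝ, ∫ z, toL2 L F z * G z ∂cellMeasure L 0
        = ∫ z, F z * G z ∂cellMeasure L 0 := fun F hF G =>
      integral_congr_ae ((coeFn_toL2 (hF.memLp_flat hL.out)).mono fun z hz => by simp only [hz])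
    rw [e1 _ hψ.pd1, e1 _ hψ.pd2, integral_mul_pd1 hL.out hψ.pd2 hφ.toIsSmoothUpToBdry,
      integral_mul_pd2 hL.out hψ.pd1 hφ.toIsSmoothUpToBdry, pd_comm hψ.smooth]
    simp [hφ.apply_bdry (z := (_, 0)) le_rfl]
  rw [← h2.int1 hφ, ← inner_toL2 _ hφ.pd2.memLp_flat, ← inner_toL2 _ hφ.pd1.memLp_flat]
  exact h _ _ ht

theorem IsTangentPair.isWeakDeriv2 {b₁ b₂ b₂' : FlatL2 L} (h : IsTangentPair b₁ b₂)
    (h2 : IsWeakDeriv L 0 (1, 0) b₂ b₂') : IsWeakDeriv L 0 (0, 1) b₁ b₂' := by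
  refine .mk2 (locInt_of_memLp (by norm_num) (Lp.memLp _)) h2.locInt_right fun φ hφ => ?_
  rw [← h2.int1 hφ, ← inner_toL2 _ hφ.pd2.memLp_flat, ← inner_toL2 _ hφ.pd1.memLp_flat]
  exact (h _ hφ.toIsSmoothUpToBdry).symm

namespace FlatSystem

variable {c₁ c₂ : ℝ → ℝ} {a₁ a₂ b₁ b₂ f : FlatL2 L}

/-- Nirenberg's method: difference quotients satisfy the same div-curl system, so the basic estimate
bounds them uniformly in t. Their limits satisfy the differentiated system, in which the derivatives
of the coefficients go into the right-hand side. -/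
theorem exists_weakDeriv (h : FlatSystem c₁ c₂ a₁ a₂ b₁ b₂ f) (h₁ : CoeffBound L 1 (1 / 4) c₁)
    (h₂ : CoeffBound L 1 (1 / 4) c₂) {f' : FlatL2 L} (hf : IsWeakDeriv L 0 (1, 0) f f') :
    ∃ a₁' a₂' b₁' b₂' : FlatL2 L, IsWeakDeriv L 0 (1, 0) a₁ a₁' ∧ IsWeakDeriv L 0 (1, 0) a₂ a₂' ∧
      IsWeakDeriv L 0 (1, 0) b₁ b₁' ∧ IsWeakDeriv L 0 (1, 0) b₂ b₂' ∧
      FlatSystem c₁ c₂ a₁' a₂' b₁' b₂' (f' + mulCoeff (deriv c₁) a₁ + mulCoeff (deriv c₂) a₂) := by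
  obtain ⟨n1, n2, -, -⟩ := h.norm_le h₁ h₂
  -- With D = ‖diffQuot b₁ - diffQuot a₂‖ and ‖a₁‖, ‖a₂‖ ≤ 2 ‖f‖, the curl equation gives D ≤ ‖f'‖ +
  -- D / 2 + ‖f‖.
  have key : ∀ t, ‖diffQuot L t a₁‖ ≤ 2 * ‖f'‖ + 2 * ‖f‖ ∧ ‖diffQuot L t a₂‖ ≤ 2 * ‖f'‖ + 2 * ‖f‖ ∧
      ‖diffQuot L t b₁‖ ≤ 2 * ‖f'‖ + 2 * ‖f‖ ∧ ‖diffQuot L t b₂‖ ≤ 2 * ‖f'‖ + 2 * ‖f‖ := by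
    intro t
    have hd : diffQuot L t a₁ + diffQuot L t b₂ = 0 := by rw [← map_add, h.div, map_zero]
    obtain ⟨e1, e2, e3, e4⟩ :=
      norm_le_of_divCurl hd ((h.grad.diffQuot t) _ _ (h.tangent.diffQuot t))
    have e5 : ‖diffQuot L t b₁ - diffQuot L t a₂‖ ≤ ‖f'‖
        + (1 / 4 * ‖diffQuot L t a₁‖ + 1 / 4 * ‖a₁‖)
        + (1 / 4 * ‖diffQuot L t a₂‖ + 1 / 4 * ‖a₂‖) := by
      rw [← map_sub, h.curl, map_add, map_add]
      refine (norm_add_le _ _).trans (add_le_add ((norm_add_le _ _).trans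
        (add_le_add (norm_diffQuot_le hf t) ?_)) ?_)
      · simpa using h₁.norm_diffQuot_mulCoeff_le a₁ t
      · simpa using h₂.norm_diffQuot_mulCoeff_le a₂ t
    refine ⟨?_, ?_, ?_, ?_⟩ <;> linarith
  have hM : 0 ≤ 2 * ‖f'‖ + 2 * ‖f‖ := by positivity
  obtain ⟨a₁', ha₁, -⟩ := exists_isWeakDeriv_of_diffQuot hM fun t => (key t).1
  obtain ⟨a₂', ha₂, -⟩ := exists_isWeakDeriv_of_diffQuot hM fun t => (key t).2.1
  obtain ⟨b₁', hb₁, -⟩ := exists_isWeakDeriv_of_diffQuot hM fun t => (key t).2.2.1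
  obtain ⟨b₂', hb₂, -⟩ := exists_isWeakDeriv_of_diffQuot hM fun t => (key t).2.2.2
  refine ⟨a₁', a₂', b₁', b₂', ha₁, ha₂, hb₁, hb₂, h.grad.weakDeriv ha₁ ha₂,
    h.tangent.weakDeriv hb₁ hb₂, ?_, ?_⟩
  -- The equations are differentiated by comparing the weak derivatives of their two sides.
  · have e1 := ha₁.lp_add hb₂
    have e2 := ha₁.lp_sub ha₁
    rw [h.div] at e1
    rw [sub_self, sub_self] at e2
    exact e1.lp_unique e2
  · have e1 := hb₁.lp_sub ha₂
    have e2 := (hf.lp_add (h₁.isWeakDeriv_mulCoeff ha₁)).lp_add (h₂.isWeakDeriv_mulCoeff ha₂)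
    rw [h.curl] at e1
    rw [e1.lp_unique e2]
    abel

end FlatSystem

end

/-- Induction on k: the horizontal derivatives solve a system of the same type, so the bound of
order k applies to them. The vertical ones are ∂₂a₁ = ∂₁a₂ and ∂₂b₁ = ∂₁b₂, while b₂ = -a₁ and a₂
are recovered from the equations. Only the size 1/4 of c₁, c₂ and the bound A enter the constant,
not L. -/
theorem FlatSystem.sobolevBound (k : ℕ) (A : ℝ≥0) : ∃ C : ℝ≥0, ∀ {L : ℝ} [Fact (0 < L)]
    {c₁ c₂ g : ℝ → ℝ} {a₁ a₂ b₁ b₂ f : FlatL2 L} {B : ℝ≥0},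
    FlatSystem c₁ c₂ a₁ a₂ b₁ b₂ f → CoeffBound L 1 (1 / 4) c₁ → CoeffBound L 1 (1 / 4) c₂ →
    CoeffBound L (k + 1) A c₁ → CoeffBound L (k + 1) A c₂ → CoeffBound L k A g →
    (∀ x, g x * (1 + c₂ x) = 1) → SobolevBound L 0 k f B →
    SobolevBound L 0 k a₁ (C * B) ∧ SobolevBound L 0 k a₂ (C * B) ∧
    SobolevBound L 0 k b₁ (C * B) ∧ SobolevBound L 0 k b₂ (C * B) := by
  induction k with
  | zero =>
    refine ⟨2, fun {L _ c₁ c₂ g a₁ a₂ b₁ b₂ f B} h h₁ h₂ _ _ _ _ hf => ?_⟩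
    obtain ⟨e1, e2, e3, e4⟩ := h.norm_le h₁ h₂
    have hB := hf.norm_le
    simp only [sobolevBound_zero_iff, NNReal.coe_mul, NNReal.coe_ofNat]
    refine ⟨?_, ?_, ?_, ?_⟩ <;> linarith
  | succ k ih =>
    obtain ⟨C, hC⟩ := ih
    set C₁ : ℝ≥0 := max C (C * (1 + 2 ^ k * A * C + 2 ^ k * A * C)) with hC₁
    set C₂ : ℝ≥0 := 2 ^ (k + 1) * A * (C₁ + 1 + 2 ^ (k + 1) * A * C₁) with hC₂
    refine ⟨max C₁ C₂, fun {L hL c₁ c₂ g a₁ a₂ b₁ b₂ f B} h h₁ h₂ hc₁ hc₂ hg hgc hf => ?_⟩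
    obtain ⟨s1, s2, s3, s4⟩ := hC h h₁ h₂ (hc₁.of_le (Nat.le_succ _)) (hc₂.of_le (Nat.le_succ _))
      (hg.of_le (Nat.le_succ _)) hgc hf.pred
    have hf0 := hf
    obtain ⟨-, f₁, -, w1, -, sf1, -⟩ := hf
    set f' : FlatL2 L := toL2 L f₁
    have hf'e : f' =ᵐ[cellMeasure L 0] f₁ := coeFn_toL2 sf1.memLp
    have w1' : IsWeakDeriv L 0 (1, 0) f f' := w1.congr ae_eq_rfl hf'e.symm
    have sf1' : SobolevBound L 0 k f' B := sf1.congr hf'e.symm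
    obtain ⟨a₁', a₂', b₁', b₂', ha₁, ha₂, hb₁, hb₂, hsys⟩ := h.exists_weakDeriv h₁ h₂ w1'
    have sf2 := (sf1'.lp_add ((hc₁.deriv.of_le (Nat.le_succ k)).sobolevBound_mulCoeff s1)).lp_add
      ((hc₂.deriv.of_le (Nat.le_succ k)).sobolevBound_mulCoeff s2)
    obtain ⟨t1, t2, t3, t4⟩ := hC hsys h₁ h₂ (hc₁.of_le (Nat.le_succ _))
      (hc₂.of_le (Nat.le_succ _)) (hg.of_le (Nat.le_succ _)) hgc sf2
    have hle : C * (B + 2 ^ k * A * (C * B) + 2 ^ k * A * (C * B)) ≤ C₁ * B := by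
      calc _ = C * (1 + 2 ^ k * A * C + 2 ^ k * A * C) * B := by ring
        _ ≤ _ := mul_le_mul_left (le_max_right _ _) _
    have hle' : C * B ≤ C₁ * B := mul_le_mul_left (le_max_left _ _) _
    have base : ∀ {u : FlatL2 L}, SobolevBound L 0 k u (C * B) →
        AEStronglyMeasurable u (cellMeasure L 0) ∧
        eLpNorm u 2 (cellMeasure L 0) ≤ (C₁ * B : ℝ≥0) := fun hu => (hu.mono hle').base
    have r1 : SobolevBound L 0 (k + 1) a₁ (C₁ * B) :=
      ⟨base s1, _, _, ha₁, h.grad.isWeakDeriv2 ha₂, t1.mono hle, t2.mono hle⟩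
    have r3 : SobolevBound L 0 (k + 1) b₁ (C₁ * B) :=
      ⟨base s3, _, _, hb₁, h.tangent.isWeakDeriv2 hb₂, t3.mono hle, t4.mono hle⟩
    have r4 : SobolevBound L 0 (k + 1) b₂ (C₁ * B) := by
      have e : b₂ = - a₁ := (neg_eq_of_add_eq_zero_right h.div).symm
      rw [e]
      exact (r1.neg continuous_const).congr (Lp.coeFn_neg a₁).symm
    -- The vertical derivative of a₂ is not a horizontal derivative of anything; instead the curl
    -- equation reads (1 + c₂) a₂ = b₁ - f - c₁ a₁, and g inverts 1 + c₂.
    have r2 : SobolevBound L 0 (k + 1) a₂ (C₂ * B) := by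
      have e : mulCoeff g (b₁ - f - mulCoeff c₁ a₁) = a₂ := by
        refine Lp.ext ?_
        have hcurl : (b₁ - f - mulCoeff c₁ a₁) = a₂ + mulCoeff c₂ a₂ := by
          have := h.curl
          rw [sub_eq_iff_eq_add] at this
          rw [this]; abel
        rw [hcurl]
        filter_upwards [hg.coeFn_mulCoeff (a₂ + mulCoeff c₂ a₂), Lp.coeFn_add a₂ (mulCoeff c₂ a₂),
          hc₂.coeFn_mulCoeff a₂] with z h1 h2 h3
        rw [h1, h2, Pi.add_apply, h3]
        linear_combination (a₂ z) * hgc z.1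
      rw [← e]
      have := hg.sobolevBound_mulCoeff ((r3.lp_sub hf0).lp_sub
        ((hc₁.of_le (Nat.le_succ _)).sobolevBound_mulCoeff r1))
      refine this.mono (le_of_eq ?_)
      rw [hC₂]; ring
    have hm1 : C₁ * B ≤ max C₁ C₂ * B := mul_le_mul_left (le_max_left _ _) _
    have hm2 : C₂ * B ≤ max C₁ C₂ * B := mul_le_mul_left (le_max_right _ _) _
    exact ⟨r1.mono hm1, r2.mono hm2, r3.mono hm1, r4.mono hm1⟩

end

section

open scoped RealInnerProductSpace

variable {L : ℝ} {γ : ℝ → ℝ}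

/-! ### Limits of smooth functions in `H¹` -/

theorem tendsto_toL2 {F : ℕ → ℝ × ℝ → ℝ} {f : ℝ × ℝ → ℝ}
    (hF : ∀ n, MemLp (F n) 2 (cellMeasure L 0)) (hf : MemLp f 2 (cellMeasure L 0))
    (h : Tendsto (fun n => eLpNorm (fun z => f z - F n z) 2 (cellMeasure L 0)) atTop (𝓝 0)) :
    Tendsto (fun n => toL2 L (F n)) atTop (𝓝 (toL2 L f)) := by
  rw [tendsto_iff_norm_sub_tendsto_zero]
  have e : ∀ n, ‖toL2 L (F n) - toL2 L f‖
      = (eLpNorm (fun z => f z - F n z) 2 (cellMeasure L 0)).toReal := fun n => by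
    rw [norm_sub_rev, Lp.norm_def]
    congr 1
    refine eLpNorm_congr_ae ?_
    filter_upwards [Lp.coeFn_sub (toL2 L f) (toL2 L (F n)), coeFn_toL2 hf, coeFn_toL2 (hF n)]
      with z h1 h2 h3
    rw [h1, Pi.sub_apply, h2, h3]
  simp only [e]
  have := (ENNReal.continuousAt_toReal ENNReal.zero_ne_top).tendsto.comp h
  simpa [Function.comp_def] using this

theorem mulCoeff_toL2 {k : ℕ} {A : ℝ≥0} {c : ℝ → ℝ} (hc : CoeffBound L k A c) {f : ℝ × ℝ → ℝ}
    (hf : MemLp f 2 (cellMeasure L 0)) : mulCoeff c (toL2 L f) = toL2 L (fun z => c z.1 * f z) := by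
  refine eq_toL2 ((hc.coeFn_mulCoeff _).trans ?_)
  filter_upwards [coeFn_toL2 hf] with z hz
  rw [hz]

theorem CoeffBound.mulCoeff_sub {k : ℕ} {A : ℝ≥0} {c : ℝ → ℝ} (hc : CoeffBound L k A c)
    (u v : FlatL2 L) : mulCoeff c (u - v) = mulCoeff c u - mulCoeff c v := by
  refine Lp.ext ?_
  filter_upwards [hc.coeFn_mulCoeff (u - v), hc.coeFn_mulCoeff u, hc.coeFn_mulCoeff v,
    Lp.coeFn_sub u v, Lp.coeFn_sub (mulCoeff c u) (mulCoeff c v)] with z h1 h2 h3 h4 h5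
  rw [h1, h4, h5, Pi.sub_apply, Pi.sub_apply, h2, h3]; ring

theorem CoeffBound.continuous_mulCoeff {k : ℕ} {A : ℝ≥0} {c : ℝ → ℝ} (hc : CoeffBound L k A c) :
    Continuous (mulCoeff c : FlatL2 L → FlatL2 L) := by
  refine (LipschitzWith.of_dist_le_mul (K := A) fun u v => ?_).continuous
  rw [dist_eq_norm, dist_eq_norm, ← hc.mulCoeff_sub]
  exact hc.norm_mulCoeff_le _

/-- `V` is the limit in `H¹` of the smooth functions `F n`, and `(a₁, a₂)` is its gradient. -/
structure IsH1Limit (V a₁ a₂ : FlatL2 L) (F : ℕ → ℝ × ℝ → ℝ) : Prop where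
  smooth : ∀ n, IsSmoothUpToBdry L (F n)
  tendsto : Tendsto (fun n => toL2 L (F n)) atTop (𝓝 V)
  tendsto1 : Tendsto (fun n => toL2 L (pd1 (F n))) atTop (𝓝 a₁)
  tendsto2 : Tendsto (fun n => toL2 L (pd2 (F n))) atTop (𝓝 a₂)

/-- For smooth functions the relation is the definition of a tangent pair, and it passes to the
limit in L². -/
theorem IsH1Limit.isGradPair {V a₁ a₂ : FlatL2 L} {F : ℕ → ℝ × ℝ → ℝ} (h : IsH1Limit V a₁ a₂ F) : IsGradPair a₁ a₂ := by
  intro b₁ b₂ hb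
  refine tendsto_nhds_unique (h.tendsto1.inner tendsto_const_nhds) ?_
  refine (h.tendsto2.inner (tendsto_const_nhds (x := b₁))).congr fun n => ?_
  rw [real_inner_comm, real_inner_comm b₂, hb _ (h.smooth n)]

section

variable [hL : Fact (0 < L)]

theorem inner_toL2_toL2 {F G : ℝ × ℝ → ℝ} (hF : IsSmoothUpToBdry L F) (hG : IsSmoothUpToBdry L G) :
    ⟪toL2 L F, toL2 L G⟫ = ∫ z, F z * G z ∂cellMeasure L 0 := by
  rw [inner_toL2 _ (hG.memLp_flat hL.out)]
  exact integral_congr_ae ((coeFn_toL2 (hF.memLp_flat hL.out)).mono fun z hz => by simp only [hz])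

namespace IsH1Limit

variable {V a₁ a₂ W b₁ b₂ : FlatL2 L} {F G : ℕ → ℝ × ℝ → ℝ}

theorem sub (h : IsH1Limit V a₁ a₂ F) (h' : IsH1Limit W b₁ b₂ G) :
    IsH1Limit (V - W) (a₁ - b₁) (a₂ - b₂) (fun n z => F n z + (-1) * G n z) where
  smooth n := (h.smooth n).add ((h'.smooth n).const_mul (-1))
  tendsto := by
    refine (h.tendsto.sub h'.tendsto).congr fun n => ?_
    rw [toL2_add ((h.smooth n).memLp_flat hL.out) (((h'.smooth n).const_mul (-1)).memLp_flat hL.out),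
      toL2_const_mul ((h'.smooth n).memLp_flat hL.out), sub_eq_add_neg, neg_one_smul]
  tendsto1 := by
    refine (h.tendsto1.sub h'.tendsto1).congr fun n => ?_
    rw [pd1_add (h.smooth n).smooth ((h'.smooth n).const_mul (-1)).smooth,
      pd1_const_mul (h'.smooth n).smooth,
      toL2_add ((h.smooth n).pd1.memLp_flat hL.out)
        (((h'.smooth n).pd1.const_mul (-1)).memLp_flat hL.out),
      toL2_const_mul ((h'.smooth n).pd1.memLp_flat hL.out), sub_eq_add_neg, neg_one_smul]
  tendsto2 := by
    refine (h.tendsto2.sub h'.tendsto2).congr fun n => ?_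
    rw [pd2_add (h.smooth n).smooth ((h'.smooth n).const_mul (-1)).smooth,
      pd2_const_mul (h'.smooth n).smooth,
      toL2_add ((h.smooth n).pd2.memLp_flat hL.out)
        (((h'.smooth n).pd2.const_mul (-1)).memLp_flat hL.out),
      toL2_const_mul ((h'.smooth n).pd2.memLp_flat hL.out), sub_eq_add_neg, neg_one_smul]

theorem mulCoeff {k : ℕ} {A : ℝ≥0} {c : ℝ → ℝ} (hc : CoeffBound L (k + 1) A c)
    (h : IsH1Limit V a₁ a₂ F) :
    IsH1Limit (mulCoeff c V) (mulCoeff c a₁ + RoughDomain.mulCoeff (deriv c) V) (mulCoeff c a₂)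
      (fun n z => c z.1 * F n z) where
  smooth n := (h.smooth n).coeff_mul hc.smooth hc.periodic
  tendsto := by
    refine ((hc.continuous_mulCoeff.tendsto _).comp h.tendsto).congr fun n => ?_
    exact mulCoeff_toL2 hc ((h.smooth n).memLp_flat hL.out)
  tendsto1 := by
    refine (((hc.continuous_mulCoeff.tendsto _).comp h.tendsto1).add
      ((hc.deriv.continuous_mulCoeff.tendsto _).comp h.tendsto)).congr fun n => ?_
    simp only [Function.comp]
    rw [pd1_mul (contDiff_comp_fst hc.smooth) (h.smooth n).smooth, pd1_comp_fst hc.smooth,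
      mulCoeff_toL2 hc ((h.smooth n).pd1.memLp_flat hL.out),
      mulCoeff_toL2 hc.deriv ((h.smooth n).memLp_flat hL.out),
      toL2_add (((h.smooth n).coeff_mul hc.deriv.smooth hc.deriv.periodic).memLp_flat hL.out)
        (((h.smooth n).pd1.coeff_mul hc.smooth hc.periodic).memLp_flat hL.out), add_comm]
  tendsto2 := by
    refine ((hc.continuous_mulCoeff.tendsto _).comp h.tendsto2).congr fun n => ?_
    simp only [Function.comp]
    rw [pd2_mul (contDiff_comp_fst hc.smooth) (h.smooth n).smooth, pd2_comp_fst hc.smooth,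
      mulCoeff_toL2 hc ((h.smooth n).pd2.memLp_flat hL.out)]
    simp

theorem inner_pd1 (h : IsH1Limit V a₁ a₂ F) {φ : ℝ × ℝ → ℝ} (hφ : IsSmoothUpToBdry L φ) :
    ⟪V, toL2 L (pd1 φ)⟫ = - ⟪a₁, toL2 L φ⟫ := by
  refine tendsto_nhds_unique (h.tendsto.inner tendsto_const_nhds) ?_
  refine ((h.tendsto1.inner (tendsto_const_nhds (x := toL2 L φ))).neg).congr fun n => ?_
  rw [inner_toL2_toL2 (h.smooth n).pd1 hφ, inner_toL2_toL2 (h.smooth n) hφ.pd1,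
    integral_mul_pd1 hL.out (h.smooth n) hφ]

/-- The hypothesis on boundary integrals is met either because φ vanishes on the boundary or because
the traces of F n tend to zero; the first serves V₁, the second V₂. -/
theorem inner_pd2_of_bdry (h : IsH1Limit V a₁ a₂ F) {φ : ℝ × ℝ → ℝ} (hφ : IsSmoothUpToBdry L φ)
    (h0 : Tendsto (fun n => ∫ x in Set.Ico 0 L, F n (x, 0) * φ (x, 0)) atTop (𝓝 0)) :
    ⟪V, toL2 L (pd2 φ)⟫ = - ⟪a₂, toL2 L φ⟫ := by
  refine tendsto_nhds_unique (h.tendsto.inner tendsto_const_nhds) ?_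
  have := ((h.tendsto2.inner (tendsto_const_nhds (x := toL2 L φ))).neg).sub h0
  rw [sub_zero] at this
  refine this.congr fun n => ?_
  rw [inner_toL2_toL2 (h.smooth n).pd2 hφ, inner_toL2_toL2 (h.smooth n) hφ.pd2,
    integral_mul_pd2 hL.out (h.smooth n) hφ]

theorem isWeakDeriv1 (h : IsH1Limit V a₁ a₂ F) : IsWeakDeriv L 0 (1, 0) V a₁ := by
  refine .mk1 (locInt_of_memLp (by norm_num) (Lp.memLp _))
    (locInt_of_memLp (by norm_num) (Lp.memLp _)) fun φ hφ => ?_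
  rw [← inner_toL2 _ hφ.pd1.memLp_flat, ← inner_toL2 _ hφ.memLp_flat]
  exact h.inner_pd1 hφ.toIsSmoothUpToBdry

theorem isWeakDeriv2 (h : IsH1Limit V a₁ a₂ F) : IsWeakDeriv L 0 (0, 1) V a₂ := by
  refine .mk2 (locInt_of_memLp (by norm_num) (Lp.memLp _))
    (locInt_of_memLp (by norm_num) (Lp.memLp _)) fun φ hφ => ?_
  rw [← inner_toL2 _ hφ.pd2.memLp_flat, ← inner_toL2 _ hφ.memLp_flat]
  refine h.inner_pd2_of_bdry hφ.toIsSmoothUpToBdry ?_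
  simp [hφ.apply_bdry (z := (_, 0)) le_rfl]

end IsH1Limit

/-- Integration by parts in the second variable without boundary term. -/
def HasZeroTrace (V b₂ : FlatL2 L) : Prop :=
  ∀ φ, IsSmoothUpToBdry L φ → ⟪V, toL2 L (pd2 φ)⟫ = - ⟪b₂, toL2 L φ⟫

/-- The boundary over one period has finite length and φ is bounded there, so convergence of the
traces in L² implies convergence of the boundary integrals to zero. -/
theorem IsH1Limit.hasZeroTrace {V b₁ b₂ : FlatL2 L} {F : ℕ → ℝ × ℝ → ℝ} (h : IsH1Limit V b₁ b₂ F)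
    (h0 : Tendsto (fun n => eLpNorm (fun x => F n (x, 0)) 2 (volume.restrict (Set.Ico 0 L))) atTop
      (𝓝 0)) : HasZeroTrace V b₂ := by
  intro φ hφ
  refine h.inner_pd2_of_bdry hφ ?_
  obtain ⟨C, hC0, hC⟩ := hφ.exists_bound hL.out 0
  set μ := (volume : Measure ℝ).restrict (Set.Ico 0 L)
  have hc : ∀ n, Continuous fun x : ℝ => F n (x, 0) := fun n =>
    (h.smooth n).smooth.continuous.comp (by fun_prop)
  have hcφ : Continuous fun x : ℝ => φ (x, 0) := hφ.smooth.continuous.comp (by fun_prop)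
  have h1 : ∀ n, eLpNorm (fun x => F n (x, 0) * φ (x, 0)) 1 μ
      ≤ ENNReal.ofReal C * (eLpNorm (fun x => F n (x, 0)) 2 μ * μ Set.univ ^ (1 / 2 : ℝ)) := by
    intro n
    have e1 : eLpNorm (fun x => F n (x, 0) * φ (x, 0)) 1 μ
        ≤ ENNReal.ofReal C * eLpNorm (fun x => F n (x, 0)) 1 μ := by
      refine eLpNorm_le_mul_eLpNorm_of_ae_le_mul (ae_of_all _ fun x => ?_) 1
      rw [Real.norm_eq_abs, abs_mul, mul_comm]
      exact mul_le_mul_of_nonneg_right (hC _ le_rfl) (abs_nonneg _)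
    refine e1.trans (mul_le_mul_right ?_ _)
    have := eLpNorm_le_eLpNorm_mul_rpow_measure_univ (p := 1) (q := 2) (μ := μ) (by norm_num)
      (hc n).aestronglyMeasurable
    refine this.trans (le_of_eq ?_)
    norm_num
  have hfin : μ Set.univ ^ (1 / 2 : ℝ) ≠ ⊤ := by
    refine ENNReal.rpow_ne_top_of_nonneg (by norm_num) ?_
    simp [μ]
  have h2 : Tendsto (fun n => eLpNorm (fun x => F n (x, 0) * φ (x, 0)) 1 μ) atTop (𝓝 0) := by
    refine tendsto_of_tendsto_of_tendsto_of_le_of_le tendsto_const_nhds ?_ (fun _ => zero_le) h1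
    have := ENNReal.Tendsto.const_mul (a := ENNReal.ofReal C)
      (ENNReal.Tendsto.mul_const (b := μ Set.univ ^ (1 / 2 : ℝ)) h0 (Or.inr hfin))
      (Or.inr ENNReal.ofReal_ne_top)
    simpa using this
  have h3 : Tendsto (fun n => (eLpNorm (fun x => F n (x, 0) * φ (x, 0)) 1 μ).toReal) atTop
      (𝓝 0) := by
    have := (ENNReal.continuousAt_toReal ENNReal.zero_ne_top).tendsto.comp h2
    simpa [Function.comp_def] using this
  refine squeeze_zero_norm (fun n => ?_) h3
  rw [eLpNorm_one_eq_lintegral_enorm, ← integral_norm_eq_lintegral_enorm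
    (f := fun x => F n (x, 0) * φ (x, 0)) ((hc n).mul hcφ).aestronglyMeasurable]
  exact norm_integral_le_integral_norm _

/-- Both sides equal -⟪V, ∂₁∂₂φ⟫ : one by vertical integration by parts without boundary term, the
other by horizontal integration by parts. -/
theorem HasZeroTrace.isTangentPair {V b₁ b₂ : FlatL2 L} (h : HasZeroTrace V b₂)
    (h1 : IsWeakDeriv L 0 (1, 0) V b₁) : IsTangentPair b₁ b₂ := by
  intro φ hφ
  have e1 := h _ hφ.pd1
  have e2 := inner_pd1_of_isWeakDeriv h1 hφ.pd2
  rw [pd_comm hφ.smooth] at e2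
  linarith

end

/-! ### Passage to the flat half plane -/

/-- Flatten, use the divergence theorem on the half plane, and shear back; no divergence theorem on
the rough domain is needed. -/
theorem IsSmoothUpToBdry.isWeakDeriv_rough (hL : 0 < L) (hγ : ContDiff ℝ ∞ γ)
    (hp : ∀ x, γ (x + L) = γ x) {F : ℝ × ℝ → ℝ} (hF : IsSmoothUpToBdry L F) :
    IsWeakDeriv L γ (1, 0) F (RoughDomain.pd1 F) ∧ IsWeakDeriv L γ (0, 1) F (RoughDomain.pd2 F) := by
  have hs := hF.comp_shear hL hγ hp
  have w1 := hs.isWeakDeriv1 hL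
  have w2 := hs.isWeakDeriv2 hL
  have e0 : (0 : ℝ → ℝ) = γ + -γ := by simp
  have hn : ContDiff ℝ ∞ (-γ) := hγ.neg
  have hnp : ∀ x, (-γ) (x + L) = (-γ) x := fun x => by simp [hp x]
  rw [e0] at w1 w2
  have r1 := w1.comp_shear1 hL hγ.continuous hn hnp w2
  have r2 := w2.comp_shear2 hL hγ.continuous hn hnp
  rw [pd1_shear hF.smooth hγ, pd2_shear hF.smooth hγ] at r1
  rw [pd2_shear hF.smooth hγ] at r2
  simp only [shear_shear_neg] at r1 r2
  refine ⟨?_, r2⟩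
  convert r1 using 2 with z
  have : deriv (-γ) z.1 = - deriv γ z.1 := by simp
  rw [this]
  simp [shear]

theorem measurePreserving_shear_zero (hγ : Continuous γ) :
    MeasurePreserving (shear γ) (cellMeasure L 0) (cellMeasure L γ) := by
  have := measurePreserving_shear (L := L) (γ := 0) continuous_const hγ
  rwa [zero_add] at this

theorem memLp_comp_shear (hγ : Continuous γ) {f : ℝ × ℝ → ℝ} (hf : MemLp f 2 (cellMeasure L γ)) :
    MemLp (fun z => f (shear γ z)) 2 (cellMeasure L 0) :=
  hf.comp_measurePreserving (measurePreserving_shear_zero hγ)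

theorem eLpNorm_comp_shear (hγ : Continuous γ) {f : ℝ × ℝ → ℝ} {p : ℝ≥0∞}
    (hf : AEStronglyMeasurable f (cellMeasure L γ)) :
    eLpNorm (fun z => f (shear γ z)) p (cellMeasure L 0) = eLpNorm f p (cellMeasure L γ) :=
  eLpNorm_comp_measurePreserving hf (measurePreserving_shear_zero hγ)

theorem ae_comp_shear (hγ : Continuous γ) {p : ℝ × ℝ → Prop}
    (h : ∀ᵐ z ∂cellMeasure L γ, p z) : ∀ᵐ z ∂cellMeasure L 0, p (shear γ z) :=
  (measurePreserving_shear_zero hγ).quasiMeasurePreserving.ae h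

section

variable [hL : Fact (0 < L)]

theorem tendsto_derivs_of_trace (hγ : ContDiff ℝ ∞ γ) (hp : ∀ x, γ (x + L) = γ x)
    {f f₁ f₂ : ℝ × ℝ → ℝ} {F : ℕ → ℝ × ℝ → ℝ} (hF : ∀ n, IsSmoothUpToBdry L (F n))
    (w1 : IsWeakDeriv L γ (1, 0) f f₁) (w2 : IsWeakDeriv L γ (0, 1) f f₂)
    (h : Tendsto (fun n => sobolevNorm L γ 1 (fun z => f z - F n z)) atTop (𝓝 0)) :
    Tendsto (fun n => eLpNorm (fun z => f z - F n z) 2 (cellMeasure L γ)) atTop (𝓝 0) ∧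
    Tendsto (fun n => eLpNorm (fun z => f₁ z - pd1 (F n) z) 2 (cellMeasure L γ)) atTop (𝓝 0) ∧
    Tendsto (fun n => eLpNorm (fun z => f₂ z - pd2 (F n) z) 2 (cellMeasure L γ)) atTop (𝓝 0) := by
  have hc := hγ.continuous
  have key : ∀ {β : ℕ × ℕ} {g : ℝ × ℝ → ℝ} {G : ℕ → ℝ × ℝ → ℝ}, β.1 + β.2 ≤ 1 →
      IsWeakDeriv L γ β f g → (∀ n, IsWeakDeriv L γ β (F n) (G n)) →
      Tendsto (fun n => eLpNorm (fun z => g z - G n z) 2 (cellMeasure L γ)) atTop (𝓝 0) := by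
    intro β g G hβ hg hG
    refine tendsto_of_tendsto_of_tendsto_of_le_of_le tendsto_const_nhds h (fun _ => zero_le)
      fun n => ?_
    dsimp only
    rw [← derivNorm_eq hL.out hc hp (hg.sub hc (hG n))]
    exact derivNorm_le_sobolevNorm hβ
  refine ⟨key (β := (0, 0)) (by simp) (.zero_order w1.locInt_left) fun n => .zero_order ?_,
    key (by simp) w1 fun n => ((hF n).isWeakDeriv_rough hL.out hγ hp).1,
    key (by simp) w2 fun n => ((hF n).isWeakDeriv_rough hL.out hγ hp).2⟩
  exact locInt_of_memLp le_rfl ((hF n).memLp hL.out hc 1)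

theorem isH1Limit_of_trace {A : ℝ≥0} (hγ : CoeffBound L 2 A γ)
    {f f₁ f₂ : ℝ × ℝ → ℝ} {F : ℕ → ℝ × ℝ → ℝ} (hF : ∀ n, IsSmoothUpToBdry L (F n))
    (w1 : IsWeakDeriv L γ (1, 0) f f₁) (w2 : IsWeakDeriv L γ (0, 1) f f₂)
    (m0 : MemLp f 2 (cellMeasure L γ)) (m1 : MemLp f₁ 2 (cellMeasure L γ))
    (m2 : MemLp f₂ 2 (cellMeasure L γ))
    (h : Tendsto (fun n => sobolevNorm L γ 1 (fun z => f z - F n z)) atTop (𝓝 0)) :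
    IsH1Limit (toL2 L (fun z => f (shear γ z)))
      (toL2 L (fun z => f₁ (shear γ z)) + mulCoeff (deriv γ) (toL2 L (fun z => f₂ (shear γ z))))
      (toL2 L (fun z => f₂ (shear γ z))) (fun n z => F n (shear γ z)) := by
  obtain ⟨t0, t1, t2⟩ := tendsto_derivs_of_trace hγ.smooth hγ.periodic hF w1 w2 h
  have hc := hγ.smooth.continuous
  have key : ∀ {g : ℝ × ℝ → ℝ} {G : ℕ → ℝ × ℝ → ℝ}, MemLp g 2 (cellMeasure L γ) →
      (∀ n, IsSmoothUpToBdry L (G n)) →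
      Tendsto (fun n => eLpNorm (fun z => g z - G n z) 2 (cellMeasure L γ)) atTop (𝓝 0) →
      Tendsto (fun n => toL2 L (fun z => G n (shear γ z))) atTop
        (𝓝 (toL2 L (fun z => g (shear γ z)))) := by
    intro g G hg hG ht
    refine tendsto_toL2 (fun n => memLp_comp_shear hc ((hG n).memLp hL.out hc 2))
      (memLp_comp_shear hc hg) (ht.congr fun n => ?_)
    exact (eLpNorm_comp_shear hc (f := fun z => g z - G n z)
      (hg.1.sub ((hG n).memLp hL.out hc 2).1)).symm
  have k2 := key m2 (fun n => (hF n).pd2) t2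
  refine ⟨fun n => (hF n).comp_shear hL.out hγ.smooth hγ.periodic, key m0 hF t0, ?_, ?_⟩
  · refine ((key m1 (fun n => (hF n).pd1) t1).add
      ((hγ.deriv.continuous_mulCoeff.tendsto _).comp k2)).congr fun n => ?_
    simp only [Function.comp]
    have s1 := (hF n).pd1.comp_shear hL.out hγ.smooth hγ.periodic
    have s2 := (hF n).pd2.comp_shear hL.out hγ.smooth hγ.periodic
    rw [pd1_shear (hF n).smooth hγ.smooth, mulCoeff_toL2 hγ.deriv (s2.memLp_flat hL.out),
      toL2_add (s1.memLp_flat hL.out)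
        ((s2.coeff_mul hγ.deriv.smooth hγ.deriv.periodic).memLp_flat hL.out)]
  · refine k2.congr fun n => ?_
    rw [pd2_shear (hF n).smooth hγ.smooth]

/-- The components `V₁ = v₁`, `V₂ = v₂ - γ' v₁` of a tangent divergence free vector field in
flattened coordinates, with their gradients. -/
structure FlatField (γ : ℝ → ℝ) (v : ℝ × ℝ → ℝ × ℝ) (w : ℝ × ℝ → ℝ)
    (V₁ V₂ a₁ a₂ b₁ b₂ : FlatL2 L) : Prop where
  eq_fst : V₁ =ᵐ[cellMeasure L 0] fun z => (v (shear γ z)).1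
  eq_snd : V₂ =ᵐ[cellMeasure L 0] fun z => (v (shear γ z)).2 - deriv γ z.1 * (v (shear γ z)).1
  deriv_fst1 : IsWeakDeriv L 0 (1, 0) V₁ a₁
  deriv_fst2 : IsWeakDeriv L 0 (0, 1) V₁ a₂
  deriv_snd1 : IsWeakDeriv L 0 (1, 0) V₂ b₁
  deriv_snd2 : IsWeakDeriv L 0 (0, 1) V₂ b₂
  ibp_fst : ∀ φ, IsSmoothUpToBdry L φ → (∀ x, φ (x, 0) = 0) →
    ⟪V₁, toL2 L (pd2 φ)⟫ = - ⟪a₂, toL2 L φ⟫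
  ibp_snd : HasZeroTrace V₂ b₂
  system : FlatSystem (fun x => -2 * deriv γ x) (fun x => deriv γ x ^ 2) a₁ a₂ b₁ b₂
    (toL2 L (fun z => w (shear γ z)) - mulCoeff (deriv (deriv γ)) V₁)

theorem ae_div_eq_zero (hγ : Continuous γ) (hp : ∀ x, γ (x + L) = γ x) {v : ℝ × ℝ → ℝ × ℝ}
    {p q : ℝ × ℝ → ℝ} (h : IsDivFree L γ v) (h1 : IsWeakDeriv L γ (1, 0) (fun z => (v z).1) p)
    (h2 : IsWeakDeriv L γ (0, 1) (fun z => (v z).2) q) :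
    ∀ᵐ z ∂cellMeasure L γ, p z + q z = 0 := by
  refine ae_eq_zero_of_test hL.out hγ hp (h1.locInt_right.add h2.locInt_right) fun φ hφ => ?_
  simp only [add_mul]
  rw [integral_add (h1.locInt_right.integrable_mul hγ hφ)
    (h2.locInt_right.integrable_mul hγ hφ)]
  have e := h.integral_eq φ hφ
  rw [integral_add (h1.locInt_left.integrable_mul hγ hφ.pd1)
    (h2.locInt_left.integrable_mul hγ hφ.pd2), h1.int1 hφ, h2.int2 hφ] at e
  linarith

theorem ae_curl_eq (hγ : Continuous γ) (hp : ∀ x, γ (x + L) = γ x) {v : ℝ × ℝ → ℝ × ℝ}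
    {w p q : ℝ × ℝ → ℝ} (h : IsCurl L γ v w) (h1 : IsWeakDeriv L γ (0, 1) (fun z => (v z).1) p)
    (h2 : IsWeakDeriv L γ (1, 0) (fun z => (v z).2) q) :
    w =ᵐ[cellMeasure L γ] fun z => q z - p z := by
  have key := ae_eq_zero_of_test hL.out hγ hp
    (h.locInt_curl.sub (h2.locInt_right.sub h1.locInt_right)) fun φ hφ => by
      simp only [sub_mul]
      have i1 := h1.locInt_right.integrable_mul hγ hφ
      have i2 := h2.locInt_right.integrable_mul hγ hφ
      have i3 : Integrable (fun z => q z * φ z - p z * φ z) (cellMeasure L γ) := i2.sub i1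
      rw [integral_sub (h.locInt_curl.integrable_mul hγ hφ) i3, integral_sub i2 i1,
        h.integral_eq φ hφ, integral_sub (h2.locInt_left.integrable_mul hγ hφ.pd1)
        (h1.locInt_left.integrable_mul hγ hφ.pd2), h2.int1 hφ, h1.int2 hφ]
      ring
  filter_upwards [key] with z hz
  simpa [sub_eq_zero] using hz

end

end

/-! ### Construction of the flattened field -/

section

open scoped RealInnerProductSpace

variable {L : ℝ} {γ : ℝ → ℝ}

/-- The condition v · n = 0 says g₂ = γ' g₁ on the boundary, so the traces of G n - γ' F n tend to
g₂ - γ' g₁ = 0. -/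
theorem tendsto_trace_combination {A : ℝ≥0} (hγ : CoeffBound L 3 A γ)
    {g₁ g₂ : ℝ → ℝ} {F G : ℕ → ℝ × ℝ → ℝ}
    (hF : ∀ n, IsSmoothUpToBdry L (F n)) (hG : ∀ n, IsSmoothUpToBdry L (G n))
    (hg₁ : MemLp g₁ 2 (volume.restrict (Set.Ico 0 L)))
    (hg₂ : MemLp g₂ 2 (volume.restrict (Set.Ico 0 L)))
    (tF : Tendsto (fun n => eLpNorm (fun s => F n (s, γ s) - g₁ s) 2
      (volume.restrict (Set.Ico 0 L))) atTop (𝓝 0))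
    (tG : Tendsto (fun n => eLpNorm (fun s => G n (s, γ s) - g₂ s) 2
      (volume.restrict (Set.Ico 0 L))) atTop (𝓝 0))
    (hn : ∀ᵐ s ∂(volume.restrict (Set.Ico 0 L)),
      g₁ s * (unitNormal γ s).1 + g₂ s * (unitNormal γ s).2 = 0) :
    Tendsto (fun n => eLpNorm (fun x => G n (shear γ (x, 0))
      + (-1) * (deriv γ x * F n (shear γ (x, 0)))) 2 (volume.restrict (Set.Ico 0 L))) atTop
      (𝓝 0) := by
  set μ := (volume : Measure ℝ).restrict (Set.Ico 0 L)
  have hc := hγ.smooth.continuous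
  have hc' := hγ.deriv.smooth.continuous
  have m1 : ∀ n, AEStronglyMeasurable (fun s => F n (s, γ s) - g₁ s) μ := fun n =>
    ((hF n).smooth.continuous.comp (by fun_prop)).aestronglyMeasurable.sub hg₁.1
  have m2 : ∀ n, AEStronglyMeasurable (fun s => G n (s, γ s) - g₂ s) μ := fun n =>
    ((hG n).smooth.continuous.comp (by fun_prop)).aestronglyMeasurable.sub hg₂.1
  have hb : ∀ n, eLpNorm (fun x => G n (shear γ (x, 0))
      + (-1) * (deriv γ x * F n (shear γ (x, 0)))) 2 μ
      ≤ eLpNorm (fun s => G n (s, γ s) - g₂ s) 2 μ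
        + A * eLpNorm (fun s => F n (s, γ s) - g₁ s) 2 μ := by
    intro n
    have e : (fun x => G n (shear γ (x, 0)) + (-1) * (deriv γ x * F n (shear γ (x, 0)))) =ᵐ[μ]
        fun x => (G n (x, γ x) - g₂ x) + (-deriv γ x) * (F n (x, γ x) - g₁ x) := by
      filter_upwards [hn] with x hx
      have hs : 0 < √(1 + deriv γ x ^ 2) := Real.sqrt_pos.2 (by positivity)
      simp only [unitNormal] at hx
      have h2 : g₂ x = deriv γ x * g₁ x := by
        field_simp at hx
        linarith
      simp only [shear, zero_add]
      rw [h2]; ring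
    rw [eLpNorm_congr_ae e]
    refine (eLpNorm_add_le (m2 n) (hc'.neg.aestronglyMeasurable.mul (m1 n)) (by norm_num)).trans ?_
    refine add_le_add le_rfl ?_
    refine eLpNorm_le_nnreal_smul_eLpNorm_of_ae_le_mul (ae_of_all _ fun x => ?_) 2
    have : |(-deriv γ x) * (F n (x, γ x) - g₁ x)| ≤ A * |F n (x, γ x) - g₁ x| := by
      rw [abs_mul, abs_neg]
      exact mul_le_mul_of_nonneg_right (hγ.deriv.abs_le x) (abs_nonneg _)
    exact_mod_cast this
  refine tendsto_of_tendsto_of_tendsto_of_le_of_le tendsto_const_nhds ?_ (fun _ => zero_le) hb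
  have := tG.add (ENNReal.Tendsto.const_mul (a := (A : ℝ≥0∞)) tF (Or.inr ENNReal.coe_ne_top))
  simpa using this

theorem CoeffBound.neg_two_mul {k : ℕ} {A : ℝ≥0} {c : ℝ → ℝ} (h : CoeffBound L k A c) :
    CoeffBound L 0 (2 * A) (fun x => -2 * c x) where
  smooth := contDiff_const.mul h.smooth
  periodic x := by rw [h.periodic]
  bound j hj x := by
    obtain rfl : j = 0 := by omega
    have := h.abs_le x
    simp only [iteratedDeriv_zero, abs_mul, NNReal.coe_mul]
    norm_num; linarith

theorem CoeffBound.sq {k : ℕ} {A : ℝ≥0} {c : ℝ → ℝ} (h : CoeffBound L k A c) :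
    CoeffBound L 0 (A ^ 2) (fun x => c x ^ 2) where
  smooth := h.smooth.pow 2
  periodic x := by rw [h.periodic]
  bound j hj x := by
    obtain rfl : j = 0 := by omega
    have := h.abs_le x
    simp only [iteratedDeriv_zero, abs_pow, NNReal.coe_pow]
    exact pow_le_pow_left₀ (abs_nonneg _) this 2

/-- The gradients of the components of `v` in `L²`. -/
structure HasGradient (L : ℝ) (γ : ℝ → ℝ) (f f₁ f₂ : ℝ × ℝ → ℝ) : Prop where
  deriv1 : IsWeakDeriv L γ (1, 0) f f₁
  deriv2 : IsWeakDeriv L γ (0, 1) f f₂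
  memLp : MemLp f 2 (cellMeasure L γ)
  memLp1 : MemLp f₁ 2 (cellMeasure L γ)
  memLp2 : MemLp f₂ 2 (cellMeasure L γ)

theorem SobolevBound.exists_hasGradient {k : ℕ} {f : ℝ × ℝ → ℝ} {B : ℝ≥0}
    (h : SobolevBound L γ (k + 1) f B) : ∃ f₁ f₂, HasGradient L γ f f₁ f₂ := by
  have h0 := h.memLp
  obtain ⟨-, f₁, f₂, w1, w2, s1, s2⟩ := h
  exact ⟨f₁, f₂, w1, w2, h0, s1.memLp, s2.memLp⟩

/-- V = (v₁, v₂ - γ' v₁) is the Piola transform of v under the shear: since the Jacobian is one it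
preserves the divergence, and it turns tangency to the graph into V₂ = 0. The explicit formulas for
the gradients are kept for the pointwise estimate. -/
theorem exists_flatField [hL : Fact (0 < L)] {A : ℝ≥0} (hγ : CoeffBound L 3 A γ)
    {v : ℝ × ℝ → ℝ × ℝ} {w p₁ p₂ q₁ q₂ : ℝ × ℝ → ℝ}
    (hv1 : HasGradient L γ (fun z => (v z).1) p₁ p₂)
    (hv2 : HasGradient L γ (fun z => (v z).2) q₁ q₂)
    (hdiv : IsDivFree L γ v) (htan : IsTangent L γ v) (hcurl : IsCurl L γ v w) :
    ∃ V₁ V₂ a₁ a₂ b₁ b₂ : FlatL2 L, FlatField γ v w V₁ V₂ a₁ a₂ b₁ b₂ ∧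
      (a₁ =ᵐ[cellMeasure L 0] fun z => p₁ (shear γ z) + deriv γ z.1 * p₂ (shear γ z)) ∧
      (a₂ =ᵐ[cellMeasure L 0] fun z => p₂ (shear γ z)) ∧
      (b₁ =ᵐ[cellMeasure L 0] fun z => q₁ (shear γ z) + deriv γ z.1 * q₂ (shear γ z)
        - deriv γ z.1 * (p₁ (shear γ z) + deriv γ z.1 * p₂ (shear γ z))
        - deriv (deriv γ) z.1 * (v (shear γ z)).1) ∧
      (b₂ =ᵐ[cellMeasure L 0] fun z => q₂ (shear γ z) - deriv γ z.1 * p₂ (shear γ z)) := by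
  obtain ⟨g₁, g₂, ⟨hg₁, F, hF, tF, tF'⟩, ⟨hg₂, G, hG, tG, tG'⟩, hn⟩ := htan
  have hc := hγ.smooth.continuous
  have hγ2 := hγ.of_le (show 2 ≤ 3 by norm_num)
  have d1 := hγ.deriv
  have d2 := d1.deriv
  have l1 := isH1Limit_of_trace hγ2 hF hv1.deriv1 hv1.deriv2 hv1.memLp hv1.memLp1 hv1.memLp2 tF
  have l2' := isH1Limit_of_trace hγ2 hG hv2.deriv1 hv2.deriv2 hv2.memLp hv2.memLp1 hv2.memLp2 tG
  have l2 := l2'.sub (l1.mulCoeff d1)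
  have tt := tendsto_trace_combination hγ hF hG hg₁ hg₂ tF' tG' hn
  have zt := l2.hasZeroTrace tt
  set U₁ := toL2 L (fun z => (v (shear γ z)).1) with hU₁
  set U₂ := toL2 L (fun z => (v (shear γ z)).2) with hU₂
  set P₁ := toL2 L (fun z => p₁ (shear γ z)) with hP₁
  set P₂ := toL2 L (fun z => p₂ (shear γ z)) with hP₂
  set Q₁ := toL2 L (fun z => q₁ (shear γ z)) with hQ₁
  set Q₂ := toL2 L (fun z => q₂ (shear γ z)) with hQ₂
  have eU₁ : U₁ =ᵐ[cellMeasure L 0] _ := coeFn_toL2 (memLp_comp_shear hc hv1.memLp)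
  have eU₂ : U₂ =ᵐ[cellMeasure L 0] _ := coeFn_toL2 (memLp_comp_shear hc hv2.memLp)
  have eP₁ : P₁ =ᵐ[cellMeasure L 0] _ := coeFn_toL2 (memLp_comp_shear hc hv1.memLp1)
  have eP₂ : P₂ =ᵐ[cellMeasure L 0] _ := coeFn_toL2 (memLp_comp_shear hc hv1.memLp2)
  have eQ₁ : Q₁ =ᵐ[cellMeasure L 0] _ := coeFn_toL2 (memLp_comp_shear hc hv2.memLp1)
  have eQ₂ : Q₂ =ᵐ[cellMeasure L 0] _ := coeFn_toL2 (memLp_comp_shear hc hv2.memLp2)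
  have ea₁ : (P₁ + mulCoeff (deriv γ) P₂ : FlatL2 L) =ᵐ[cellMeasure L 0]
      fun z => p₁ (shear γ z) + deriv γ z.1 * p₂ (shear γ z) := by
    filter_upwards [Lp.coeFn_add P₁ (mulCoeff (deriv γ) P₂), d1.coeFn_mulCoeff P₂, eP₁, eP₂]
      with z h1 h2 h3 h4
    rw [h1, Pi.add_apply, h2, h3, h4]
  have eb₂ : (Q₂ - mulCoeff (deriv γ) P₂ : FlatL2 L) =ᵐ[cellMeasure L 0]
      fun z => q₂ (shear γ z) - deriv γ z.1 * p₂ (shear γ z) := by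
    filter_upwards [Lp.coeFn_sub Q₂ (mulCoeff (deriv γ) P₂), d1.coeFn_mulCoeff P₂, eQ₂, eP₂]
      with z h1 h2 h3 h4
    rw [h1, Pi.sub_apply, h2, h3, h4]
  have eb₁ : (Q₁ + mulCoeff (deriv γ) Q₂ - (mulCoeff (deriv γ) (P₁ + mulCoeff (deriv γ) P₂)
      + mulCoeff (deriv (deriv γ)) U₁) : FlatL2 L) =ᵐ[cellMeasure L 0]
      fun z => q₁ (shear γ z) + deriv γ z.1 * q₂ (shear γ z)
        - deriv γ z.1 * (p₁ (shear γ z) + deriv γ z.1 * p₂ (shear γ z))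
        - deriv (deriv γ) z.1 * (v (shear γ z)).1 := by
    filter_upwards [Lp.coeFn_sub (Q₁ + mulCoeff (deriv γ) Q₂) (mulCoeff (deriv γ)
        (P₁ + mulCoeff (deriv γ) P₂) + mulCoeff (deriv (deriv γ)) U₁),
      Lp.coeFn_add Q₁ (mulCoeff (deriv γ) Q₂), Lp.coeFn_add (mulCoeff (deriv γ)
        (P₁ + mulCoeff (deriv γ) P₂)) (mulCoeff (deriv (deriv γ)) U₁), d1.coeFn_mulCoeff Q₂,
      d1.coeFn_mulCoeff (P₁ + mulCoeff (deriv γ) P₂), d2.coeFn_mulCoeff U₁, ea₁, eQ₁, eQ₂, eU₁]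
      with z h1 h2 h3 h4 h5 h6 h7 h8 h9 h10
    rw [h1, Pi.sub_apply, h2, Pi.add_apply, h3, Pi.add_apply, h4, h5, h6, h7, h8, h9, h10]
    ring
  have eV₂ : (U₂ - mulCoeff (deriv γ) U₁ : FlatL2 L) =ᵐ[cellMeasure L 0]
      fun z => (v (shear γ z)).2 - deriv γ z.1 * (v (shear γ z)).1 := by
    filter_upwards [Lp.coeFn_sub U₂ (mulCoeff (deriv γ) U₁), d1.coeFn_mulCoeff U₁, eU₂, eU₁]
      with z h1 h2 h3 h4
    rw [h1, Pi.sub_apply, h2, h3, h4]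
  have hdiv0 := ae_comp_shear hc (ae_div_eq_zero hc hγ.periodic hdiv hv1.deriv1 hv2.deriv2)
  have hcurl1 := ae_curl_eq hc hγ.periodic hcurl hv1.deriv2 hv2.deriv1
  have hcurl0 := ae_comp_shear hc hcurl1
  have hw : MemLp w 2 (cellMeasure L γ) :=
    (memLp_congr_ae hcurl1).2 (hv2.memLp1.sub hv1.memLp2)
  refine ⟨U₁, _, _, P₂, _, _, ⟨eU₁, eV₂, l1.isWeakDeriv1, l1.isWeakDeriv2, l2.isWeakDeriv1,
    l2.isWeakDeriv2, fun φ hφ h0 => l1.inner_pd2_of_bdry hφ (by simp [h0]), zt,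
    l1.isGradPair, zt.isTangentPair l2.isWeakDeriv1, ?_, ?_⟩, ea₁, eP₂, eb₁, eb₂⟩
  · refine Lp.eq_zero_iff_ae_eq_zero.2 ?_
    filter_upwards [Lp.coeFn_add (P₁ + mulCoeff (deriv γ) P₂) (Q₂ - mulCoeff (deriv γ) P₂), ea₁,
      eb₂, hdiv0] with z h1 h2 h3 h4
    rw [h1, Pi.add_apply, h2, h3, Pi.zero_apply]
    linarith
  · set a₁ : FlatL2 L := P₁ + mulCoeff (deriv γ) P₂ with ha₁
    set b₁ : FlatL2 L := Q₁ + mulCoeff (deriv γ) Q₂ - (mulCoeff (deriv γ) a₁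
      + mulCoeff (deriv (deriv γ)) U₁) with hb₁
    have c1 := d1.neg_two_mul
    have c2 := d1.sq
    set W := toL2 L (fun z => w (shear γ z)) with hW
    have eW : W =ᵐ[cellMeasure L 0] _ := coeFn_toL2 (memLp_comp_shear hc hw)
    refine Lp.ext ?_
    filter_upwards [Lp.coeFn_sub b₁ P₂, eb₁, eP₂, Lp.coeFn_add (W - mulCoeff (deriv (deriv γ)) U₁
        + mulCoeff (fun x => -2 * deriv γ x) a₁) (mulCoeff (fun x => deriv γ x ^ 2) P₂),
      Lp.coeFn_add (W - mulCoeff (deriv (deriv γ)) U₁) (mulCoeff (fun x => -2 * deriv γ x) a₁),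
      Lp.coeFn_sub W (mulCoeff (deriv (deriv γ)) U₁), c1.coeFn_mulCoeff a₁, c2.coeFn_mulCoeff P₂,
      d2.coeFn_mulCoeff U₁, eW, ea₁, eU₁, hdiv0, hcurl0]
      with z h1 h2 h3 h4 h5 h6 h7 h8 h9 h10 h11 h12 h13 h14
    rw [h1, Pi.sub_apply, h2, h4, Pi.add_apply, h5, Pi.add_apply, h6, Pi.sub_apply, h7, h8, h9, h10,
      h11, h12, h3, h14]
    -- The direct computation of curl V gives γ' q₂ - γ' p₁; the divergence equation replaces γ' q₂
    -- by -γ' p₁, which is the source of the coefficient -2γ'.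
    linear_combination (deriv γ z.1) * h13

/-! ### The estimates in `H^k` -/

/-- Bounds for the coefficients of the flattened system. -/
structure GoodProfile (L : ℝ) (k : ℕ) (A : ℝ≥0) (γ : ℝ → ℝ) : Prop where
  profile : CoeffBound L (k + 3) A γ
  small₁ : CoeffBound L 1 (1 / 4) (fun x => -2 * deriv γ x)
  small₂ : CoeffBound L 1 (1 / 4) (fun x => deriv γ x ^ 2)
  bound₁ : CoeffBound L (k + 1) A (fun x => -2 * deriv γ x)
  bound₂ : CoeffBound L (k + 1) A (fun x => deriv γ x ^ 2)
  bound_inv : CoeffBound L k A (fun x => (1 + deriv γ x ^ 2)⁻¹)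

theorem GoodProfile.of_le {k k' : ℕ} {A : ℝ≥0} (h : GoodProfile L k A γ) (hk : k' ≤ k) :
    GoodProfile L k' A γ :=
  ⟨h.profile.of_le (by omega), h.small₁, h.small₂, h.bound₁.of_le (by omega),
    h.bound₂.of_le (by omega), h.bound_inv.of_le hk⟩

theorem CoeffBound.neg {k : ℕ} {A : ℝ≥0} {c : ℝ → ℝ} (h : CoeffBound L k A c) :
    CoeffBound L k A (-c) where
  smooth := h.smooth.neg
  periodic x := by simp [h.periodic x]
  bound j hj x := by
    have : iteratedDeriv j (-c) x = - iteratedDeriv j c x := iteratedDeriv_neg j c x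
    rw [this, abs_neg]; exact h.bound j hj x

/-- The right-hand side w - γ'' V₁ of the flat system involves V₁ itself, so a bound of order k for
V₁ is traded for one of order k + 1; iteration then starts from L². -/
theorem FlatField.sobolevBound_step (k : ℕ) (A : ℝ≥0) : ∃ C : ℝ≥0, ∀ {L : ℝ} [Fact (0 < L)]
    {γ : ℝ → ℝ} {v : ℝ × ℝ → ℝ × ℝ} {w : ℝ × ℝ → ℝ} {V₁ V₂ a₁ a₂ b₁ b₂ : FlatL2 L} {B B' : ℝ≥0},
    GoodProfile L k A γ → FlatField γ v w V₁ V₂ a₁ a₂ b₁ b₂ → SobolevBound L γ k w B →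
    SobolevBound L 0 k V₁ B' → SobolevBound L 0 0 V₂ B' →
    SobolevBound L 0 (k + 1) V₁ (C * (B + B')) ∧ SobolevBound L 0 (k + 1) V₂ (C * (B + B')) := by
  obtain ⟨C₁, hC₁⟩ := FlatSystem.sobolevBound k A
  obtain ⟨C₂, -, hC₂⟩ := SobolevBound.comp_shear k A
  refine ⟨1 + C₁ * (C₂ + 2 ^ k * A), fun {L hL γ v w V₁ V₂ a₁ a₂ b₁ b₂ B B'} hg hf hw h1 h2 => ?_⟩
  have hc := hg.profile.smooth.continuous
  have hw' : SobolevBound L 0 k (toL2 L (fun z => w (shear γ z))) (C₂ * B) := by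
    have e : γ = 0 + γ := (zero_add γ).symm
    have := hC₂ (γ := 0) (κ := γ) (f := w) hL.out continuous_const
      (hg.profile.of_le (show k ≤ k + 3 by omega)) (by rwa [zero_add])
    exact this.congr (coeFn_toL2 (memLp_comp_shear hc hw.memLp)).symm
  have hd2 : CoeffBound L k A (deriv (deriv γ)) := by
    have h3 : CoeffBound L (k + 1 + 1 + 1) A γ := hg.profile
    exact h3.deriv.deriv.of_le (Nat.le_succ k)
  have hF := hw'.lp_sub (hd2.sobolevBound_mulCoeff h1)
  obtain ⟨s1, s2, s3, s4⟩ := hC₁ hf.system hg.small₁ hg.small₂ hg.bound₁ hg.bound₂ hg.bound_inv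
    (fun x => inv_mul_cancel₀ (by positivity)) hF
  have hle : C₁ * (C₂ * B + 2 ^ k * A * B') ≤ (1 + C₁ * (C₂ + 2 ^ k * A)) * (B + B') := by
    calc _ ≤ C₁ * (C₂ * (B + B') + 2 ^ k * A * (B + B')) := by
          gcongr
          · exact le_self_add
          · exact le_add_self
      _ = C₁ * (C₂ + 2 ^ k * A) * (B + B') := by ring
      _ ≤ _ := by gcongr; exact le_add_self
  have hle' : B' ≤ (1 + C₁ * (C₂ + 2 ^ k * A)) * (B + B') := by
    calc B' ≤ 1 * (B + B') := by rw [one_mul]; exact le_add_self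
      _ ≤ _ := by gcongr; exact le_self_add
  exact ⟨⟨(h1.mono hle').base, _, _, hf.deriv_fst1, hf.deriv_fst2, s1.mono hle, s2.mono hle⟩,
    ⟨(h2.mono hle').base, _, _, hf.deriv_snd1, hf.deriv_snd2, s3.mono hle, s4.mono hle⟩⟩

theorem FlatField.sobolevBound (k : ℕ) (A : ℝ≥0) : ∃ C : ℝ≥0, ∀ {L : ℝ} [Fact (0 < L)]
    {γ : ℝ → ℝ} {v : ℝ × ℝ → ℝ × ℝ} {w : ℝ × ℝ → ℝ} {V₁ V₂ a₁ a₂ b₁ b₂ : FlatL2 L} {B B' : ℝ≥0},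
    GoodProfile L k A γ → FlatField γ v w V₁ V₂ a₁ a₂ b₁ b₂ → SobolevBound L γ k w B →
    SobolevBound L 0 0 V₁ B' → SobolevBound L 0 0 V₂ B' →
    SobolevBound L 0 (k + 1) V₁ (C * (B + B')) ∧ SobolevBound L 0 (k + 1) V₂ (C * (B + B')) := by
  induction k with
  | zero => exact FlatField.sobolevBound_step 0 A
  | succ k ih =>
    obtain ⟨C, hC⟩ := ih
    obtain ⟨C', hC'⟩ := FlatField.sobolevBound_step (k + 1) A
    refine ⟨C' * (1 + C), fun {L hL γ v w V₁ V₂ a₁ a₂ b₁ b₂ B B'} hg hf hw h1 h2 => ?_⟩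
    obtain ⟨s1, s2⟩ := hC (hg.of_le (Nat.le_succ k)) hf hw.pred h1 h2
    obtain ⟨t1, t2⟩ := hC' hg hf hw s1 (s2.of_le (Nat.zero_le _))
    have hle : C' * (B + C * (B + B')) ≤ C' * (1 + C) * (B + B') := by
      calc _ ≤ C' * ((B + B') + C * (B + B')) := by gcongr; exact le_self_add
        _ = _ := by ring
    exact ⟨t1.mono hle, t2.mono hle⟩

theorem sobolevBound_of_flat (k : ℕ) (A : ℝ≥0) : ∃ C : ℝ≥0, ∀ {L : ℝ} [Fact (0 < L)]
    {γ : ℝ → ℝ} {f : ℝ × ℝ → ℝ} {u : FlatL2 L} {B : ℝ≥0}, CoeffBound L k A γ →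
    u =ᵐ[cellMeasure L 0] (fun z => f (shear γ z)) → SobolevBound L 0 k u B →
    SobolevBound L γ k f (C * B) := by
  obtain ⟨C, -, hC⟩ := SobolevBound.comp_shear k A
  refine ⟨C, fun {L hL γ f u B} hγ hu h => ?_⟩
  have hc := hγ.smooth.continuous
  have h1 := hC (γ := γ) (κ := -γ) hL.out hc hγ.neg (by rwa [add_neg_cancel])
  refine h1.congr ?_
  have hm : MeasurePreserving (shear (-γ)) (cellMeasure L γ) (cellMeasure L 0) := by
    have := measurePreserving_shear (L := L) (γ := γ) (κ := -γ) hc hc.neg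
    rwa [add_neg_cancel] at this
  have h2 := hm.quasiMeasurePreserving.ae hu
  filter_upwards [h2] with z hz
  rw [hz, shear_shear_neg]

/-- Pass to flat coordinates, apply the flat estimate, and return through v₁ = V₁, v₂ = V₂ + γ' V₁.
-/
theorem sobolevBound_of_curl (k : ℕ) (A : ℝ≥0) : ∃ C : ℝ≥0, ∀ {L : ℝ} [Fact (0 < L)]
    {γ : ℝ → ℝ} {v : ℝ × ℝ → ℝ × ℝ} {w : ℝ × ℝ → ℝ} {V₁ V₂ a₁ a₂ b₁ b₂ : FlatL2 L} {B B' : ℝ≥0},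
    GoodProfile L k A γ → FlatField γ v w V₁ V₂ a₁ a₂ b₁ b₂ → SobolevBound L γ k w B →
    SobolevBound L γ 0 (fun z => (v z).1) B' → SobolevBound L γ 0 (fun z => (v z).2) B' →
    SobolevBound L γ (k + 1) (fun z => (v z).1) (C * (B + B')) ∧
    SobolevBound L γ (k + 1) (fun z => (v z).2) (C * (B + B')) := by
  obtain ⟨C, hC⟩ := FlatField.sobolevBound k A
  obtain ⟨C₀, -, hC₀⟩ := SobolevBound.comp_shear 0 A
  obtain ⟨C₁, hC₁⟩ := sobolevBound_of_flat (k + 1) A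
  set D : ℝ≥0 := C * (1 + C₀ + 2 ^ 0 * A * C₀) with hD
  refine ⟨max (C₁ * D) (C₁ * (D + 2 ^ (k + 1) * A * D)),
    fun {L hL γ v w V₁ V₂ a₁ a₂ b₁ b₂ B B'} hg hf hw h1 h2 => ?_⟩
  have hγ := hg.profile
  have hc := hγ.smooth.continuous
  have e0 : ∀ {f : ℝ × ℝ → ℝ}, SobolevBound L γ 0 f B' →
      SobolevBound L 0 0 (fun z => f (shear γ z)) (C₀ * B') := fun {f} h =>
    hC₀ (γ := 0) (κ := γ) hL.out continuous_const (hγ.of_le (Nat.zero_le _)) (by rwa [zero_add])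
  have hd1 : CoeffBound L (k + 2) A (deriv γ) := by
    have h3 : CoeffBound L (k + 2 + 1) A γ := hγ
    exact h3.deriv
  have u1 : SobolevBound L 0 0 V₁ (C₀ * B' + 2 ^ 0 * A * (C₀ * B')) :=
    ((e0 h1).congr hf.eq_fst.symm).mono le_self_add
  have u2 : SobolevBound L 0 0 V₂ (C₀ * B' + 2 ^ 0 * A * (C₀ * B')) :=
    ((e0 h2).sub continuous_const ((e0 h1).coeff_mul continuous_const
      (hd1.of_le (Nat.zero_le _)))).congr hf.eq_snd.symm
  obtain ⟨s1, s2⟩ := hC (hg) hf hw u1 u2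
  have hle : C * (B + (C₀ * B' + 2 ^ 0 * A * (C₀ * B'))) ≤ D * (B + B') := by
    calc _ ≤ C * ((B + B') + (C₀ * (B + B') + 2 ^ 0 * A * (C₀ * (B + B')))) := by
          gcongr
          · exact le_self_add
          · exact le_add_self
          · exact le_add_self
      _ = _ := by rw [hD]; ring
  have t1 := hC₁ (f := fun z => (v z).1) (hγ.of_le (by omega)) hf.eq_fst (s1.mono hle)
  have s3 : SobolevBound L 0 (k + 1) (V₂ + mulCoeff (deriv γ) V₁ : FlatL2 L)
      (D * (B + B') + 2 ^ (k + 1) * A * (D * (B + B'))) :=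
    (s2.mono hle).lp_add ((hd1.of_le (Nat.le_succ _)).sobolevBound_mulCoeff (s1.mono hle))
  have e3 : (V₂ + mulCoeff (deriv γ) V₁ : FlatL2 L) =ᵐ[cellMeasure L 0]
      fun z => (v (shear γ z)).2 := by
    filter_upwards [Lp.coeFn_add V₂ (mulCoeff (deriv γ) V₁), hd1.coeFn_mulCoeff V₁, hf.eq_fst,
      hf.eq_snd] with z h1 h2 h3 h4
    rw [h1, Pi.add_apply, h2, h3, h4]; ring
  have t2 := hC₁ (f := fun z => (v z).2) (hγ.of_le (by omega)) e3 s3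
  refine ⟨t1.mono ?_, t2.mono ?_⟩
  · rw [← mul_assoc]; gcongr; exact le_max_left _ _
  · calc _ = C₁ * (D + 2 ^ (k + 1) * A * D) * (B + B') := by ring
      _ ≤ _ := by gcongr; exact le_max_right _ _

end

section

open scoped RealInnerProductSpace

variable {L : ℝ} {γ : ℝ → ℝ}

/-! ### Existence of good profiles -/

theorem contDiff_iterate_pd2 {G : ℝ × ℝ → ℝ} (hG : ContDiff ℝ ∞ G) (j : ℕ) :
    ContDiff ℝ ∞ (pd2^[j] G) := by
  induction j with
  | zero => exact hG
  | succ j ih => rw [Function.iterate_succ_apply']; exact contDiff_pd2 ih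

theorem iteratedDeriv_slice {G : ℝ × ℝ → ℝ} (hG : ContDiff ℝ ∞ G) (j : ℕ) (s x : ℝ) :
    iteratedDeriv j (fun y => G (s, y)) x = pd2^[j] G (s, x) := by
  induction j generalizing x with
  | zero => simp
  | succ j ih =>
    rw [iteratedDeriv_succ, funext ih, Function.iterate_succ_apply']
    exact (hasDerivAt_pd2 (contDiff_iterate_pd2 hG j) s x).deriv

theorem iterate_pd2_periodic {G : ℝ × ℝ → ℝ} {T : ℝ} (hG : ContDiff ℝ ∞ G)
    (hp : ∀ s x, G (s, x + T) = G (s, x)) (j : ℕ) (s x : ℝ) :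
    pd2^[j] G (s, x + T) = pd2^[j] G (s, x) := by
  rw [← iteratedDeriv_slice hG, ← iteratedDeriv_slice hG]
  have := iteratedDeriv_comp_add_const j (fun y => G (s, y)) T
  rw [funext (hp s)] at this
  exact (congrFun this x).symm

/-- The amplitude s is treated as a variable in the compact interval [0, 1], which gives bounds
uniform in s. A function of period 1 has every integer period N; this is where 1/ε ∈ ℕ matters. -/
theorem exists_coeffBound_slice {G : ℝ × ℝ → ℝ} (hG : ContDiff ℝ ∞ G)
    (hp : ∀ s x, G (s, x + 1) = G (s, x)) (k : ℕ) :
    ∃ A : ℝ≥0, ∀ s ∈ Set.Icc (0 : ℝ) 1, ∀ N : ℕ, CoeffBound N k A (fun x => G (s, x)) := by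
  have h1 : ∀ j, ∃ A : ℝ≥0, ∀ s ∈ Set.Icc (0 : ℝ) 1, ∀ x, |pd2^[j] G (s, x)| ≤ A := by
    intro j
    obtain ⟨A, hA⟩ := (isCompact_Icc.prod isCompact_Icc).exists_bound_of_continuousOn
      (s := Set.Icc (0 : ℝ) 1 ×ˢ Set.Icc (0 : ℝ) 1)
      (contDiff_iterate_pd2 hG j).continuous.continuousOn
    refine ⟨A.toNNReal, fun s hs x => ?_⟩
    have hper : Function.Periodic (fun y => pd2^[j] G (s, y)) 1 := iterate_pd2_periodic hG hp j s
    obtain ⟨y, hy, e⟩ := hper.exists_mem_Ico₀ one_pos x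
    rw [e]
    exact (hA (s, y) ⟨hs, hy.1, hy.2.le⟩).trans (Real.le_coe_toNNReal A)
  choose A hA using h1
  refine ⟨∑ j ∈ Finset.range (k + 1), A j, fun s hs N => ⟨hG.comp (by fun_prop), fun x => ?_,
    fun j hj x => ?_⟩⟩
  · have hper : Function.Periodic (fun y => G (s, y)) 1 := hp s
    have := hper.nat_mul N x
    rwa [mul_one] at this
  · rw [iteratedDeriv_slice hG]
    refine (hA j s hs x).trans ?_
    exact_mod_cast Finset.single_le_sum (f := A) (fun _ _ => zero_le)
      (Finset.mem_range.2 (Nat.lt_succ_of_le hj))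

theorem CoeffBound.const_mul {k : ℕ} {A B : ℝ≥0} {c : ℝ → ℝ} (h : CoeffBound L k A c) {s : ℝ}
    (hs : |s| * A ≤ B) : CoeffBound L k B (fun x => s * c x) where
  smooth := contDiff_const.mul h.smooth
  periodic x := by rw [h.periodic]
  bound j hj x := by
    rw [iteratedDeriv_const_mul_field, abs_mul]
    exact (mul_le_mul_of_nonneg_left (h.bound j hj x) (abs_nonneg s)).trans hs

theorem CoeffBound.mono {k : ℕ} {A B : ℝ≥0} {c : ℝ → ℝ} (h : CoeffBound L k A c) (hAB : A ≤ B) :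
    CoeffBound L k B c :=
  ⟨h.smooth, h.periodic, fun j hj x => (h.bound j hj x).trans (by exact_mod_cast hAB)⟩

theorem exists_goodProfile {η : ℝ → ℝ} (hη : ContDiff ℝ ∞ η) (hp : ∀ x, η (x + 1) = η x) (k : ℕ) :
    ∃ (A : ℝ≥0) (s₀ : ℝ), 0 < s₀ ∧ s₀ ≤ 1 ∧ ∀ s, 0 < s → s ≤ s₀ → ∀ N : ℕ,
      GoodProfile N k A (fun x => s * η x) ∧ CoeffBound N 3 (s.toNNReal * A) (fun x => s * η x) := by
  have hd := contDiff_deriv hη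
  have hdp := deriv_periodic hp
  have sG : ContDiff ℝ ∞ (fun z : ℝ × ℝ => z.1 * deriv η z.2) :=
    contDiff_fst.mul (hd.comp contDiff_snd)
  obtain ⟨A₁, h1⟩ := exists_coeffBound_slice (G := fun z => z.1 * η z.2)
    (contDiff_fst.mul (hη.comp contDiff_snd)) (fun s x => by simp [hp]) (k + 3)
  obtain ⟨A₂, h2⟩ := exists_coeffBound_slice (G := fun z => -2 * (z.1 * deriv η z.2))
    (contDiff_const.mul sG) (fun s x => by simp [hdp]) (k + 1)
  obtain ⟨A₃, h3⟩ := exists_coeffBound_slice (G := fun z => (z.1 * deriv η z.2) ^ 2)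
    (sG.pow 2) (fun s x => by simp [hdp]) (k + 1)
  obtain ⟨A₄, h4⟩ := exists_coeffBound_slice (G := fun z => (1 + (z.1 * deriv η z.2) ^ 2)⁻¹)
    ((contDiff_const.add (sG.pow 2)).inv fun z => by positivity) (fun s x => by simp [hdp]) k
  set A := A₁ + A₂ + A₃ + A₄ with hA
  have l1 : A₁ ≤ A := by rw [hA, add_assoc, add_assoc]; exact le_self_add
  have l2 : A₂ ≤ A := by rw [hA]; exact le_add_right (le_add_right le_add_self)
  have l3 : A₃ ≤ A := by rw [hA]; exact le_add_right le_add_self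
  have l4 : A₄ ≤ A := by rw [hA]; exact le_add_self
  have hA0 : (0 : ℝ) < 4 * A + 1 := by positivity
  -- This threshold ensures s A ≤ 1/4, the smallness needed for absorption; the coefficients -2γ'
  -- and γ'² scale like s and s².
  refine ⟨A, (4 * (A : ℝ) + 1)⁻¹, by positivity, inv_le_one_of_one_le₀ (by
    have := A.coe_nonneg; linarith), fun s hs0 hs N => ?_⟩
  have hs1 : s ≤ 1 := hs.trans (inv_le_one_of_one_le₀ (by have := A.coe_nonneg; linarith))
  have hsm : |s| * A ≤ (1 / 4 : ℝ≥0) := by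
    rw [abs_of_pos hs0]
    have : s * (4 * A + 1) ≤ 1 := by
      calc _ ≤ (4 * (A : ℝ) + 1)⁻¹ * (4 * A + 1) := by gcongr
        _ = 1 := inv_mul_cancel₀ hA0.ne'
    push_cast
    nlinarith
  have hsq : |s ^ 2| * A ≤ (1 / 4 : ℝ≥0) := by
    refine le_trans (mul_le_mul_of_nonneg_right ?_ A.coe_nonneg) hsm
    rw [abs_pow, abs_of_pos hs0]
    nlinarith
  have ed : deriv (fun x => s * η x) = fun x => s * deriv η x := by
    ext x; exact deriv_const_mul_field s
  have mem : s ∈ Set.Icc (0 : ℝ) 1 := ⟨hs0.le, hs1⟩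
  have one : (1 : ℝ) ∈ Set.Icc (0 : ℝ) 1 := ⟨zero_le_one, le_rfl⟩
  have one1 := ((h1 1 one N).mono l1).const_mul (s := s) (B := s.toNNReal * A) (by
    rw [abs_of_pos hs0]; simp [hs0.le])
  have one2 := (((h2 1 one N).mono l2).of_le (show 1 ≤ k + 1 by omega)).const_mul hsm
  have one3 := (((h3 1 one N).mono l3).of_le (show 1 ≤ k + 1 by omega)).const_mul hsq
  refine ⟨⟨(h1 s mem N).mono l1, ?_, ?_, ?_, ?_, ?_⟩, ?_⟩
  · rw [ed]; convert one2 using 2; ring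
  · rw [ed]; convert one3 using 2; ring
  · rw [ed]; exact (h2 s mem N).mono l2
  · rw [ed]; exact (h3 s mem N).mono l3
  · rw [ed]; exact (h4 s mem N).mono l4
  · convert one1.of_le (show 3 ≤ k + 3 by omega) using 2; ring

end

/-! ### The H^k estimates in terms of extended norms -/

section

open scoped RealInnerProductSpace

variable {L : ℝ} {γ : ℝ → ℝ}

theorem hNormVec_succ_le (k : ℕ) (A : ℝ≥0) : ∃ C : ℝ≥0, ∀ {L : ℝ} [Fact (0 < L)]
    {γ : ℝ → ℝ} {v : ℝ × ℝ → ℝ × ℝ} {w : ℝ × ℝ → ℝ} {V₁ V₂ a₁ a₂ b₁ b₂ : FlatL2 L},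
    GoodProfile L k A γ → FlatField γ v w V₁ V₂ a₁ a₂ b₁ b₂ →
    hNormVec L γ ((k + 1 : ℕ) : ℤ) v ≤ C * (hNorm L γ (k : ℤ) w + hNormVec L γ 0 v) := by
  obtain ⟨C₁, h1⟩ := sobolevBound_of_curl k A
  obtain ⟨C₂, h2⟩ := sobolevNorm_le_of_sobolevBound (k + 1)
  refine ⟨1 + 2 * (C₂ * C₁), fun {L hL γ v w V₁ V₂ a₁ a₂ b₁ b₂} hg hf => ?_⟩
  have hc := hg.profile.smooth.continuous
  have hp := hg.profile.periodic
  -- If the right-hand side is infinite there is nothing to prove, the constant being at least 1;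
  -- otherwise w and v have finite norms.
  by_cases hfin : hNorm L γ (k : ℤ) w + hNormVec L γ 0 v = ⊤
  · rw [hfin, ENNReal.mul_top (by simp)]; exact le_top
  obtain ⟨hw, hv⟩ := ENNReal.add_ne_top.1 hfin
  lift hNorm L γ (k : ℤ) w to ℝ≥0 using hw with B hB
  lift hNormVec L γ 0 v to ℝ≥0 using hv with B' hB'
  have sw : SobolevBound L γ k w B := sobolevBound_of_sobolevNorm_le hL.out hc hp hB.ge
  have s1 : SobolevBound L γ 0 (fun z => (v z).1) B' :=
    sobolevBound_of_sobolevNorm_le hL.out hc hp ((le_hNormVec_fst 0 v).trans hB'.ge)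
  have s2 : SobolevBound L γ 0 (fun z => (v z).2) B' :=
    sobolevBound_of_sobolevNorm_le hL.out hc hp ((le_hNormVec_snd 0 v).trans hB'.ge)
  obtain ⟨t1, t2⟩ := h1 hg hf sw s1 s2
  refine (hNormVec_le_add _ v).trans ((add_le_add (h2 t1) (h2 t2)).trans ?_)
  rw [← two_mul]
  norm_cast
  calc 2 * (C₂ * (C₁ * (B + B'))) = 2 * (C₂ * C₁) * (B + B') := by ring
    _ ≤ _ := by gcongr; exact le_add_self

end

section

open scoped RealInnerProductSpace

variable {L : ℝ} {γ : ℝ → ℝ}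

/-! ### Reflection and periodic extension to the plane -/

/-- Lebesgue measure on the strip `a ≤ y₁ < a + L`. -/
def stripMeasure (L a : ℝ) : Measure (ℝ × ℝ) :=
  (volume.restrict (Set.Ico a (a + L))).prod volume

theorem stripMeasure_eq_restrict (a : ℝ) :
    stripMeasure L a = volume.restrict (Set.Ico a (a + L) ×ˢ Set.univ) := by
  rw [stripMeasure, Measure.volume_eq_prod, ← Measure.prod_restrict, Measure.restrict_univ]

/-- The upper half of a strip. -/
def upperMeasure (L a : ℝ) : Measure (ℝ × ℝ) :=
  (volume.restrict (Set.Ico a (a + L))).prod (volume.restrict (Set.Ioi 0))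

/-- The lower half of a strip. -/
def lowerMeasure (L a : ℝ) : Measure (ℝ × ℝ) :=
  (volume.restrict (Set.Ico a (a + L))).prod (volume.restrict (Set.Iio 0))

theorem stripMeasure_eq_add (a : ℝ) :
    stripMeasure L a = upperMeasure L a + lowerMeasure L a := by
  have h : (volume : Measure ℝ) = volume.restrict (Set.Ioi 0) + volume.restrict (Set.Iio 0) := by
    rw [Measure.restrict_congr_set (Iio_ae_eq_Iic (a := (0 : ℝ))), ← Set.compl_Ioi,
      Measure.restrict_add_restrict_compl measurableSet_Ioi]
  rw [stripMeasure, upperMeasure, lowerMeasure, ← Measure.prod_add, ← h]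

theorem measurePreserving_wrap (hL : 0 < L) (a : ℝ) :
    MeasurePreserving (wrap L) (volume.restrict (Set.Ico a (a + L)))
      (volume.restrict (Set.Ico 0 L)) := by
  have h1 : MeasurePreserving (fun x : ℝ => x - a) (volume.restrict (Set.Ico a (a + L)))
      (volume.restrict (Set.Ico 0 L)) := by
    have := (measurePreserving_sub_right (volume : Measure ℝ) a).restrict_preimage
      (measurableSet_Ico (a := (0 : ℝ)) (b := L))
    rwa [Set.preimage_sub_const_Ico, zero_add, add_comm L a] at this
  have := (measurePreserving_wrap_add hL a).comp h1
  simpa [Function.comp_def] using this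

theorem measurePreserving_upper (hL : 0 < L) (a : ℝ) :
    MeasurePreserving (fun y : ℝ × ℝ => (wrap L y.1, y.2)) (upperMeasure L a)
      (cellMeasure L 0) := by
  rw [cellMeasure_zero]
  exact (measurePreserving_wrap hL a).prod (MeasurePreserving.id _)

theorem measurePreserving_lower (hL : 0 < L) (a : ℝ) :
    MeasurePreserving (fun y : ℝ × ℝ => (wrap L y.1, -y.2)) (lowerMeasure L a)
      (cellMeasure L 0) := by
  rw [cellMeasure_zero]
  have h1 : MeasurePreserving (fun x : ℝ => -x) (volume.restrict (Set.Iio 0))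
      (volume.restrict (Set.Ioi 0)) := by
    have := (Measure.measurePreserving_neg (volume : Measure ℝ)).restrict_preimage
      (measurableSet_Ioi (a := (0 : ℝ)))
    simpa using this
  exact (measurePreserving_wrap hL a).prod h1

/-- The extension of a function on the periodic half plane to the plane by periodicity and by
reflection, with the sign `e`. -/
def ext (L e : ℝ) (g : ℝ × ℝ → ℝ) (y : ℝ × ℝ) : ℝ :=
  if 0 < y.2 then g (wrap L y.1, y.2) else e * g (wrap L y.1, -y.2)

theorem measurable_ext {g : ℝ × ℝ → ℝ} (hg : Measurable g) (e : ℝ) : Measurable (ext L e g) := by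
  refine Measurable.ite (measurableSet_lt measurable_const measurable_snd) ?_ ?_
  · exact hg.comp ((measurable_wrap.comp measurable_fst).prodMk measurable_snd)
  · exact (hg.comp ((measurable_wrap.comp measurable_fst).prodMk measurable_snd.neg)).const_mul e

theorem ext_periodic (hL : 0 < L) (e : ℝ) (g : ℝ × ℝ → ℝ) (y : ℝ × ℝ) (k : ℤ) :
    ext L e g (y.1 + k * L, y.2) = ext L e g y := by
  simp only [ext, wrap_add_period hL]

theorem ext_ae_upper (a e : ℝ) (g : ℝ × ℝ → ℝ) :
    ext L e g =ᵐ[upperMeasure L a] fun y => g (wrap L y.1, y.2) := by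
  rw [upperMeasure, Measure.prod_restrict]
  filter_upwards [ae_restrict_mem (measurableSet_Ico.prod measurableSet_Ioi)] with y hy
  exact if_pos hy.2

theorem ext_ae_lower (a e : ℝ) (g : ℝ × ℝ → ℝ) :
    ext L e g =ᵐ[lowerMeasure L a] fun y => e * g (wrap L y.1, -y.2) := by
  rw [lowerMeasure, Measure.prod_restrict]
  filter_upwards [ae_restrict_mem (measurableSet_Ico.prod measurableSet_Iio)] with y hy
  exact if_neg (not_lt.2 (le_of_lt hy.2))

/-- A strip of width L consists of one copy of the cell above the axis and one reflected copy below.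
-/
theorem lintegral_ext_sq (hL : 0 < L) {e : ℝ} (he : |e| = 1) {g : ℝ × ℝ → ℝ} (hg : Measurable g)
    (a : ℝ) : ∫⁻ y, ‖ext L e g y‖ₑ ^ 2 ∂stripMeasure L a
      = 2 * ∫⁻ z, ‖g z‖ₑ ^ 2 ∂cellMeasure L 0 := by
  have he' : ‖e‖ₑ = 1 := by rw [Real.enorm_eq_ofReal_abs, he, ENNReal.ofReal_one]
  rw [stripMeasure_eq_add, lintegral_add_measure, two_mul]
  congr 1
  · rw [← (measurePreserving_upper hL a).lintegral_comp (by fun_prop)]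
    refine lintegral_congr_ae ?_
    filter_upwards [ext_ae_upper a e g] with y hy
    rw [hy]
  · rw [← (measurePreserving_lower hL a).lintegral_comp (by fun_prop)]
    refine lintegral_congr_ae ?_
    filter_upwards [ext_ae_lower a e g] with y hy
    rw [hy, enorm_mul, he', one_mul]

theorem ae_of_forall_stripMeasure (hL : 0 < L) {P : ℝ × ℝ → Prop}
    (h : ∀ a, ∀ᵐ y ∂stripMeasure L a, P y) : ∀ᵐ y, P y := by
  have h1 := (ae_restrict_iUnion_iff (μ := volume)
    (fun n : ℤ => Set.Ico (0 + n • L) (0 + (n + 1) • L) ×ˢ (Set.univ : Set ℝ)) P).2 fun n => by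
      have := h (0 + n • L)
      rw [stripMeasure_eq_restrict] at this
      rwa [add_smul, one_smul, ← add_assoc]
  rwa [← Set.iUnion_prod_const, iUnion_Ico_add_zsmul hL, Set.univ_prod_univ,
    Measure.restrict_univ] at h1

theorem ae_abs_ext_le (hL : 0 < L) {e M : ℝ} (he : |e| = 1) {g : ℝ × ℝ → ℝ}
    (hg : ∀ᵐ z ∂cellMeasure L 0, |g z| ≤ M) : ∀ᵐ y, |ext L e g y| ≤ M := by
  refine ae_of_forall_stripMeasure hL fun a => ?_
  rw [stripMeasure_eq_add, ae_add_measure_iff]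
  constructor
  · filter_upwards [ext_ae_upper a e g,
      (measurePreserving_upper hL a).quasiMeasurePreserving.ae hg] with y hy h
    rwa [hy]
  · filter_upwards [ext_ae_lower a e g,
      (measurePreserving_lower hL a).quasiMeasurePreserving.ae hg] with y hy h
    rwa [hy, abs_mul, he, one_mul]

theorem ext_congr_ae (hL : 0 < L) (e : ℝ) {f g : ℝ × ℝ → ℝ} (h : f =ᵐ[cellMeasure L 0] g) :
    ext L e f =ᵐ[volume] ext L e g := by
  refine ae_of_forall_stripMeasure hL fun a => ?_
  rw [stripMeasure_eq_add, ae_add_measure_iff]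
  constructor
  · filter_upwards [ext_ae_upper a e f, ext_ae_upper a e g,
      (measurePreserving_upper hL a).quasiMeasurePreserving.ae h] with y h1 h2 h3
    rw [h1, h2, h3]
  · filter_upwards [ext_ae_lower a e f, ext_ae_lower a e g,
      (measurePreserving_lower hL a).quasiMeasurePreserving.ae h] with y h1 h2 h3
    rw [h1, h2, h3]

theorem memLp_ext_strip (hL : 0 < L) {e : ℝ} (he : |e| = 1) {g : ℝ × ℝ → ℝ} (hg : Measurable g)
    (h : MemLp g 2 (cellMeasure L 0)) (a : ℝ) : MemLp (ext L e g) 2 (stripMeasure L a) := by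
  refine ⟨(measurable_ext hg e).aestronglyMeasurable, ?_⟩
  have h2 := h.2
  rw [eLpNorm_lt_top_iff_lintegral_rpow_enorm_lt_top (by norm_num) (by norm_num)] at h2 ⊢
  simp only [ENNReal.toReal_ofNat, ENNReal.rpow_ofNat] at h2 ⊢
  rw [lintegral_ext_sq hL he hg]
  exact ENNReal.mul_lt_top (by norm_num) h2

theorem locallyIntegrable_ext (hL : 0 < L) {e : ℝ} (he : |e| = 1) {g : ℝ × ℝ → ℝ}
    (hg : Measurable g) (h : MemLp g 2 (cellMeasure L 0)) :
    LocallyIntegrable (ext L e g) volume := by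
  intro x
  set a := x.1 - L / 2 with ha
  refine ⟨Set.Ioo a (a + L) ×ˢ Set.Ioo (x.2 - 1) (x.2 + 1),
    prod_mem_nhds (Ioo_mem_nhds (by rw [ha]; linarith) (by rw [ha]; linarith))
      (Ioo_mem_nhds (by linarith) (by linarith)), ?_⟩
  have h1 := memLp_ext_strip hL he hg h a
  rw [stripMeasure_eq_restrict] at h1
  have h2 : MemLp (ext L e g) 2
      (volume.restrict (Set.Ioo a (a + L) ×ˢ Set.Ioo (x.2 - 1) (x.2 + 1))) :=
    h1.mono_measure (Measure.restrict_mono (Set.prod_mono Set.Ioo_subset_Ico_self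
      (Set.subset_univ _)) le_rfl)
  have : IsFiniteMeasure ((volume : Measure (ℝ × ℝ)).restrict
      (Set.Ioo a (a + L) ×ˢ Set.Ioo (x.2 - 1) (x.2 + 1))) := by
    refine ⟨?_⟩
    rw [Measure.restrict_apply_univ, Measure.volume_eq_prod, Measure.prod_prod]
    simp [ENNReal.mul_lt_top]
  exact h2.integrable (by norm_num)

/-- Unfolding: cut the plane into strips of width L, translate each to the first one, and sum; only
finitely many strips meet the support of φ. -/
theorem integral_eq_integral_periodize (hL : 0 < L) {R φ : ℝ × ℝ → ℝ}
    (hR : ∀ (y : ℝ × ℝ) (k : ℤ), R (y.1 + k * L, y.2) = R y) (hRi : LocallyIntegrable R volume)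
    (hφ : HasCompactSupport φ) (hc : Continuous φ) :
    ∫ y, R y * φ y = ∫ y, R y * periodize L φ y ∂stripMeasure L 0 := by
  set S : ℤ → Set (ℝ × ℝ) := fun n => Set.Ico (0 + n • L) (0 + (n + 1) • L) ×ˢ Set.univ with hS
  have hint : Integrable (fun y => R y * φ y) :=
    hRi.integrable_smul_right_of_hasCompactSupport hc hφ
  have hU : ⋃ n, S n = Set.univ := by
    rw [← Set.iUnion_prod_const, iUnion_Ico_add_zsmul hL, Set.univ_prod_univ]
  have h1 : HasSum (fun n => ∫ y in S n, R y * φ y) (∫ y, R y * φ y) := by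
    have := hasSum_integral_iUnion (μ := volume) (f := fun y => R y * φ y) (s := S)
      (fun n => measurableSet_Ico.prod MeasurableSet.univ)
      (fun i j hij => Set.disjoint_prod.2 (Or.inl (Set.pairwise_disjoint_Ico_add_zsmul 0 L hij)))
      hint.integrableOn
    rwa [hU, setIntegral_univ] at this
  have e1 : ∀ n : ℤ, MeasurePreserving (fun y : ℝ × ℝ => (y.1 + n * L, y.2)) (stripMeasure L 0)
      (volume.restrict (S n)) := by
    intro n
    have := ((measurePreserving_add_right (volume : Measure ℝ) (n * L)).restrict_preimage
      (measurableSet_Ico (a := 0 + n • L) (b := 0 + (n + 1) • L))).prod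
      (MeasurePreserving.id (volume : Measure ℝ))
    rw [Set.preimage_add_const_Ico] at this
    have e2 : volume.restrict (S n) = ((volume : Measure ℝ).restrict
        (Set.Ico (0 + n • L) (0 + (n + 1) • L))).prod volume := by
      rw [hS, Measure.volume_eq_prod, ← Measure.prod_restrict, Measure.restrict_univ]
    rw [e2]
    have e4 : Set.Ico (0 + n • L - n * L) (0 + (n + 1) • L - n * L) = Set.Ico 0 (0 + L) := by
      congr 1 <;> simp only [zsmul_eq_mul] <;> push_cast <;> ring
    rw [e4] at this
    exact this
  have e1' : ∀ n : ℤ, MeasurableEmbedding (fun y : ℝ × ℝ => (y.1 + n * L, y.2)) := fun n =>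
    ((MeasurableEquiv.addRight ((n : ℝ) * L)).prodCongr (MeasurableEquiv.refl ℝ)).measurableEmbedding
  have e3 : ∀ n : ℤ, ∫ y in S n, R y * φ y
      = ∫ y, R y * φ (y.1 + n * L, y.2) ∂stripMeasure L 0 := by
    intro n
    rw [← (e1 n).integral_comp (e1' n)]
    simp only [hR]
  have i3 : ∀ n : ℤ, Integrable (fun y => R y * φ (y.1 + n * L, y.2)) (stripMeasure L 0) := by
    intro n
    have := ((e1 n).integrable_comp_emb (e1' n)).2 (hint.integrableOn (s := S n))
    simpa only [Function.comp_def, hR] using this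
  obtain ⟨N, hN'⟩ := exists_forall_notMem_eq_zero hL hφ.isCompact L
  have hN := hN' φ (subset_tsupport φ)
  have mem : ∀ᵐ y ∂stripMeasure L 0, |y.1| ≤ L := by
    rw [stripMeasure_eq_restrict]
    filter_upwards [ae_restrict_mem (measurableSet_Ico.prod MeasurableSet.univ)] with y hy
    have h2 := hy.1.2
    rw [abs_of_nonneg hy.1.1]
    linarith
  have h2 := h1.unique (hasSum_sum_of_ne_finset_zero (s := Finset.Icc (-N : ℤ) N) fun k hk => by
    rw [e3 k]
    refine integral_eq_zero_of_ae ?_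
    filter_upwards [mem] with y hy
    rw [hN y hy k hk, mul_zero, Pi.zero_apply])
  rw [h2]
  simp only [e3]
  rw [← integral_finsetSum _ fun k _ => i3 k]
  refine integral_congr_ae ?_
  filter_upwards [mem] with y hy
  rw [← Finset.mul_sum, periodize, tsum_eq_sum (hN y hy)]

/-- The reflection in the horizontal axis. -/
def reflect (φ : ℝ × ℝ → ℝ) (z : ℝ × ℝ) : ℝ := φ (z.1, -z.2)

theorem contDiff_reflect {φ : ℝ × ℝ → ℝ} (h : ContDiff ℝ ∞ φ) : ContDiff ℝ ∞ (reflect φ) := by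
  have := contDiff_affine h 0 1 0 (-1)
  simp only [zero_add, one_mul, neg_one_mul] at this
  exact this

theorem pd1_reflect {φ : ℝ × ℝ → ℝ} (h : ContDiff ℝ ∞ φ) : pd1 (reflect φ) = reflect (pd1 φ) := by
  have := pd1_affine h 0 1 0 (-1)
  simp only [zero_add, one_mul, neg_one_mul] at this
  exact this

theorem pd2_reflect {φ : ℝ × ℝ → ℝ} (h : ContDiff ℝ ∞ φ) :
    pd2 (reflect φ) = fun z => - reflect (pd2 φ) z := by
  have := pd2_affine h 0 1 0 (-1)
  simp only [zero_add, one_mul, neg_one_mul] at this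
  exact this

theorem hasCompactSupport_reflect {φ : ℝ × ℝ → ℝ} (h : HasCompactSupport φ) :
    HasCompactSupport (reflect φ) :=
  h.comp_homeomorph ((Homeomorph.refl ℝ).prodCongr (Homeomorph.neg ℝ))

/-- The smooth function on the periodic half plane with which a test function on the plane is
replaced in integrals against `ext L e g`. -/
def foldTest (L e : ℝ) (φ : ℝ × ℝ → ℝ) (z : ℝ × ℝ) : ℝ :=
  periodize L φ z + e * periodize L (reflect φ) z

theorem foldTest_isSmoothUpToBdry (hL : 0 < L) (e : ℝ) {φ : ℝ × ℝ → ℝ} (hφ : HasCompactSupport φ)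
    (hc : ContDiff ℝ ∞ φ) : IsSmoothUpToBdry L (foldTest L e φ) :=
  (periodize_isSmoothUpToBdry hL hφ hc).add ((periodize_isSmoothUpToBdry hL
    (hasCompactSupport_reflect hφ) (contDiff_reflect hc)).const_mul e)

theorem pd1_foldTest (hL : 0 < L) (e : ℝ) {φ : ℝ × ℝ → ℝ} (hφ : HasCompactSupport φ)
    (hc : ContDiff ℝ ∞ φ) : pd1 (foldTest L e φ) = foldTest L e (pd1 φ) := by
  have h1 := contDiff_periodize hL hφ hc
  have h2 := contDiff_periodize hL (hasCompactSupport_reflect hφ) (contDiff_reflect hc)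
  have := pd1_add h1 (contDiff_const.mul h2 : ContDiff ℝ ∞ fun z => e * periodize L (reflect φ) z)
  rw [pd1_const_mul h2, pd1_periodize hL hφ hc, pd1_periodize hL (hasCompactSupport_reflect hφ)
    (contDiff_reflect hc), pd1_reflect hc] at this
  exact this

theorem pd2_foldTest (hL : 0 < L) (e : ℝ) {φ : ℝ × ℝ → ℝ} (hφ : HasCompactSupport φ)
    (hc : ContDiff ℝ ∞ φ) : pd2 (foldTest L e φ) = foldTest L (-e) (pd2 φ) := by
  have h1 := contDiff_periodize hL hφ hc
  have h2 := contDiff_periodize hL (hasCompactSupport_reflect hφ) (contDiff_reflect hc)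
  have := pd2_add h1 (contDiff_const.mul h2 : ContDiff ℝ ∞ fun z => e * periodize L (reflect φ) z)
  rw [pd2_const_mul h2, pd2_periodize hL hφ hc, pd2_periodize hL (hasCompactSupport_reflect hφ)
    (contDiff_reflect hc), pd2_reflect hc] at this
  refine this.trans ?_
  funext z
  simp only [foldTest, periodize, tsum_neg]
  ring

theorem foldTest_neg_one_bdry (φ : ℝ × ℝ → ℝ) (x : ℝ) : foldTest L (-1) φ (x, 0) = 0 := by
  simp [foldTest, periodize, reflect]

/-- Periodicity of the extension is moved onto the test function by periodising, and its parity by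
folding the lower half onto the upper one. -/
theorem integral_ext_mul (hL : 0 < L) {e : ℝ} (he : |e| = 1) {g φ : ℝ × ℝ → ℝ}
    (hg : Measurable g) (h : MemLp g 2 (cellMeasure L 0)) (hφ : HasCompactSupport φ)
    (hc : ContDiff ℝ ∞ φ) :
    ∫ y, ext L e g y * φ y = ∫ z, g z * foldTest L e φ z ∂cellMeasure L 0 := by
  have hP := periodize_isSmoothUpToBdry hL hφ hc
  have hP' := periodize_isSmoothUpToBdry hL (hasCompactSupport_reflect hφ) (contDiff_reflect hc)
  have i1 : Integrable (fun z => g z * periodize L φ z) (cellMeasure L 0) :=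
    MemLp.integrable_mul_smooth hL continuous_const h hP
  have i2 : Integrable (fun z => g z * periodize L (reflect φ) z) (cellMeasure L 0) :=
    MemLp.integrable_mul_smooth hL continuous_const h hP'
  have m1 := measurePreserving_upper hL 0
  have m2 := measurePreserving_lower hL 0
  have e1 : (fun y => ext L e g y * periodize L φ y) =ᵐ[upperMeasure L 0]
      (fun z => g z * periodize L φ z) ∘ fun y : ℝ × ℝ => (wrap L y.1, y.2) := by
    filter_upwards [ext_ae_upper 0 e g] with y hy
    have := apply_wrap hL (c := fun x => periodize L φ (x, y.2)) (fun x => hP.periodic (x, y.2)) y.1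
    simp only [Function.comp, hy]
    rw [this]
  have e2 : (fun y => ext L e g y * periodize L φ y) =ᵐ[lowerMeasure L 0]
      (fun z => e * (g z * periodize L (reflect φ) z)) ∘ fun y : ℝ × ℝ => (wrap L y.1, -y.2) := by
    filter_upwards [ext_ae_lower 0 e g] with y hy
    have := apply_wrap hL (c := fun x => periodize L φ (x, y.2)) (fun x => hP.periodic (x, y.2)) y.1
    have e3 : periodize L (reflect φ) (wrap L y.1, -y.2) = periodize L φ (wrap L y.1, y.2) := by
      simp [periodize, reflect]
    simp only [Function.comp, hy, e3]
    rw [this]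
    ring
  rw [integral_eq_integral_periodize hL (ext_periodic hL e g) (locallyIntegrable_ext hL he hg h) hφ
    hc.continuous, stripMeasure_eq_add, integral_add_measure
    ((m1.integrable_comp_of_integrable i1).congr e1.symm)
    ((m2.integrable_comp_of_integrable (i2.const_mul e)).congr e2.symm),
    integral_congr_ae e1, integral_congr_ae e2]
  have j1 : ∫ z, g z * periodize L φ z ∂cellMeasure L 0
      = ∫ y, ((fun z => g z * periodize L φ z) ∘ fun y : ℝ × ℝ => (wrap L y.1, y.2)) y
        ∂upperMeasure L 0 := by
    rw [← m1.map_eq]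
    exact integral_map m1.measurable.aemeasurable (m1.map_eq ▸ i1.aestronglyMeasurable)
  have j2 : ∫ z, e * (g z * periodize L (reflect φ) z) ∂cellMeasure L 0
      = ∫ y, ((fun z => e * (g z * periodize L (reflect φ) z)) ∘
        fun y : ℝ × ℝ => (wrap L y.1, -y.2)) y ∂lowerMeasure L 0 := by
    rw [← m2.map_eq]
    exact integral_map m2.measurable.aemeasurable
      (m2.map_eq ▸ (i2.const_mul e).aestronglyMeasurable)
  rw [← j1, ← j2, ← integral_add i1 (i2.const_mul e)]
  congr 1
  ext z
  simp only [foldTest]; ring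

/-! ### Weak derivatives on the plane -/

/-- Weak derivatives of locally integrable functions on the plane; `D` is one of the partial
derivatives. -/
structure PlaneWeakDeriv (D : (ℝ × ℝ → ℝ) → ℝ × ℝ → ℝ) (f g : ℝ × ℝ → ℝ) : Prop where
  left : LocallyIntegrable f volume
  right : LocallyIntegrable g volume
  integral_eq : ∀ φ : ℝ × ℝ → ℝ, HasCompactSupport φ → ContDiff ℝ ∞ φ →
    ∫ y, f y * D φ y = - ∫ y, g y * φ y

theorem hasCompactSupport_pd1 {φ : ℝ × ℝ → ℝ} (h : HasCompactSupport φ) :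
    HasCompactSupport (pd1 φ) := h.of_isClosed_subset (isClosed_tsupport _) (tsupport_pd1_subset φ)

theorem hasCompactSupport_pd2 {φ : ℝ × ℝ → ℝ} (h : HasCompactSupport φ) :
    HasCompactSupport (pd2 φ) := h.of_isClosed_subset (isClosed_tsupport _) (tsupport_pd2_subset φ)

theorem measurable_lp (u : FlatL2 L) : Measurable u := (Lp.stronglyMeasurable u).measurable

/-- Either parity is admissible, since horizontal integration by parts produces no boundary term. -/
theorem planeWeakDeriv_pd1_ext [hL : Fact (0 < L)] {e : ℝ} (he : |e| = 1) {u u' : FlatL2 L}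
    (h : IsWeakDeriv L 0 (1, 0) u u') : PlaneWeakDeriv pd1 (ext L e u) (ext L e u') where
  left := locallyIntegrable_ext hL.out he (measurable_lp u) (Lp.memLp u)
  right := locallyIntegrable_ext hL.out he (measurable_lp u') (Lp.memLp u')
  integral_eq φ hφ hc := by
    have hF := foldTest_isSmoothUpToBdry hL.out e hφ hc
    rw [integral_ext_mul hL.out he (measurable_lp u) (Lp.memLp u) (hasCompactSupport_pd1 hφ)
      (contDiff_pd1 hc), integral_ext_mul hL.out he (measurable_lp u') (Lp.memLp u') hφ hc,
      ← pd1_foldTest hL.out e hφ hc, ← inner_toL2 u (hF.pd1.memLp_flat hL.out),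
      ← inner_toL2 u' (hF.memLp_flat hL.out)]
    exact inner_pd1_of_isWeakDeriv h hF

/-- For an even extension the derivative is paired with an odd fold, which vanishes on the boundary;
hence no condition on the trace of u is needed. -/
theorem planeWeakDeriv_pd2_ext_one [hL : Fact (0 < L)] {u u' : FlatL2 L}
    (h : ∀ φ, IsSmoothUpToBdry L φ → (∀ x, φ (x, 0) = 0) →
      ⟪u, toL2 L (pd2 φ)⟫ = - ⟪u', toL2 L φ⟫) :
    PlaneWeakDeriv pd2 (ext L 1 u) (ext L (-1) u') where
  left := locallyIntegrable_ext hL.out (by simp) (measurable_lp u) (Lp.memLp u)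
  right := locallyIntegrable_ext hL.out (by simp) (measurable_lp u') (Lp.memLp u')
  integral_eq φ hφ hc := by
    have hF := foldTest_isSmoothUpToBdry hL.out (-1) hφ hc
    have e1 := pd2_foldTest hL.out (-1) hφ hc
    rw [neg_neg] at e1
    rw [integral_ext_mul hL.out (by simp) (measurable_lp u) (Lp.memLp u)
      (hasCompactSupport_pd2 hφ) (contDiff_pd2 hc), integral_ext_mul hL.out (by simp)
      (measurable_lp u') (Lp.memLp u') hφ hc, ← e1, ← inner_toL2 u (hF.pd2.memLp_flat hL.out),
      ← inner_toL2 u' (hF.memLp_flat hL.out)]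
    exact h _ hF (foldTest_neg_one_bdry φ)

/-- For an odd extension the folded test function need not vanish on the boundary, so the zero trace
of u is what prevents a jump across the axis. -/
theorem planeWeakDeriv_pd2_ext_neg_one [hL : Fact (0 < L)] {u u' : FlatL2 L}
    (h : HasZeroTrace u u') : PlaneWeakDeriv pd2 (ext L (-1) u) (ext L 1 u') where
  left := locallyIntegrable_ext hL.out (by simp) (measurable_lp u) (Lp.memLp u)
  right := locallyIntegrable_ext hL.out (by simp) (measurable_lp u') (Lp.memLp u')
  integral_eq φ hφ hc := by
    have hF := foldTest_isSmoothUpToBdry hL.out 1 hφ hc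
    rw [integral_ext_mul hL.out (by simp) (measurable_lp u) (Lp.memLp u)
      (hasCompactSupport_pd2 hφ) (contDiff_pd2 hc), integral_ext_mul hL.out (by simp)
      (measurable_lp u') (Lp.memLp u') hφ hc, ← pd2_foldTest hL.out 1 hφ hc,
      ← inner_toL2 u (hF.pd2.memLp_flat hL.out), ← inner_toL2 u' (hF.memLp_flat hL.out)]
    exact h _ hF

end

section

variable {φ R A : ℝ × ℝ → ℝ}

/-! ### Mollification -/

/-- The convolution of `R` with `φ`. -/
def moll (φ R : ℝ × ℝ → ℝ) (x : ℝ × ℝ) : ℝ := ∫ y, R y * φ (x - y)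

theorem moll_eq_convolution (φ R : ℝ × ℝ → ℝ) :
    moll φ R = convolution R φ (ContinuousLinearMap.mul ℝ ℝ) volume := rfl

/-- A smooth probability density with compact support. -/
structure IsMollifier (φ : ℝ × ℝ → ℝ) : Prop where
  smooth : ContDiff ℝ ∞ φ
  compact : HasCompactSupport φ
  nonneg : ∀ x, 0 ≤ φ x
  integral_eq_one : ∫ x, φ x = 1

theorem contDiff_moll (hc : ContDiff ℝ ∞ φ) (hφ : HasCompactSupport φ)
    (hR : LocallyIntegrable R volume) : ContDiff ℝ ∞ (moll φ R) :=
  hφ.contDiff_convolution_right (ContinuousLinearMap.mul ℝ ℝ) hR hc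

theorem moll_integrable (hc : Continuous φ) (hφ : HasCompactSupport φ)
    (hR : LocallyIntegrable R volume) (x : ℝ × ℝ) : Integrable (fun y => R y * φ (x - y)) :=
  hR.integrable_smul_right_of_hasCompactSupport (hc.comp (by fun_prop))
    (hφ.comp_homeomorph (Homeomorph.subLeft x))

theorem fderiv_moll (hc : ContDiff ℝ ∞ φ) (hφ : HasCompactSupport φ)
    (hR : LocallyIntegrable R volume) (x e : ℝ × ℝ) :
    fderiv ℝ (moll φ R) x e = moll (fun z => fderiv ℝ φ z e) R x := by
  have hc1 : ContDiff ℝ 1 φ := hc.of_le (by exact_mod_cast le_top)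
  have h := (hφ.hasFDerivAt_convolution_right (ContinuousLinearMap.mul ℝ ℝ) hR hc1 x).fderiv
  rw [moll_eq_convolution, h, convolution_precompR_apply _ hR (hφ.fderiv (𝕜 := ℝ))
    (hc1.continuous_fderiv one_ne_zero)]
  rfl

theorem contDiff_sub_left (hc : ContDiff ℝ ∞ φ) (x : ℝ × ℝ) :
    ContDiff ℝ ∞ (fun y => φ (x - y)) := hc.comp (by fun_prop)

theorem fderiv_sub_left (hc : ContDiff ℝ ∞ φ) (x y e : ℝ × ℝ) :
    fderiv ℝ (fun y => φ (x - y)) y e = - fderiv ℝ φ (x - y) e := by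
  have h1 : HasFDerivAt φ (fderiv ℝ φ (x - y)) (x - y) :=
    (differentiable_of_smooth hc _).hasFDerivAt
  have h2 : HasFDerivAt (fun y : ℝ × ℝ => x - y) (-ContinuousLinearMap.id ℝ (ℝ × ℝ)) y :=
    (hasFDerivAt_id y).const_sub x
  have h3 : HasFDerivAt (fun y => φ (x - y)) _ y := h1.comp y h2
  rw [h3.fderiv]
  simp

theorem moll_of_planeWeakDeriv {D : (ℝ × ℝ → ℝ) → ℝ × ℝ → ℝ} {e : ℝ × ℝ}
    (hD : ∀ φ, D φ = fun z => fderiv ℝ φ z e) (h : PlaneWeakDeriv D R A)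
    (hc : ContDiff ℝ ∞ φ) (hφ : HasCompactSupport φ) : D (moll φ R) = moll φ A := by
  funext x
  have h1 := h.integral_eq (fun y => φ (x - y)) (hφ.comp_homeomorph (Homeomorph.subLeft x))
    (contDiff_sub_left hc x)
  simp only [hD, fderiv_sub_left hc, mul_neg, integral_neg, neg_inj] at h1
  simp only [hD]
  rw [fderiv_moll hc hφ h.left]
  exact h1

theorem pd1_moll (h : PlaneWeakDeriv pd1 R A) (hφ : IsMollifier φ) : pd1 (moll φ R) = moll φ A :=
  moll_of_planeWeakDeriv (fun _ => rfl) h hφ.smooth hφ.compact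

theorem pd2_moll (h : PlaneWeakDeriv pd2 R A) (hφ : IsMollifier φ) : pd2 (moll φ R) = moll φ A :=
  moll_of_planeWeakDeriv (fun _ => rfl) h hφ.smooth hφ.compact

theorem moll_congr_ae {R' : ℝ × ℝ → ℝ} (h : R =ᵐ[volume] R') (x : ℝ × ℝ) :
    moll φ R x = moll φ R' x := by
  refine integral_congr_ae ?_
  filter_upwards [h] with y hy
  rw [hy]

theorem moll_sub (hφ : IsMollifier φ) (hR : LocallyIntegrable R volume)
    (hA : LocallyIntegrable A volume) (x : ℝ × ℝ) :
    moll φ (fun y => R y - A y) x = moll φ R x - moll φ A x := by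
  simp only [moll, sub_mul]
  exact integral_sub (moll_integrable hφ.smooth.continuous hφ.compact hR x)
    (moll_integrable hφ.smooth.continuous hφ.compact hA x)

theorem moll_add (hφ : IsMollifier φ) (hR : LocallyIntegrable R volume)
    (hA : LocallyIntegrable A volume) (x : ℝ × ℝ) :
    moll φ (fun y => R y + A y) x = moll φ R x + moll φ A x := by
  simp only [moll, add_mul]
  exact integral_add (moll_integrable hφ.smooth.continuous hφ.compact hR x)
    (moll_integrable hφ.smooth.continuous hφ.compact hA x)

theorem IsMollifier.integrable (hφ : IsMollifier φ) : Integrable φ :=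
  hφ.smooth.continuous.integrable_of_hasCompactSupport hφ.compact

theorem abs_moll_le (hφ : IsMollifier φ) {M : ℝ} (hM : ∀ᵐ y, |R y| ≤ M)
    (x : ℝ × ℝ) : |moll φ R x| ≤ M := by
  have h1 : Integrable (fun y => M * φ (x - y)) := (hφ.integrable.comp_sub_left x).const_mul M
  have h2 : ‖moll φ R x‖ ≤ ∫ y, M * φ (x - y) := by
    refine norm_integral_le_of_norm_le h1 ?_
    filter_upwards [hM] with y hy
    rw [Real.norm_eq_abs, abs_mul, abs_of_nonneg (hφ.nonneg _)]
    exact mul_le_mul_of_nonneg_right hy (hφ.nonneg _)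
  rwa [Real.norm_eq_abs, integral_const_mul, integral_sub_left_eq_self φ volume x, hφ.integral_eq_one, mul_one] at h2

/-- The half-open unit square. -/
def unitSquare : Set (ℝ × ℝ) := Set.Ico 0 1 ×ˢ Set.Ico 0 1

theorem measurableSet_unitSquare : MeasurableSet unitSquare :=
  measurableSet_Ico.prod measurableSet_Ico

/-- The `L²` norms of `R` on all unit squares are bounded by `B`. -/
def UnifL2 (R : ℝ × ℝ → ℝ) (B : ℝ≥0) : Prop :=
  ∀ c : ℝ × ℝ, ∫⁻ x in unitSquare, ‖R (x + c)‖ₑ ^ 2 ≤ (B : ℝ≥0∞) ^ 2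

theorem lintegral_sq_le_of_isProbabilityMeasure {α : Type*} [MeasurableSpace α] (ν : Measure α)
    [IsProbabilityMeasure ν] {f : α → ℝ} (hf : AEStronglyMeasurable f ν) :
    (∫⁻ y, ‖f y‖ₑ ∂ν) ^ 2 ≤ ∫⁻ y, ‖f y‖ₑ ^ 2 ∂ν := by
  have h := eLpNorm_le_eLpNorm_of_exponent_le (p := 1) (q := 2) (by norm_num) hf
  rw [eLpNorm_one_eq_lintegral_enorm, eLpNorm_eq_lintegral_rpow_enorm_toReal (by norm_num)
    (by norm_num)] at h
  have h2 := pow_le_pow_left₀ zero_le h 2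
  refine h2.trans_eq ?_
  rw [← ENNReal.rpow_natCast, ← ENNReal.rpow_mul]
  simp

/-- Jensen's inequality for the probability density φ, then Tonelli; the uniform local bound is
invariant under translations and so survives averaging. -/
theorem UnifL2.moll (hφ : IsMollifier φ) (hR : Measurable R) {B : ℝ≥0} (h : UnifL2 R B) :
    UnifL2 (moll φ R) B := by
  intro c
  have hφm : Measurable (fun y => ‖φ y‖ₑ) := hφ.smooth.continuous.measurable.enorm
  set ν : Measure (ℝ × ℝ) := volume.withDensity (fun y => ‖φ y‖ₑ) with hν
  have hprob : IsProbabilityMeasure ν := by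
    refine ⟨?_⟩
    rw [hν, withDensity_apply _ MeasurableSet.univ, Measure.restrict_univ]
    have e : ∀ y, ‖φ y‖ₑ = ENNReal.ofReal (φ y) := fun y => Real.enorm_of_nonneg (hφ.nonneg y)
    simp only [e]
    rw [← ofReal_integral_eq_lintegral_ofReal hφ.integrable (ae_of_all _ hφ.nonneg),
      hφ.integral_eq_one, ENNReal.ofReal_one]
  have hRx : ∀ x, Measurable (fun y => R (x - y)) := fun x => hR.comp (by fun_prop)
  have hR2 : Measurable (fun p : (ℝ × ℝ) × (ℝ × ℝ) => R (p.1 + c - p.2)) := hR.comp (by fun_prop)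
  have h1 : ∀ x, ‖RoughDomain.moll φ R x‖ₑ ≤ ∫⁻ y, ‖R (x - y)‖ₑ ∂ν := by
    intro x
    rw [hν, lintegral_withDensity_eq_lintegral_mul _ hφm (hRx x).enorm]
    refine (enorm_integral_le_lintegral_enorm _).trans_eq ?_
    rw [← lintegral_sub_left_eq_self _ x]
    refine lintegral_congr fun y => ?_
    rw [enorm_mul, sub_sub_cancel, mul_comm]; rfl
  have h2 : ∀ x, ‖RoughDomain.moll φ R x‖ₑ ^ 2 ≤ ∫⁻ y, ‖R (x - y)‖ₑ ^ 2 ∂ν := fun x =>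
    (pow_le_pow_left₀ zero_le (h1 x) 2).trans (lintegral_sq_le_of_isProbabilityMeasure ν
      (hRx x).aestronglyMeasurable)
  calc ∫⁻ x in unitSquare, ‖RoughDomain.moll φ R (x + c)‖ₑ ^ 2
      ≤ ∫⁻ x in unitSquare, ∫⁻ y, ‖R (x + c - y)‖ₑ ^ 2 ∂ν := lintegral_mono fun x => h2 _
    _ = ∫⁻ y, (∫⁻ x in unitSquare, ‖R (x + c - y)‖ₑ ^ 2) ∂ν :=
        lintegral_lintegral_swap (hR2.enorm.pow_const 2).aemeasurable
    _ ≤ ∫⁻ _, (B : ℝ≥0∞) ^ 2 ∂ν := by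
        refine lintegral_mono fun y => ?_
        have := h (c - y)
        simp only [← add_sub_assoc] at this
        exact this
    _ = _ := by simp

/-- As L ≥ 1, a unit square lies in a single strip, so its integral is at most 2 ‖u‖² ≤ (2B)². -/
theorem unifL2_ext {L : ℝ} (hL : 1 ≤ L) {e : ℝ} (he : |e| = 1) (u : FlatL2 L) {B : ℝ≥0}
    (h : ‖u‖ ≤ B) : UnifL2 (ext L e u) (2 * B) := by
  intro c
  have hL0 : 0 < L := by linarith
  have hm := measurable_lp u
  have h1 : ∫⁻ x in unitSquare, ‖ext L e u (x + c)‖ₑ ^ 2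
      ≤ ∫⁻ y, ‖ext L e u y‖ₑ ^ 2 ∂stripMeasure L c.1 := by
    rw [stripMeasure_eq_restrict, ← lintegral_indicator measurableSet_unitSquare,
      ← lintegral_indicator (measurableSet_Ico.prod MeasurableSet.univ),
      ← lintegral_add_right_eq_self (Set.indicator _ (fun y => ‖ext L e u y‖ₑ ^ 2)) c]
    refine lintegral_mono fun x => ?_
    by_cases hx : x ∈ unitSquare
    · rw [Set.indicator_of_mem hx, Set.indicator_of_mem]
      have h1 := hx.1.1
      have h2 := hx.1.2
      refine ⟨⟨?_, ?_⟩, trivial⟩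
      · simp only [Prod.fst_add]; linarith
      · simp only [Prod.fst_add]; linarith
    · rw [Set.indicator_of_notMem hx]; exact zero_le
  rw [lintegral_ext_sq hL0 he hm] at h1
  refine h1.trans ?_
  have h2 : ∫⁻ z, ‖u z‖ₑ ^ 2 ∂cellMeasure L 0 ≤ (B : ℝ≥0∞) ^ 2 := by
    have h3 : eLpNorm u 2 (cellMeasure L 0) ≤ B := by
      rw [← Lp.enorm_def]
      rw [← ofReal_norm]
      exact ENNReal.ofReal_le_of_le_toReal (by simpa using h)
    rw [eLpNorm_eq_lintegral_rpow_enorm_toReal (by norm_num) (by norm_num)] at h3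
    have h4 := pow_le_pow_left₀ zero_le h3 2
    rw [← ENNReal.rpow_natCast, ← ENNReal.rpow_mul] at h4
    simpa using h4
  calc _ ≤ 2 * (B : ℝ≥0∞) ^ 2 := by gcongr
    _ ≤ 4 * (B : ℝ≥0∞) ^ 2 := by gcongr; norm_num
    _ = _ := by push_cast; ring

theorem exists_mollifiers : ∃ φ : ℕ → ℝ × ℝ → ℝ, (∀ n, IsMollifier (φ n)) ∧
    ∀ R : ℝ × ℝ → ℝ, LocallyIntegrable R volume →
      ∀ᵐ x, Tendsto (fun n => moll (φ n) R x) atTop (𝓝 (R x)) := by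
  set ψ : ℕ → ContDiffBump (0 : ℝ × ℝ) := fun n =>
    -- The ratio of the radii is fixed at 2, as the almost everywhere convergence of mollifications
    -- requires a bounded ratio.
    ⟨((n : ℝ) + 1)⁻¹, 2 * ((n : ℝ) + 1)⁻¹, by positivity, by
      have : (0 : ℝ) < ((n : ℝ) + 1)⁻¹ := by positivity
      linarith⟩ with hψ
  refine ⟨fun n => (ψ n).normed volume, fun n => ⟨(ψ n).contDiff_normed, 
    (ψ n).hasCompactSupport_normed, (ψ n).nonneg_normed, (ψ n).integral_normed⟩, fun R hR => ?_⟩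
  have h := ContDiffBump.ae_convolution_tendsto_right_of_locallyIntegrable (φ := ψ) (l := atTop)
    (K := 2) (μ := volume) (g := R) (by
      have := (tendsto_one_div_add_atTop_nhds_zero_nat (𝕜 := ℝ)).const_mul 2
      simpa [hψ] using this) (Eventually.of_forall fun n => le_rfl) hR
  filter_upwards [h] with x hx
  refine hx.congr fun n => ?_
  rw [← convolution_flip]
  simp only [convolution, moll, ContinuousLinearMap.flip_apply, ContinuousLinearMap.lsmul_apply,
    smul_eq_mul, mul_comm]

end

section

/-! ### Pointwise bounds by local `L²` norms -/

/-- Integrate (g²)' = 2 g g' from 0 to y, bound it by g² + g'², and average over y in [0, 1]. -/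
theorem sq_le_integral_sq {g g' : ℝ → ℝ} (hg : ∀ x, HasDerivAt g (g' x) x) (hc : Continuous g') :
    g 0 ^ 2 ≤ 2 * ((∫ x in (0 : ℝ)..1, g x ^ 2) + ∫ x in (0 : ℝ)..1, g' x ^ 2) := by
  have hgc : Continuous g := continuous_iff_continuousAt.2 fun x => (hg x).continuousAt
  have h1 : ∀ y ∈ Set.Icc (0 : ℝ) 1,
      g 0 ^ 2 ≤ g y ^ 2 + ∫ x in (0 : ℝ)..1, (g x ^ 2 + g' x ^ 2) := by
    intro y hy
    have e : ∫ x in (0 : ℝ)..y, 2 * g x * g' x = g y ^ 2 - g 0 ^ 2 := by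
      refine intervalIntegral.integral_eq_sub_of_hasDerivAt (f := fun x => g x ^ 2) (fun x _ => ?_)
        ((by fun_prop : Continuous fun x => 2 * g x * g' x).intervalIntegrable _ _)
      simpa using (hg x).fun_pow 2
    have h2 : ∫ x in (0 : ℝ)..y, -(2 * g x * g' x) ≤ ∫ x in (0 : ℝ)..y, (g x ^ 2 + g' x ^ 2) :=
      intervalIntegral.integral_mono_on hy.1
        ((by fun_prop : Continuous fun x => -(2 * g x * g' x)).intervalIntegrable _ _)
        ((by fun_prop : Continuous fun x => g x ^ 2 + g' x ^ 2).intervalIntegrable _ _)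
        fun x _ => by nlinarith [sq_nonneg (g x + g' x)]
    have h3 : ∫ x in (0 : ℝ)..y, (g x ^ 2 + g' x ^ 2) ≤ ∫ x in (0 : ℝ)..1, (g x ^ 2 + g' x ^ 2) :=
      intervalIntegral.integral_mono_interval le_rfl hy.1 hy.2
        (ae_of_all _ fun x => by simp only [Pi.zero_apply]; positivity)
        ((by fun_prop : Continuous fun x => g x ^ 2 + g' x ^ 2).intervalIntegrable _ _)
    rw [intervalIntegral.integral_neg, e] at h2
    linarith
  have h2 := intervalIntegral.integral_mono_on (μ := volume) (zero_le_one (α := ℝ))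
    (continuous_const.intervalIntegrable _ _)
    ((by fun_prop : Continuous fun y => g y ^ 2 +
      ∫ x in (0 : ℝ)..1, (g x ^ 2 + g' x ^ 2)).intervalIntegrable _ _) h1
  rw [intervalIntegral.integral_const, intervalIntegral.integral_add
    ((by fun_prop : Continuous fun x => g x ^ 2).intervalIntegrable _ _)
    (continuous_const.intervalIntegrable _ _), intervalIntegral.integral_const,
    intervalIntegral.integral_add
    ((by fun_prop : Continuous fun x => g x ^ 2).intervalIntegrable _ _)
    ((by fun_prop : Continuous fun x => g' x ^ 2).intervalIntegrable _ _)] at h2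
  have h3 : 0 ≤ ∫ x in (0 : ℝ)..1, g' x ^ 2 :=
    intervalIntegral.integral_nonneg zero_le_one fun x _ => sq_nonneg _
  simp only [sub_zero, one_smul] at h2
  linarith

/-- The Cauchy–Schwarz inequality for the integral of g' over [0, h], obtained by expanding the
integral of (h g' - (g h - g 0))². -/
theorem sub_sq_le_integral_sq {g g' : ℝ → ℝ} (hg : ∀ x, HasDerivAt g (g' x) x)
    (hc : Continuous g') {h : ℝ} (h0 : 0 ≤ h) (h1 : h ≤ 1) :
    (g h - g 0) ^ 2 ≤ h * ∫ x in (0 : ℝ)..1, g' x ^ 2 := by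
  rcases h0.eq_or_lt with rfl | hpos
  · simp
  have e : ∫ x in (0 : ℝ)..h, g' x = g h - g 0 :=
    intervalIntegral.integral_eq_sub_of_hasDerivAt (fun x _ => hg x) (hc.intervalIntegrable _ _)
  set s := g h - g 0
  have i2 : IntervalIntegrable (fun x => h ^ 2 * g' x ^ 2) volume 0 h :=
    (by fun_prop : Continuous fun x => h ^ 2 * g' x ^ 2).intervalIntegrable _ _
  have i3 : IntervalIntegrable (fun x => 2 * h * s * g' x) volume 0 h :=
    (by fun_prop : Continuous fun x => 2 * h * s * g' x).intervalIntegrable _ _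
  have h2 : 0 ≤ ∫ x in (0 : ℝ)..h, (h * g' x - s) ^ 2 :=
    intervalIntegral.integral_nonneg h0 fun x _ => sq_nonneg _
  have e2 : ∫ x in (0 : ℝ)..h, (h * g' x - s) ^ 2
      = h ^ 2 * (∫ x in (0 : ℝ)..h, g' x ^ 2) - 2 * h * s * s + h * s ^ 2 := by
    have : ∀ x, (h * g' x - s) ^ 2 = h ^ 2 * g' x ^ 2 - 2 * h * s * g' x + s ^ 2 := fun x => by ring
    simp only [this]
    rw [intervalIntegral.integral_add (i2.sub i3) (continuous_const.intervalIntegrable _ _),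
      intervalIntegral.integral_sub i2 i3, intervalIntegral.integral_const_mul,
      intervalIntegral.integral_const_mul, e, intervalIntegral.integral_const]
    simp
  have h3 : ∫ x in (0 : ℝ)..h, g' x ^ 2 ≤ ∫ x in (0 : ℝ)..1, g' x ^ 2 :=
    intervalIntegral.integral_mono_interval le_rfl h0 h1
      (ae_of_all _ fun x => by simp only [Pi.zero_apply]; positivity)
      ((by fun_prop : Continuous fun x => g' x ^ 2).intervalIntegrable _ _)
  rw [e2] at h2
  have h4 : s ^ 2 ≤ h * ∫ x in (0 : ℝ)..h, g' x ^ 2 := by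
    have : 0 ≤ h * (h * (∫ x in (0 : ℝ)..h, g' x ^ 2) - s ^ 2) := by nlinarith
    linarith [nonneg_of_mul_nonneg_right this hpos]
  exact h4.trans (mul_le_mul_of_nonneg_left h3 h0)

theorem UnifL2.setIntegral_le {F : ℝ × ℝ → ℝ} {B : ℝ≥0} (h : UnifL2 F B) (hF : Continuous F)
    (c : ℝ × ℝ) : ∫ x in Set.Ioc (0 : ℝ) 1 ×ˢ Set.Ioc (0 : ℝ) 1, F (x + c) ^ 2 ≤ B ^ 2 := by
  have hae : (Set.Ioc (0 : ℝ) 1 ×ˢ Set.Ioc (0 : ℝ) 1 : Set (ℝ × ℝ)) =ᵐ[volume] unitSquare :=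
    Measure.set_prod_ae_eq Ico_ae_eq_Ioc.symm Ico_ae_eq_Ioc.symm
  rw [Measure.restrict_congr_set hae]
  have hi : IntegrableOn (fun x => F (x + c) ^ 2) unitSquare := by
    refine IntegrableOn.mono_set ((by fun_prop : Continuous fun x => F (x + c) ^ 2).continuousOn
      |>.integrableOn_compact (isCompact_Icc.prod isCompact_Icc))
      (Set.prod_mono Set.Ico_subset_Icc_self Set.Ico_subset_Icc_self)
  have h1 := h c
  have e : ∀ x, ‖F (x + c)‖ₑ ^ 2 = ENNReal.ofReal (F (x + c) ^ 2) := fun x => by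
    rw [← enorm_pow, Real.enorm_of_nonneg (sq_nonneg _)]
  simp only [e] at h1
  rw [← ofReal_integral_eq_lintegral_ofReal hi (ae_of_all _ fun x => sq_nonneg _)] at h1
  have h2 : ENNReal.ofReal (∫ x in unitSquare, F (x + c) ^ 2) ≤ ENNReal.ofReal ((B : ℝ) ^ 2) := by
    refine h1.trans_eq ?_
    rw [ENNReal.ofReal_pow B.coe_nonneg, ENNReal.ofReal_coe_nnreal]
  exact (ENNReal.ofReal_le_ofReal_iff (by positivity)).1 h2

theorem UnifL2.integral_le {F : ℝ × ℝ → ℝ} {B : ℝ≥0} (h : UnifL2 F B) (hF : Continuous F)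
    (c : ℝ × ℝ) :
    ∫ x in (0 : ℝ)..1, ∫ y in (0 : ℝ)..1, F (c.1 + x, c.2 + y) ^ 2 ≤ B ^ 2 := by
  have h1 := h.setIntegral_le hF c
  have hi : IntegrableOn (fun x => F (x + c) ^ 2) (Set.Ioc (0 : ℝ) 1 ×ˢ Set.Ioc (0 : ℝ) 1)
      (volume.prod volume) := by
    refine IntegrableOn.mono_set ((by fun_prop : Continuous fun x => F (x + c) ^ 2).continuousOn
      |>.integrableOn_compact (isCompact_Icc.prod isCompact_Icc))
      (Set.prod_mono Set.Ioc_subset_Icc_self Set.Ioc_subset_Icc_self)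
  rw [Measure.volume_eq_prod, setIntegral_prod _ hi] at h1
  simp only [intervalIntegral.integral_of_le (zero_le_one (α := ℝ))]
  refine le_trans (le_of_eq ?_) h1
  refine integral_congr_ae (ae_of_all _ fun x => integral_congr_ae (ae_of_all _ fun y => ?_))
  simp only [Prod.add_def, add_comm]

theorem UnifL2.integral_swap_le {F : ℝ × ℝ → ℝ} {B : ℝ≥0} (h : UnifL2 F B) (hF : Continuous F)
    (c : ℝ × ℝ) :
    ∫ y in (0 : ℝ)..1, ∫ x in (0 : ℝ)..1, F (c.1 + x, c.2 + y) ^ 2 ≤ B ^ 2 := by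
  refine le_trans (le_of_eq ?_) (h.integral_le hF c)
  simp only [intervalIntegral.integral_of_le (zero_le_one (α := ℝ))]
  refine integral_integral_swap (f := fun y x => F (c.1 + x, c.2 + y) ^ 2) ?_
  rw [Measure.prod_restrict]
  exact IntegrableOn.mono_set ((by fun_prop : Continuous (Function.uncurry fun y x : ℝ =>
    F (c.1 + x, c.2 + y) ^ 2)).continuousOn |>.integrableOn_compact
      (isCompact_Icc.prod isCompact_Icc))
    (Set.prod_mono Set.Ioc_subset_Icc_self Set.Ioc_subset_Icc_self)

theorem hasDerivAt_slice1 {F : ℝ × ℝ → ℝ} (hF : ContDiff ℝ ∞ F) (a b x : ℝ) :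
    HasDerivAt (fun x => F (a + x, b)) (pd1 F (a + x, b)) x := by
  simpa using (hasDerivAt_pd1 hF (a + x) b).comp_const_add a x

theorem hasDerivAt_slice2 {F : ℝ × ℝ → ℝ} (hF : ContDiff ℝ ∞ F) (a b y : ℝ) :
    HasDerivAt (fun y => F (a, b + y)) (pd2 F (a, b + y)) y := by
  simpa using (hasDerivAt_pd2 hF a (b + y)).comp_const_add b y

/-- The one-dimensional inequality in the vertical variable, integrated horizontally, bounds the L²
norm on a horizontal segment. -/
theorem integral_slice1_le {G : ℝ × ℝ → ℝ} (hG : ContDiff ℝ ∞ G) {B : ℝ≥0} (h : UnifL2 G B)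
    (h2 : UnifL2 (pd2 G) B) (c : ℝ × ℝ) : ∫ x in (0 : ℝ)..1, G (c.1 + x, c.2) ^ 2 ≤ 4 * B ^ 2 := by
  have hc := hG.continuous
  have hc2 := (contDiff_pd2 hG).continuous
  have h3 : ∀ x : ℝ, G (c.1 + x, c.2) ^ 2 ≤ 2 * ((∫ y in (0 : ℝ)..1, G (c.1 + x, c.2 + y) ^ 2)
      + ∫ y in (0 : ℝ)..1, pd2 G (c.1 + x, c.2 + y) ^ 2) := fun x => by
    have := sq_le_integral_sq (fun y => hasDerivAt_slice2 hG (c.1 + x) c.2 y) (by fun_prop)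
    simpa using this
  have i1 : Continuous fun x : ℝ => ∫ y in (0 : ℝ)..1, G (c.1 + x, c.2 + y) ^ 2 :=
    intervalIntegral.continuous_parametric_intervalIntegral_of_continuous' (by fun_prop) _ _
  have i2 : Continuous fun x : ℝ => ∫ y in (0 : ℝ)..1, pd2 G (c.1 + x, c.2 + y) ^ 2 :=
    intervalIntegral.continuous_parametric_intervalIntegral_of_continuous' (by fun_prop) _ _
  have h4 := intervalIntegral.integral_mono_on (μ := volume) (zero_le_one (α := ℝ))
    ((by fun_prop : Continuous fun x => G (c.1 + x, c.2) ^ 2).intervalIntegrable _ _)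
    (((i1.add i2).const_mul 2).intervalIntegrable _ _) fun x _ => h3 x
  rw [intervalIntegral.integral_const_mul] at h4
  have e := intervalIntegral.integral_add (μ := volume) (i1.intervalIntegrable 0 1)
    (i2.intervalIntegrable 0 1)
  simp only [Pi.add_apply] at h4
  rw [e] at h4
  have := h.integral_le hc c
  have := h2.integral_le hc2 c
  linarith

theorem integral_slice2_le {G : ℝ × ℝ → ℝ} (hG : ContDiff ℝ ∞ G) {B : ℝ≥0} (h : UnifL2 G B)
    (h1 : UnifL2 (pd1 G) B) (c : ℝ × ℝ) : ∫ y in (0 : ℝ)..1, G (c.1, c.2 + y) ^ 2 ≤ 4 * B ^ 2 := by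
  have hc := hG.continuous
  have hc2 := (contDiff_pd1 hG).continuous
  have h3 : ∀ y : ℝ, G (c.1, c.2 + y) ^ 2 ≤ 2 * ((∫ x in (0 : ℝ)..1, G (c.1 + x, c.2 + y) ^ 2)
      + ∫ x in (0 : ℝ)..1, pd1 G (c.1 + x, c.2 + y) ^ 2) := fun y => by
    have := sq_le_integral_sq (fun x => hasDerivAt_slice1 hG c.1 (c.2 + y) x) (by fun_prop)
    simpa using this
  have i1 : Continuous fun y : ℝ => ∫ x in (0 : ℝ)..1, G (c.1 + x, c.2 + y) ^ 2 :=
    intervalIntegral.continuous_parametric_intervalIntegral_of_continuous' (by fun_prop) _ _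
  have i2 : Continuous fun y : ℝ => ∫ x in (0 : ℝ)..1, pd1 G (c.1 + x, c.2 + y) ^ 2 :=
    intervalIntegral.continuous_parametric_intervalIntegral_of_continuous' (by fun_prop) _ _
  have h4 := intervalIntegral.integral_mono_on (μ := volume) (zero_le_one (α := ℝ))
    ((by fun_prop : Continuous fun y => G (c.1, c.2 + y) ^ 2).intervalIntegrable _ _)
    (((i1.add i2).const_mul 2).intervalIntegrable _ _) fun y _ => h3 y
  rw [intervalIntegral.integral_const_mul] at h4
  have e := intervalIntegral.integral_add (μ := volume) (i1.intervalIntegrable 0 1)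
    (i2.intervalIntegrable 0 1)
  simp only [Pi.add_apply] at h4
  rw [e] at h4
  have := h.integral_swap_le hc c
  have := h1.integral_swap_le hc2 c
  linarith

/-- Local `L²` bounds for `F` and its derivatives that control `F` pointwise. -/
structure MixedBound (F : ℝ × ℝ → ℝ) (B : ℝ≥0) : Prop where
  smooth : ContDiff ℝ ∞ F
  base : UnifL2 F B
  bound1 : UnifL2 (pd1 F) B
  bound2 : UnifL2 (pd2 F) B
  bound21 : UnifL2 (pd2 (pd1 F)) B

namespace MixedBound

variable {F : ℝ × ℝ → ℝ} {B : ℝ≥0}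

/-- The one-dimensional Sobolev inequality is used first along a segment, then transversally for F
and ∂₁F. Only the mixed second derivative is involved: after reflection ∂₂F may jump across the
axis, so ∂₂∂₂F is not available. -/
theorem abs_le (h : MixedBound F B) (c : ℝ × ℝ) : |F c| ≤ 4 * B := by
  have h1 := sq_le_integral_sq (fun x => hasDerivAt_slice1 h.smooth c.1 c.2 x)
    (by have := (contDiff_pd1 h.smooth).continuous; fun_prop)
  have h2 := integral_slice1_le h.smooth h.base h.bound2 c
  have h3 := integral_slice1_le (contDiff_pd1 h.smooth) h.bound1 h.bound21 c
  simp only [add_zero] at h1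
  refine abs_le_of_sq_le_sq ?_ (by positivity)
  calc F c ^ 2 ≤ _ := h1
    _ ≤ (4 * B) ^ 2 := by nlinarith

theorem abs_sub_le1 (h : MixedBound F B) (c : ℝ × ℝ) {t : ℝ} (h0 : 0 ≤ t) (h1 : t ≤ 1) :
    |F (c.1 + t, c.2) - F c| ≤ 2 * B * √t := by
  have h2 := sub_sq_le_integral_sq (fun x => hasDerivAt_slice1 h.smooth c.1 c.2 x)
    (by have := (contDiff_pd1 h.smooth).continuous; fun_prop) h0 h1
  have h3 := integral_slice1_le (contDiff_pd1 h.smooth) h.bound1 h.bound21 c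
  simp only [add_zero] at h2
  refine abs_le_of_sq_le_sq ?_ (by positivity)
  calc _ ≤ _ := h2
    _ ≤ t * (4 * B ^ 2) := mul_le_mul_of_nonneg_left h3 h0
    _ = (2 * B * √t) ^ 2 := by rw [mul_pow, Real.sq_sqrt h0]; ring

theorem abs_sub_le2 (h : MixedBound F B) (c : ℝ × ℝ) {t : ℝ} (h0 : 0 ≤ t) (h1 : t ≤ 1) :
    |F (c.1, c.2 + t) - F c| ≤ 2 * B * √t := by
  have h2 := sub_sq_le_integral_sq (fun x => hasDerivAt_slice2 h.smooth c.1 c.2 x)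
    (by have := (contDiff_pd2 h.smooth).continuous; fun_prop) h0 h1
  have h3 := integral_slice2_le (contDiff_pd2 h.smooth) h.bound2
    (by rw [pd_comm h.smooth]; exact h.bound21) c
  simp only [add_zero] at h2
  refine abs_le_of_sq_le_sq ?_ (by positivity)
  calc _ ≤ _ := h2
    _ ≤ t * (4 * B ^ 2) := mul_le_mul_of_nonneg_left h3 h0
    _ = (2 * B * √t) ^ 2 := by rw [mul_pow, Real.sq_sqrt h0]; ring

/-- Join the two points by a horizontal and a vertical segment; on each, the L² bound of the
tangential derivative gives Hölder continuity of exponent 1/2. -/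
theorem abs_sub_le (h : MixedBound F B) (x z : ℝ × ℝ) {t : ℝ} (ht : t ≤ 1) (h1 : |z.1| ≤ t)
    (h2 : |z.2| ≤ t) : |F (x + z) - F x| ≤ 4 * B * √t := by
  have hB : (0 : ℝ) ≤ 2 * B := by positivity
  have a1 : |F (x.1 + z.1, x.2 + z.2) - F (x.1, x.2 + z.2)| ≤ 2 * B * √t := by
    rcases le_total 0 z.1 with hz | hz
    · have := h.abs_sub_le1 (x.1, x.2 + z.2) hz ((le_abs_self _).trans (h1.trans ht))
      exact this.trans (mul_le_mul_of_nonneg_left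
        (Real.sqrt_le_sqrt ((le_abs_self _).trans h1)) hB)
    · have := h.abs_sub_le1 (x.1 + z.1, x.2 + z.2) (neg_nonneg.2 hz)
        ((neg_le_abs _).trans (h1.trans ht))
      simp only [add_neg_cancel_right] at this
      rw [abs_sub_comm]
      exact this.trans (mul_le_mul_of_nonneg_left
        (Real.sqrt_le_sqrt ((neg_le_abs _).trans h1)) hB)
  have a2 : |F (x.1, x.2 + z.2) - F x| ≤ 2 * B * √t := by
    rcases le_total 0 z.2 with hz | hz
    · exact (h.abs_sub_le2 x hz ((le_abs_self _).trans (h2.trans ht))).trans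
        (mul_le_mul_of_nonneg_left (Real.sqrt_le_sqrt ((le_abs_self _).trans h2)) hB)
    · have := h.abs_sub_le2 (x.1, x.2 + z.2) (neg_nonneg.2 hz)
        ((neg_le_abs _).trans (h2.trans ht))
      simp only [add_neg_cancel_right] at this
      rw [abs_sub_comm]
      exact this.trans (mul_le_mul_of_nonneg_left
        (Real.sqrt_le_sqrt ((neg_le_abs _).trans h2)) hB)
  calc |F (x + z) - F x| = |(F (x.1 + z.1, x.2 + z.2) - F (x.1, x.2 + z.2))
        + (F (x.1, x.2 + z.2) - F x)| := by rw [sub_add_sub_cancel]; rfl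
    _ ≤ _ := abs_add_le _ _
    _ ≤ 4 * B * √t := by linarith

end MixedBound

end

section

/-! ### A logarithmic estimate on the plane -/

/-- A radial kernel `ρ` with `z ρ(z) = -∇Σ(z)`. -/
structure RadialKernel (ρ S : ℝ × ℝ → ℝ) : Prop where
  smooth : ContDiff ℝ ∞ ρ
  compact : HasCompactSupport ρ
  nonneg : ∀ z, 0 ≤ ρ z
  supp : ∀ z, ρ z ≠ 0 → |z.1| ≤ 1 ∧ |z.2| ≤ 1
  integral_pos : 0 < ∫ z, ρ z
  smooth_potential : ContDiff ℝ ∞ S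
  compact_potential : HasCompactSupport S
  pd1_potential : ∀ z, pd1 S z = - (z.1 * ρ z)
  pd2_potential : ∀ z, pd2 S z = - (z.2 * ρ z)

/-- Take S = σ(|z|²) and ρ = -2 σ'(|z|²) for a smooth decreasing σ with σ(0) = 1 that vanishes on
[1, ∞). -/
theorem exists_radialKernel : ∃ ρ S : ℝ × ℝ → ℝ, RadialKernel ρ S := by
  set σ : ℝ → ℝ := fun r => Real.smoothTransition (1 - r) with hσ
  have hs : ContDiff ℝ ∞ σ := Real.smoothTransition.contDiff.comp (contDiff_const.sub contDiff_id)
  have hd : ContDiff ℝ ∞ (deriv σ) := contDiff_deriv hs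
  have h1 : ∀ r, 1 ≤ r → σ r = 0 := fun r hr => Real.smoothTransition.zero_of_nonpos (by linarith)
  have hanti : Antitone σ := fun a b hab => Real.smoothTransition.monotone (by linarith)
  have hd1 : ∀ r, 1 < r → deriv σ r = 0 := fun r hr => by
    have : σ =ᶠ[𝓝 r] fun _ => 0 := by
      filter_upwards [lt_mem_nhds hr] with y hy using h1 y hy.le
    rw [this.deriv_eq, deriv_const]
  set q : ℝ × ℝ → ℝ := fun z => z.1 ^ 2 + z.2 ^ 2 with hq
  have hqs : ContDiff ℝ ∞ q := (contDiff_fst.pow 2).add (contDiff_snd.pow 2)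
  have hle : ∀ z : ℝ × ℝ, q z ≤ 1 → |z.1| ≤ 1 ∧ |z.2| ≤ 1 := fun z hz => by
    simp only [hq] at hz
    exact ⟨abs_le_one_iff_mul_self_le_one.2 (by nlinarith [sq_nonneg z.2]),
      abs_le_one_iff_mul_self_le_one.2 (by nlinarith [sq_nonneg z.1])⟩
  have hcomp : ∀ f : ℝ → ℝ, (∀ r, 1 < r → f r = 0) → HasCompactSupport (fun z => f (q z)) := by
    intro f hf
    refine HasCompactSupport.of_support_subset_isCompact
      ((isCompact_Icc (a := (-1 : ℝ)) (b := 1)).prod (isCompact_Icc (a := (-1 : ℝ)) (b := 1)))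
      fun z hz => ?_
    have : q z ≤ 1 := by
      by_contra hn
      exact hz (hf _ (not_le.1 hn))
    exact ⟨abs_le.1 (hle z this).1, abs_le.1 (hle z this).2⟩
  have hρs : ContDiff ℝ ∞ (fun z => -2 * deriv σ (q z)) := contDiff_const.mul (hd.comp hqs)
  have hρc : HasCompactSupport (fun z => -2 * deriv σ (q z)) :=
    hcomp (fun r => -2 * deriv σ r) fun r hr => by rw [hd1 r hr, mul_zero]
  have hρ0 : ∀ z, 0 ≤ -2 * deriv σ (q z) := fun z => by
    have := hanti.deriv_nonpos (x := q z)
    linarith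
  -- The mean value theorem yields a point with σ'(r) = -1, so ρ is not identically zero and its
  -- integral is positive.
  obtain ⟨r, hr, hr'⟩ := exists_deriv_eq_slope σ (zero_lt_one (α := ℝ)) hs.continuous.continuousOn
    (hs.differentiable (by simp)).differentiableOn
  have e0 : σ 0 = 1 := by simp [hσ]
  rw [e0, h1 1 le_rfl] at hr'
  have hσd : ∀ x, HasDerivAt σ (deriv σ x) x := fun x =>
    (hs.differentiable (by simp) x).hasDerivAt
  refine ⟨fun z => -2 * deriv σ (q z), fun z => σ (q z), hρs, hρc, hρ0, fun z hz => hle z ?_,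
    ?_, hs.comp hqs, hcomp σ fun r hr => h1 r hr.le, fun z => ?_, fun z => ?_⟩
  · by_contra hn
    exact hz (by simp only [hd1 _ (not_le.1 hn), mul_zero])
  · refine hρs.continuous.integral_pos_of_hasCompactSupport_nonneg_nonzero hρc hρ0
      (x := (√r, 0)) ?_
    have : q (√r, 0) = r := by simp [hq, Real.sq_sqrt hr.1.le]
    rw [this, hr']
    norm_num
  · obtain ⟨x, y⟩ := z
    have h2 : HasDerivAt (fun x => q (x, y)) (2 * x) x := by
      have := ((hasDerivAt_id x).fun_pow 2).add_const (y ^ 2)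
      simpa [hq, -hasDerivAt_add_const_iff] using this
    have h3 : HasDerivAt (fun x => σ (q (x, y))) (deriv σ (q (x, y)) * (2 * x)) x :=
      HasDerivAt.comp x (h₂ := σ) (hσd (q (x, y))) h2
    rw [pd1_eq (φ := fun z => σ (q z)) (hs.comp hqs) h3]
    ring
  · obtain ⟨x, y⟩ := z
    have h2 : HasDerivAt (fun y => q (x, y)) (2 * y) y := by
      have := ((hasDerivAt_id y).fun_pow 2).const_add (x ^ 2)
      simpa [hq, -hasDerivAt_const_add_iff] using this
    have h3 : HasDerivAt (fun y => σ (q (x, y))) (deriv σ (q (x, y)) * (2 * y)) y :=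
      HasDerivAt.comp y (h₂ := σ) (hσd (q (x, y))) h2
    rw [pd2_eq (φ := fun z => σ (q z)) (hs.comp hqs) h3]
    ring

/-- The average `∫ F(x - t z) ρ(z) dz`. -/
def scaledMean (ρ F : ℝ × ℝ → ℝ) (x : ℝ × ℝ) (t : ℝ) : ℝ := ∫ z, F (x - t • z) * ρ z

theorem integrable_mul_of_compact {F ρ : ℝ × ℝ → ℝ} (hF : Continuous F) (hρ : Continuous ρ)
    (hc : HasCompactSupport ρ) : Integrable (fun z => F z * ρ z) :=
  (hF.mul hρ).integrable_of_hasCompactSupport hc.mul_left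

theorem integral_pd1_mul {F ρ : ℝ × ℝ → ℝ} (hF : ContDiff ℝ ∞ F) (hρ : ContDiff ℝ ∞ ρ)
    (hc : HasCompactSupport ρ) : ∫ z, pd1 F z * ρ z = - ∫ z, F z * pd1 ρ z := by
  have h := integral_mul_fderiv_eq_neg_fderiv_mul_of_integrable (𝕜 := ℝ) (μ := volume) (f := F)
    (g := ρ) (v := (1, 0)) (integrable_mul_of_compact (contDiff_pd1 hF).continuous hρ.continuous hc)
    (integrable_mul_of_compact hF.continuous (contDiff_pd1 hρ).continuous (hasCompactSupport_pd1 hc))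
    (integrable_mul_of_compact hF.continuous hρ.continuous hc)
    (fun x _ => differentiable_of_smooth hF x) (fun x _ => differentiable_of_smooth hρ x)
  simp only [pd1]
  rw [h, neg_neg]

theorem integral_pd2_mul {F ρ : ℝ × ℝ → ℝ} (hF : ContDiff ℝ ∞ F) (hρ : ContDiff ℝ ∞ ρ)
    (hc : HasCompactSupport ρ) : ∫ z, pd2 F z * ρ z = - ∫ z, F z * pd2 ρ z := by
  have h := integral_mul_fderiv_eq_neg_fderiv_mul_of_integrable (𝕜 := ℝ) (μ := volume) (f := F)
    (g := ρ) (v := (0, 1)) (integrable_mul_of_compact (contDiff_pd2 hF).continuous hρ.continuous hc)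
    (integrable_mul_of_compact hF.continuous (contDiff_pd2 hρ).continuous (hasCompactSupport_pd2 hc))
    (integrable_mul_of_compact hF.continuous hρ.continuous hc)
    (fun x _ => differentiable_of_smooth hF x) (fun x _ => differentiable_of_smooth hρ x)
  simp only [pd2]
  rw [h, neg_neg]

theorem contDiff_dilate {F : ℝ × ℝ → ℝ} (hF : ContDiff ℝ ∞ F) (x : ℝ × ℝ) (t : ℝ) :
    ContDiff ℝ ∞ (fun z => F (x - t • z)) := hF.comp (by fun_prop)

theorem pd1_dilate {F : ℝ × ℝ → ℝ} (hF : ContDiff ℝ ∞ F) (x : ℝ × ℝ) (t : ℝ) :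
    pd1 (fun z => F (x - t • z)) = fun z => -t * pd1 F (x - t • z) := by
  have := pd1_affine hF x.1 (-t) x.2 (-t)
  simp only [neg_mul, ← sub_eq_add_neg] at this ⊢
  exact this

theorem pd2_dilate {F : ℝ × ℝ → ℝ} (hF : ContDiff ℝ ∞ F) (x : ℝ × ℝ) (t : ℝ) :
    pd2 (fun z => F (x - t • z)) = fun z => -t * pd2 F (x - t • z) := by
  have := pd2_affine hF x.1 (-t) x.2 (-t)
  simp only [neg_mul, ← sub_eq_add_neg] at this ⊢
  exact this

theorem mul_scaledMean_pd1 {F ρ : ℝ × ℝ → ℝ} (hF : ContDiff ℝ ∞ F) (hρ : ContDiff ℝ ∞ ρ)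
    (hc : HasCompactSupport ρ) (x : ℝ × ℝ) (t : ℝ) :
    t * scaledMean ρ (pd1 F) x t = scaledMean (pd1 ρ) F x t := by
  have h := integral_pd1_mul (contDiff_dilate hF x t) hρ hc
  rw [pd1_dilate hF] at h
  simp only [mul_assoc, integral_const_mul] at h
  simp only [scaledMean]
  linarith

theorem mul_scaledMean_pd2 {F ρ : ℝ × ℝ → ℝ} (hF : ContDiff ℝ ∞ F) (hρ : ContDiff ℝ ∞ ρ)
    (hc : HasCompactSupport ρ) (x : ℝ × ℝ) (t : ℝ) :
    t * scaledMean ρ (pd2 F) x t = scaledMean (pd2 ρ) F x t := by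
  have h := integral_pd2_mul (contDiff_dilate hF x t) hρ hc
  rw [pd2_dilate hF] at h
  simp only [mul_assoc, integral_const_mul] at h
  simp only [scaledMean]
  linarith

theorem abs_scaledMean_le {F ρ : ℝ × ℝ → ℝ} (hρ : Continuous ρ) (hc : HasCompactSupport ρ) {M : ℝ}
    (hM : ∀ z, |F z| ≤ M) (x : ℝ × ℝ) (t : ℝ) : |scaledMean ρ F x t| ≤ M * ∫ z, |ρ z| := by
  have h : ‖scaledMean ρ F x t‖ ≤ ∫ z, M * |ρ z| := by
    refine norm_integral_le_of_norm_le
      ((hρ.integrable_of_hasCompactSupport hc).abs.const_mul M) (ae_of_all _ fun z => ?_)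
    rw [Real.norm_eq_abs, abs_mul]
    exact mul_le_mul_of_nonneg_right (hM _) (abs_nonneg _)
  rwa [integral_const_mul] at h

theorem hasDerivAt_scaledMean {F ρ : ℝ × ℝ → ℝ} (hF : ContDiff ℝ ∞ F) (hρ : Continuous ρ)
    (hc : HasCompactSupport ρ) (x : ℝ × ℝ) (t : ℝ) :
    HasDerivAt (scaledMean ρ F x)
      (∫ z, -(z.1 * pd1 F (x - t • z) + z.2 * pd2 F (x - t • z)) * ρ z) t := by
  have c1 := (contDiff_pd1 hF).continuous
  have c2 := (contDiff_pd2 hF).continuous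
  have hFc := hF.continuous
  set K : Set (ℝ × (ℝ × ℝ)) := Set.Icc (t - 1) (t + 1) ×ˢ tsupport ρ with hK
  have hKc : IsCompact K := isCompact_Icc.prod hc
  obtain ⟨C, hC⟩ := hKc.exists_bound_of_continuousOn (f := fun p : ℝ × (ℝ × ℝ) =>
    -(p.2.1 * pd1 F (x - p.1 • p.2) + p.2.2 * pd2 F (x - p.1 • p.2)))
    (by fun_prop : Continuous _).continuousOn
  refine (hasDerivAt_integral_of_dominated_loc_of_deriv_le (F := fun t z => F (x - t • z) * ρ z)
    (F' := fun t z => -(z.1 * pd1 F (x - t • z) + z.2 * pd2 F (x - t • z)) * ρ z)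
    (bound := fun z => C * |ρ z|) (s := Set.Icc (t - 1) (t + 1))
    (Icc_mem_nhds (by linarith) (by linarith)) ?_ ?_ ?_ ?_ ?_ ?_).2
  · exact Eventually.of_forall fun s => (by fun_prop : Continuous fun z =>
      F (x - s • z) * ρ z).aestronglyMeasurable
  · exact integrable_mul_of_compact (by fun_prop) hρ hc
  · exact (by fun_prop : Continuous fun z : ℝ × ℝ =>
      -(z.1 * pd1 F (x - t • z) + z.2 * pd2 F (x - t • z)) * ρ z).aestronglyMeasurable
  · refine ae_of_all _ fun z s hs => ?_
    rw [norm_mul]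
    by_cases hz : ρ z = 0
    · simp [hz]
    · exact mul_le_mul_of_nonneg_right (hC (s, z) ⟨hs, subset_tsupport ρ hz⟩) (norm_nonneg _)
  · exact (hρ.integrable_of_hasCompactSupport hc).abs.const_mul C
  · refine ae_of_all _ fun z s _ => HasDerivAt.mul_const ?_ _
    have h1 : HasFDerivAt F (fderiv ℝ F (x - s • z)) (x - s • z) :=
      (differentiable_of_smooth hF _).hasFDerivAt
    have h2 : HasDerivAt (fun s : ℝ => x - s • z) (-z) s := by
      simpa using ((hasDerivAt_id s).smul_const z).const_sub x
    have h3 : HasDerivAt (fun s : ℝ => F (x - s • z)) (fderiv ℝ F (x - s • z) (-z)) s :=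
      h1.comp_hasDerivAt s h2
    convert! h3 using 1
    have e : -z = -(z.1 • ((1 : ℝ), (0 : ℝ)) + z.2 • ((0 : ℝ), (1 : ℝ))) := by
      ext <;> simp
    rw [e, map_neg, map_add, map_smul, map_smul]
    rfl

/-- Differentiating in t produces -z · ∇F(x - tz) ρ(z) = ∇F(x - tz) · ∇S(z); integrating by parts in
z turns this into t ΔF against S. -/
theorem RadialKernel.deriv_scaledMean {ρ S F : ℝ × ℝ → ℝ} (h : RadialKernel ρ S)
    (hF : ContDiff ℝ ∞ F) (x : ℝ × ℝ) (t : ℝ) :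
    HasDerivAt (scaledMean ρ F x)
      (t * scaledMean S (fun z => pd1 (pd1 F) z + pd2 (pd2 F) z) x t) t := by
  convert! hasDerivAt_scaledMean hF h.smooth.continuous h.compact x t using 1
  have s1 := contDiff_pd1 hF
  have s2 := contDiff_pd2 hF
  have t1 := mul_scaledMean_pd1 s1 h.smooth_potential h.compact_potential x t
  have t2 := mul_scaledMean_pd2 s2 h.smooth_potential h.compact_potential x t
  have hd := fun (G : ℝ × ℝ → ℝ) (hG : ContDiff ℝ ∞ G) => contDiff_dilate hG x t
  have i1 : Integrable fun z => pd1 (pd1 F) (x - t • z) * S z :=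
    integrable_mul_of_compact (hd _ (contDiff_pd1 s1)).continuous h.smooth_potential.continuous
      h.compact_potential
  have i2 : Integrable fun z => pd2 (pd2 F) (x - t • z) * S z :=
    integrable_mul_of_compact (hd _ (contDiff_pd2 s2)).continuous h.smooth_potential.continuous
      h.compact_potential
  have i3 : Integrable fun z => pd1 F (x - t • z) * pd1 S z :=
    integrable_mul_of_compact (hd _ s1).continuous (contDiff_pd1 h.smooth_potential).continuous
      (hasCompactSupport_pd1 h.compact_potential)
  have i4 : Integrable fun z => pd2 F (x - t • z) * pd2 S z :=
    integrable_mul_of_compact (hd _ s2).continuous (contDiff_pd2 h.smooth_potential).continuous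
      (hasCompactSupport_pd2 h.compact_potential)
  have e1 : scaledMean S (fun z => pd1 (pd1 F) z + pd2 (pd2 F) z) x t
      = scaledMean S (pd1 (pd1 F)) x t + scaledMean S (pd2 (pd2 F)) x t := by
    simp only [scaledMean, add_mul]
    exact integral_add i1 i2
  rw [e1, mul_add, t1, t2]
  simp only [scaledMean]
  rw [← integral_add i3 i4]
  congr 1
  ext z
  rw [h.pd1_potential, h.pd2_potential]
  ring

/-- Compare the mean at scale 0, which is ∂₁U(x) ∫ ρ, with those at scales δ and T. From 0 to δ
Hölder continuity is used; from δ to T the bound N on t m'(t), the derivative of m in log t; at T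
the derivative in ∂₁U is moved onto ρ, which gains 1/T. -/
theorem RadialKernel.abs_mul_integral_le {ρ S U : ℝ × ℝ → ℝ} (h : RadialKernel ρ S) {B : ℝ≥0}
    (hU : MixedBound U B) (hF : MixedBound (pd1 U) B) {N : ℝ} (x : ℝ × ℝ)
    (hN : ∀ t, |t * (t * scaledMean S
      (fun z => pd1 (pd1 (pd1 U)) z + pd2 (pd2 (pd1 U)) z) x t)| ≤ N)
    {δ T : ℝ} (hδ : 0 < δ) (hδ1 : δ ≤ 1) (hT : δ ≤ T) :
    |pd1 U x| * ∫ z, ρ z ≤ 4 * B * √δ * (∫ z, ρ z) + N * Real.log (T / δ)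
      + 4 * B / T * ∫ z, |pd1 ρ z| := by
  set F := pd1 U with hFdef
  set m := scaledMean ρ F x with hm
  have hT0 : 0 < T := hδ.trans_le hT
  have hρi : Integrable ρ := h.smooth.continuous.integrable_of_hasCompactSupport h.compact
  have hFc := hF.smooth.continuous
  have e0 : m 0 = F x * ∫ z, ρ z := by
    simp only [hm, scaledMean, zero_smul, sub_zero, integral_const_mul]
  have h1 : |m δ - m 0| ≤ 4 * B * √δ * ∫ z, ρ z := by
    have i1 : Integrable fun z => F (x - δ • z) * ρ z :=
      integrable_mul_of_compact (by fun_prop) h.smooth.continuous h.compact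
    have e1 : m δ - m 0 = ∫ z, (F (x - δ • z) - F x) * ρ z := by
      rw [e0, ← integral_const_mul]
      simp only [hm, scaledMean, sub_mul]
      rw [integral_sub i1 (hρi.const_mul _)]
    rw [e1, ← integral_const_mul, ← Real.norm_eq_abs]
    refine norm_integral_le_of_norm_le (hρi.const_mul _) (ae_of_all _ fun z => ?_)
    rw [norm_mul, Real.norm_eq_abs, Real.norm_eq_abs, abs_of_nonneg (h.nonneg z)]
    by_cases hz : ρ z = 0
    · simp [hz]
    · refine mul_le_mul_of_nonneg_right ?_ (h.nonneg z)
      obtain ⟨z1, z2⟩ := h.supp z hz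
      rw [sub_eq_add_neg]
      refine hF.abs_sub_le x (-(δ • z)) hδ1 ?_ ?_
      · simp only [Prod.fst_neg, Prod.smul_fst, smul_eq_mul, abs_neg, abs_mul, abs_of_pos hδ]
        nlinarith
      · simp only [Prod.snd_neg, Prod.smul_snd, smul_eq_mul, abs_neg, abs_mul, abs_of_pos hδ]
        nlinarith
  have h2 : |m T| ≤ 4 * B / T * ∫ z, |pd1 ρ z| := by
    have e2 := mul_scaledMean_pd1 hU.smooth h.smooth h.compact x T
    have e3 := abs_scaledMean_le (contDiff_pd1 h.smooth).continuous
      (hasCompactSupport_pd1 h.compact) hU.abs_le x T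
    rw [← e2, abs_mul, abs_of_pos hT0] at e3
    rw [div_mul_eq_mul_div, le_div_iff₀ hT0]
    linarith
  have h3 : |m T - m δ| ≤ N * Real.log (T / δ) := by
    have hn : ∀ s, HasDerivAt (fun s => m (Real.exp s)) (Real.exp s * (Real.exp s * scaledMean S
        (fun z => pd1 (pd1 F) z + pd2 (pd2 F) z) x (Real.exp s))) s := fun s => by
      convert! (h.deriv_scaledMean hF.smooth x (Real.exp s)).comp s (Real.hasDerivAt_exp s) using 1
      ring
    have := Convex.norm_image_sub_le_of_norm_hasDerivWithin_le (C := N) (s := Set.univ)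
      (x := Real.log δ) (y := Real.log T) (fun s _ => (hn s).hasDerivWithinAt)
      (fun s _ => hN (Real.exp s)) convex_univ trivial trivial
    simp only [Real.exp_log hδ, Real.exp_log hT0, Real.norm_eq_abs] at this
    rwa [Real.log_div hT0.ne' hδ.ne', ← abs_of_nonneg (sub_nonneg.2 (Real.log_le_log hδ hT))]
  have h4 : |F x| * ∫ z, ρ z = |m 0| := by rw [e0, abs_mul, abs_of_pos h.integral_pos]
  rw [h4]
  have h5 : m 0 = -(m δ - m 0) - (m T - m δ) + m T := by ring
  calc |m 0| ≤ |-(m δ - m 0) - (m T - m δ)| + |m T| := by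
        conv_lhs => rw [h5]
        exact abs_add_le _ _
    _ ≤ |-(m δ - m 0)| + |m T - m δ| + |m T| := by gcongr; exact abs_sub _ _
    _ ≤ _ := by rw [abs_neg]; gcongr

theorem scaledMean_neg (S G : ℝ × ℝ → ℝ) (x : ℝ × ℝ) (t : ℝ) :
    scaledMean S (fun z => -G z) x t = - scaledMean S G x t := by
  simp only [scaledMean, neg_mul, integral_neg]

/-- Two functions on the plane with `∂₁U₁ + ∂₂U₂ = 0`, `∂₁U₂ - ∂₂U₁ = W`, and local bounds. -/
structure PlaneField (U₁ U₂ W : ℝ × ℝ → ℝ) (B : ℝ≥0) (M : ℝ) : Prop where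
  bound_fst : MixedBound U₁ B
  bound_snd : MixedBound U₂ B
  bound_fst1 : MixedBound (pd1 U₁) B
  bound_snd1 : MixedBound (pd1 U₂) B
  smooth : ContDiff ℝ ∞ W
  abs_le : ∀ z, |W z| ≤ M
  div : ∀ z, pd1 U₁ z + pd2 U₂ z = 0
  curl : ∀ z, pd1 U₂ z - pd2 U₁ z = W z

/-- The div-curl equations give ΔU₁ = -∂₂W; this is its horizontal derivative. -/
theorem PlaneField.laplacian_fst {U₁ U₂ W : ℝ × ℝ → ℝ} {B : ℝ≥0} {M : ℝ}
    (h : PlaneField U₁ U₂ W B M) (z : ℝ × ℝ) :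
    pd1 (pd1 (pd1 U₁)) z + pd2 (pd2 (pd1 U₁)) z = - pd1 (pd2 W) z := by
  have s1 := h.bound_fst.smooth
  have s2 := h.bound_snd.smooth
  have e1 : pd1 U₁ = fun z => (-1) * pd2 U₂ z := funext fun z => by linarith [h.div z]
  have e2 : pd2 U₁ = fun z => pd1 U₂ z + (-1) * W z := funext fun z => by linarith [h.curl z]
  have a1 : pd1 (pd1 U₁) = fun z => (-1) * pd2 (pd1 U₂) z := by
    rw [e1, pd1_const_mul (contDiff_pd2 s2), pd_comm s2]
  have a2 : pd2 (pd2 U₁) = fun z => pd2 (pd1 U₂) z + (-1) * pd2 W z := by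
    rw [e2, pd2_add (contDiff_pd1 s2) (contDiff_const.mul h.smooth), pd2_const_mul h.smooth]
  have a3 : pd2 (pd2 (pd1 U₁)) = pd1 (pd2 (pd2 U₁)) := by
    rw [← pd_comm s1, pd_comm (contDiff_pd2 s1)]
  have t1 := contDiff_pd2 (contDiff_pd1 s2)
  rw [a3, a2, a1, pd1_const_mul t1, pd1_add t1 (contDiff_const.mul (contDiff_pd2 h.smooth)),
    pd1_const_mul (contDiff_pd2 h.smooth)]
  ring

theorem PlaneField.laplacian_snd {U₁ U₂ W : ℝ × ℝ → ℝ} {B : ℝ≥0} {M : ℝ}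
    (h : PlaneField U₁ U₂ W B M) (z : ℝ × ℝ) :
    pd1 (pd1 (pd1 U₂)) z + pd2 (pd2 (pd1 U₂)) z = pd1 (pd1 W) z := by
  have s1 := h.bound_fst.smooth
  have s2 := h.bound_snd.smooth
  have e1 : pd2 U₂ = fun z => (-1) * pd1 U₁ z := funext fun z => by linarith [h.div z]
  have e2 : pd1 U₂ = fun z => pd2 U₁ z + W z := funext fun z => by linarith [h.curl z]
  have a1 : pd2 (pd2 U₂) = fun z => (-1) * pd2 (pd1 U₁) z := by
    rw [e1, pd2_const_mul (contDiff_pd1 s1)]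
  have a2 : pd1 (pd1 U₂) = fun z => pd2 (pd1 U₁) z + pd1 W z := by
    rw [e2, pd1_add (contDiff_pd2 s1) h.smooth, pd_comm s1]
  have a3 : pd2 (pd2 (pd1 U₂)) = pd1 (pd2 (pd2 U₂)) := by
    rw [← pd_comm s2, pd_comm (contDiff_pd2 s2)]
  have t1 := contDiff_pd2 (contDiff_pd1 s1)
  rw [a3, a2, a1, pd1_const_mul t1, pd1_add t1 (contDiff_pd1 h.smooth)]
  ring

/-- Here Δ∂₁U is a second derivative of W. In t² times its mean against S, both derivatives pass to
S, each using up one factor t; what remains is bounded by sup |W| times an L¹ norm of second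
derivatives of S, uniformly in t. -/
theorem exists_planeField_bound : ∃ C : ℝ, 0 ≤ C ∧ ∀ {U₁ U₂ W : ℝ × ℝ → ℝ} {B : ℝ≥0} {M : ℝ},
    PlaneField U₁ U₂ W B M → ∀ {δ T : ℝ}, 0 < δ → δ ≤ 1 → δ ≤ T → ∀ x,
    |pd1 U₁ x| ≤ C * (B * √δ + M * Real.log (T / δ) + B / T) ∧
    |pd1 U₂ x| ≤ C * (B * √δ + M * Real.log (T / δ) + B / T) := by
  obtain ⟨ρ, S, h⟩ := exists_radialKernel
  have c1 := contDiff_pd1 h.smooth_potential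
  have c2 := contDiff_pd2 h.smooth_potential
  have k1 := hasCompactSupport_pd1 h.compact_potential
  set c := ∫ z, ρ z with hc
  have hc0 : 0 < c := h.integral_pos
  set K₀ := ∫ z, |pd1 ρ z|
  set K₁ := ∫ z, |pd2 (pd1 S) z|
  set K₂ := ∫ z, |pd1 (pd1 S) z|
  have hK₀ : 0 ≤ K₀ := integral_nonneg fun z => abs_nonneg _
  have hK₁ : 0 ≤ K₁ := integral_nonneg fun z => abs_nonneg _
  have hK₂ : 0 ≤ K₂ := integral_nonneg fun z => abs_nonneg _
  refine ⟨(4 * c + K₁ + K₂ + 4 * K₀) / c, by positivity,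
    fun {U₁ U₂ W B M} hf {δ T} hδ hδ1 hT x => ?_⟩
  have hT0 : 0 < T := hδ.trans_le hT
  have hM : 0 ≤ M := (abs_nonneg _).trans (hf.abs_le x)
  have hlog : 0 ≤ Real.log (T / δ) := Real.log_nonneg ((one_le_div hδ).2 hT)
  have b1 : ∀ t, |t * (t * scaledMean S
      (fun z => pd1 (pd1 (pd1 U₁)) z + pd2 (pd2 (pd1 U₁)) z) x t)| ≤ M * K₁ := fun t => by
    simp only [hf.laplacian_fst, scaledMean_neg, mul_neg, abs_neg]
    rw [mul_scaledMean_pd1 (contDiff_pd2 hf.smooth) h.smooth_potential h.compact_potential,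
      mul_scaledMean_pd2 hf.smooth c1 k1]
    exact abs_scaledMean_le (contDiff_pd2 c1).continuous (hasCompactSupport_pd2 k1) hf.abs_le x t
  have b2 : ∀ t, |t * (t * scaledMean S
      (fun z => pd1 (pd1 (pd1 U₂)) z + pd2 (pd2 (pd1 U₂)) z) x t)| ≤ M * K₂ := fun t => by
    simp only [hf.laplacian_snd]
    have e : (fun z => pd1 (pd1 W) z) = pd1 (pd1 W) := rfl
    rw [e, mul_scaledMean_pd1 (contDiff_pd1 hf.smooth) h.smooth_potential h.compact_potential,
      mul_scaledMean_pd1 hf.smooth c1 k1]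
    exact abs_scaledMean_le (contDiff_pd1 c1).continuous (hasCompactSupport_pd1 k1) hf.abs_le x t
  have r1 := h.abs_mul_integral_le hf.bound_fst hf.bound_fst1 x b1 hδ hδ1 hT
  have r2 := h.abs_mul_integral_le hf.bound_snd hf.bound_snd1 x b2 hδ hδ1 hT
  have p1 : 0 ≤ B * √δ := by positivity
  have p2 : 0 ≤ M * Real.log (T / δ) := by positivity
  have p3 : 0 ≤ B / T := by positivity
  have key : ∀ K, 0 ≤ K → K ≤ K₁ + K₂ → 4 * B * √δ * c + M * K * Real.log (T / δ) + 4 * B / T * K₀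
      ≤ (4 * c + K₁ + K₂ + 4 * K₀) * (B * √δ + M * Real.log (T / δ) + B / T) := fun K h0 hK => by
    have e : 4 * B * √δ * c + M * K * Real.log (T / δ) + 4 * B / T * K₀
      = 4 * c * (B * √δ) + K * (M * Real.log (T / δ)) + 4 * K₀ * (B / T) := by ring
    rw [e, mul_add, mul_add]
    gcongr <;> linarith
  constructor
  · rw [div_mul_eq_mul_div, le_div_iff₀ hc0]
    exact r1.trans (key K₁ hK₁ (by linarith))
  · rw [div_mul_eq_mul_div, le_div_iff₀ hc0]
    exact r2.trans (key K₂ hK₂ (by linarith))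

end

section

open scoped RealInnerProductSpace

variable {L : ℝ} {γ : ℝ → ℝ}

/-! ### The pointwise bound for the flattened field -/

theorem unifL2_moll_ext (hL : 1 ≤ L) {e : ℝ} (he : |e| = 1) {u : FlatL2 L} {B : ℝ≥0}
    (h : ‖u‖ ≤ B) {φ : ℝ × ℝ → ℝ} (hφ : IsMollifier φ) : UnifL2 (moll φ (ext L e u)) (2 * B) :=
  (unifL2_ext hL he u h).moll hφ (measurable_ext (measurable_lp u) e)

/-- Vertical derivatives change the parity of an extension and horizontal ones keep it. At most one
vertical derivative is ever taken, so that reflection creates no singular part. -/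
theorem mixedBound_moll_ext [hL : Fact (0 < L)] (hL1 : 1 ≤ L) {e : ℝ} (he : |e| = 1)
    {u u₁ u₂ u₁₁ u₂₁ u₂₁₁ : FlatL2 L} {B : ℝ≥0} (h1 : IsWeakDeriv L 0 (1, 0) u u₁)
    (h2 : PlaneWeakDeriv pd2 (ext L e u) (ext L (-e) u₂)) (h11 : IsWeakDeriv L 0 (1, 0) u₁ u₁₁)
    (h21 : IsWeakDeriv L 0 (1, 0) u₂ u₂₁) (h211 : IsWeakDeriv L 0 (1, 0) u₂₁ u₂₁₁)
    (n : ‖u‖ ≤ B) (n1 : ‖u₁‖ ≤ B) (n2 : ‖u₂‖ ≤ B) (n11 : ‖u₁₁‖ ≤ B) (n21 : ‖u₂₁‖ ≤ B)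
    (n211 : ‖u₂₁₁‖ ≤ B) {φ : ℝ × ℝ → ℝ} (hφ : IsMollifier φ) :
    MixedBound (moll φ (ext L e u)) (2 * B) ∧ MixedBound (pd1 (moll φ (ext L e u))) (2 * B) := by
  have he' : |-e| = 1 := by rwa [abs_neg]
  have hs : ContDiff ℝ ∞ (moll φ (ext L e u)) := contDiff_moll hφ.smooth hφ.compact h2.left
  have e1 := pd1_moll (planeWeakDeriv_pd1_ext he h1) hφ
  have e2 := pd2_moll h2 hφ
  have e11 := pd1_moll (planeWeakDeriv_pd1_ext he h11) hφ
  have e21 := pd1_moll (planeWeakDeriv_pd1_ext he' h21) hφ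
  have e211 := pd1_moll (planeWeakDeriv_pd1_ext he' h211) hφ
  have c1 : pd2 (pd1 (moll φ (ext L e u))) = moll φ (ext L (-e) u₂₁) := by
    rw [← pd_comm hs, e2, e21]
  have c2 : pd2 (pd1 (pd1 (moll φ (ext L e u)))) = moll φ (ext L (-e) u₂₁₁) := by
    rw [← pd_comm (contDiff_pd1 hs), c1, e211]
  refine ⟨⟨hs, unifL2_moll_ext hL1 he n hφ, ?_, ?_, ?_⟩, ⟨contDiff_pd1 hs, ?_, ?_, ?_, ?_⟩⟩
  · rw [e1]; exact unifL2_moll_ext hL1 he n1 hφ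
  · rw [e2]; exact unifL2_moll_ext hL1 he' n2 hφ
  · rw [c1]; exact unifL2_moll_ext hL1 he' n21 hφ
  · rw [e1]; exact unifL2_moll_ext hL1 he n1 hφ
  · rw [e1, e11]; exact unifL2_moll_ext hL1 he n11 hφ
  · rw [c1]; exact unifL2_moll_ext hL1 he' n21 hφ
  · rw [c2]; exact unifL2_moll_ext hL1 he' n211 hφ

theorem SobolevBound.of_isWeakDeriv1 [hL : Fact (0 < L)] {k : ℕ} {B : ℝ≥0} {u u' : FlatL2 L}
    (h : SobolevBound L 0 (k + 1) u B) (hu : IsWeakDeriv L 0 (1, 0) u u') :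
    SobolevBound L 0 k u' B := by
  obtain ⟨-, f₁, f₂, w1, w2, s1, s2⟩ := h
  exact s1.congr (w1.ae_unique hL.out continuous_const (fun _ => rfl) hu)

theorem SobolevBound.of_isWeakDeriv2 [hL : Fact (0 < L)] {k : ℕ} {B : ℝ≥0} {u u' : FlatL2 L}
    (h : SobolevBound L 0 (k + 1) u B) (hu : IsWeakDeriv L 0 (0, 1) u u') :
    SobolevBound L 0 k u' B := by
  obtain ⟨-, f₁, f₂, w1, w2, s1, s2⟩ := h
  exact s2.congr (w2.ae_unique hL.out continuous_const (fun _ => rfl) hu)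

theorem SobolevBound.exists_lp_deriv1 {k : ℕ} {B : ℝ≥0} {u : FlatL2 L}
    (h : SobolevBound L 0 (k + 1) u B) :
    ∃ u' : FlatL2 L, IsWeakDeriv L 0 (1, 0) u u' ∧ SobolevBound L 0 k u' B := by
  obtain ⟨-, f₁, f₂, w1, w2, s1, s2⟩ := h
  have e := (coeFn_toL2 s1.memLp).symm
  exact ⟨toL2 L f₁, w1.congr EventuallyEq.rfl e, s1.congr e⟩

theorem exists_mixedBound [hL : Fact (0 < L)] (hL1 : 1 ≤ L) {e : ℝ} (he : |e| = 1)
    {u u₁ u₂ : FlatL2 L} {B : ℝ≥0} (hs : SobolevBound L 0 3 u B)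
    (h1 : IsWeakDeriv L 0 (1, 0) u u₁) (h2 : IsWeakDeriv L 0 (0, 1) u u₂)
    (h2' : PlaneWeakDeriv pd2 (ext L e u) (ext L (-e) u₂)) {φ : ℝ × ℝ → ℝ} (hφ : IsMollifier φ) :
    MixedBound (moll φ (ext L e u)) (2 * B) ∧ MixedBound (pd1 (moll φ (ext L e u))) (2 * B) := by
  have s1 := hs.of_isWeakDeriv1 h1
  have s2 := hs.of_isWeakDeriv2 h2
  obtain ⟨u₁₁, h11, s11⟩ := s1.exists_lp_deriv1
  obtain ⟨u₂₁, h21, s21⟩ := s2.exists_lp_deriv1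
  obtain ⟨u₂₁₁, h211, s211⟩ := s21.exists_lp_deriv1
  exact mixedBound_moll_ext hL1 he h1 h2' h11 h21 h211 hs.norm_le s1.norm_le s2.norm_le s11.norm_le
    s21.norm_le s211.norm_le hφ

theorem ext_ae_cell (e : ℝ) (g : ℝ × ℝ → ℝ) :
    ∀ᵐ z ∂cellMeasure L 0, ext L e g z = g z := by
  filter_upwards [ae_mem_cell (γ := 0) (L := L) continuous_const] with z hz
  have h0 : 0 < z.2 := hz.2.2
  rw [ext, if_pos h0, wrap_of_mem (⟨hz.1, hz.2.1⟩ : z.1 ∈ Set.Ico 0 L)]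

theorem ae_cell_of_ae {P : ℝ × ℝ → Prop} (h : ∀ᵐ z, P z) : ∀ᵐ z ∂cellMeasure L γ, P z :=
  ae_restrict_of_ae h

/-- With V₁ even and V₂ odd, both terms of the divergence are even and both terms of the curl are
odd, so the equations continue across the axis. -/
theorem FlatField.planeField [hL : Fact (0 < L)] (hL1 : 1 ≤ L) {v : ℝ × ℝ → ℝ × ℝ}
    {w : ℝ × ℝ → ℝ} {V₁ V₂ a₁ a₂ b₁ b₂ : FlatL2 L} (h : FlatField γ v w V₁ V₂ a₁ a₂ b₁ b₂) {X : ℝ≥0}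
    (s1 : SobolevBound L 0 3 V₁ X) (s2 : SobolevBound L 0 3 V₂ X) {M : ℝ}
    (hM : ∀ᵐ z ∂cellMeasure L 0, |b₁ z - a₂ z| ≤ M) {φ : ℝ × ℝ → ℝ} (hφ : IsMollifier φ) :
    PlaneField (moll φ (ext L 1 V₁)) (moll φ (ext L (-1) V₂))
      (moll φ (ext L (-1) fun z => b₁ z - a₂ z)) (2 * X) M := by
  have o1 : |(1 : ℝ)| = 1 := by simp
  have o2 : |(-1 : ℝ)| = 1 := by simp
  have p1 := planeWeakDeriv_pd2_ext_one h.ibp_fst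
  have p2 := planeWeakDeriv_pd2_ext_neg_one h.ibp_snd
  have q1 := planeWeakDeriv_pd1_ext o1 h.deriv_fst1
  have q2 := planeWeakDeriv_pd1_ext o2 h.deriv_snd1
  obtain ⟨m1, m1'⟩ := exists_mixedBound hL1 o1 s1 h.deriv_fst1 h.deriv_fst2 p1 hφ
  obtain ⟨m2, m2'⟩ := exists_mixedBound hL1 o2 s2 h.deriv_snd1 h.deriv_snd2
    (by rw [neg_neg]; exact p2) hφ
  have hω : MemLp (fun z => b₁ z - a₂ z) 2 (cellMeasure L 0) := (Lp.memLp b₁).sub (Lp.memLp a₂)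
  have hωm : Measurable (fun z => b₁ z - a₂ z) := (measurable_lp b₁).sub (measurable_lp a₂)
  have hωl := locallyIntegrable_ext hL.out o2 hωm hω
  refine ⟨m1, m2, m1', m2', contDiff_moll hφ.smooth hφ.compact hωl,
    abs_moll_le hφ (ae_abs_ext_le hL.out o2 hM), fun z => ?_, fun z => ?_⟩
  · rw [pd1_moll q1 hφ, pd2_moll p2 hφ, ← moll_add hφ q1.right p2.right]
    have e1 : (fun y => ext L 1 a₁ y + ext L 1 b₂ y) =ᵐ[volume] fun _ => 0 := by
      have e2 : (fun z => a₁ z + b₂ z) =ᵐ[cellMeasure L 0] fun _ => 0 := by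
        filter_upwards [Lp.coeFn_add a₁ b₂, Lp.eq_zero_iff_ae_eq_zero.1 h.system.div] with z h1 h2
        rw [h2, Pi.add_apply] at h1
        exact h1.symm
      filter_upwards [ext_congr_ae hL.out 1 e2] with y hy
      simp only [ext] at hy ⊢
      split_ifs at hy ⊢ <;> linarith
    rw [moll_congr_ae e1]
    simp [moll]
  · rw [pd1_moll q2 hφ, pd2_moll p1 hφ, ← moll_sub hφ q2.right p1.right]
    refine moll_congr_ae (ae_of_all _ fun y => ?_) z
    simp only [ext]
    split_ifs <;> ring

/-- The planar bound is uniform in the mollification parameter, and mollifications converge almost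
everywhere. -/
theorem FlatField.exists_ae_bound : ∃ C : ℝ, 0 ≤ C ∧ ∀ {L : ℝ} [Fact (0 < L)] {γ : ℝ → ℝ}
    {v : ℝ × ℝ → ℝ × ℝ} {w : ℝ × ℝ → ℝ} {V₁ V₂ a₁ a₂ b₁ b₂ : FlatL2 L} {X : ℝ≥0} {M δ T : ℝ},
    1 ≤ L → FlatField γ v w V₁ V₂ a₁ a₂ b₁ b₂ →
    SobolevBound L 0 3 V₁ X → SobolevBound L 0 3 V₂ X →
    (∀ᵐ z ∂cellMeasure L 0, |b₁ z - a₂ z| ≤ M) → 0 < δ → δ ≤ 1 → δ ≤ T →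
    ∀ᵐ z ∂cellMeasure L 0,
      |a₁ z| ≤ C * (2 * X * √δ + M * Real.log (T / δ) + 2 * X / T) ∧
      |b₁ z| ≤ C * (2 * X * √δ + M * Real.log (T / δ) + 2 * X / T) := by
  obtain ⟨C, hC0, hC⟩ := exists_planeField_bound
  obtain ⟨φ, hφ, hlim⟩ := exists_mollifiers
  refine ⟨C, hC0, fun {L hL γ v w V₁ V₂ a₁ a₂ b₁ b₂ X M δ T} hL1 h s1 s2 hM hδ hδ1 hT => ?_⟩
  have o1 : |(1 : ℝ)| = 1 := by simp
  have o2 : |(-1 : ℝ)| = 1 := by simp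
  have q1 := planeWeakDeriv_pd1_ext o1 h.deriv_fst1
  have q2 := planeWeakDeriv_pd1_ext o2 h.deriv_snd1
  have hb : ∀ n x, _ := fun n x => hC (h.planeField hL1 s1 s2 hM (hφ n)) hδ hδ1 hT x
  filter_upwards [ae_cell_of_ae (hlim _ q1.right), ae_cell_of_ae (hlim _ q2.right),
    ext_ae_cell 1 a₁, ext_ae_cell (-1) b₁] with z l1 l2 e1 e2
  rw [e1] at l1
  rw [e2] at l2
  constructor
  · refine le_of_tendsto l1.abs (Eventually.of_forall fun n => ?_)
    have := (hb n z).1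
    rw [pd1_moll q1 (hφ n)] at this
    push_cast at this
    exact this
  · refine le_of_tendsto l2.abs (Eventually.of_forall fun n => ?_)
    have := (hb n z).2
    rw [pd1_moll q2 (hφ n)] at this
    push_cast at this
    exact this

end

section

variable {L : ℝ} {γ : ℝ → ℝ}

/-! ### The estimate of the gradient in `L^∞` -/

/-- The choice T = r, δ = r⁻² makes √δ = 1/T = 1/r, so both error terms equal 2 C₃ X / r ≤ ε², and
log(T/δ) = 3 log r. -/
theorem exists_scales {C₃ ε X : ℝ} (hC : 0 ≤ C₃) (hε : 0 < ε) (hε1 : ε ≤ 1) (hX : 0 ≤ X) :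
    ∃ δ T : ℝ, 0 < δ ∧ δ ≤ 1 ∧ δ ≤ T ∧ ∀ M, 0 ≤ M →
      2 * (C₃ * X) * √δ + M * Real.log (T / δ) + 2 * (C₃ * X) / T
        ≤ 2 * ε ^ 2 + 3 * (1 + 2 * Real.log (1 + 2 * C₃)) * (M * Real.log (2 + 1 / ε ^ 3 * X)) := by
  set r := 1 + 2 * (C₃ * X) / ε ^ 2 with hr
  set Y := 2 + 1 / ε ^ 3 * X with hY
  have hr1 : 1 ≤ r := by rw [hr]; linarith [show 0 ≤ 2 * (C₃ * X) / ε ^ 2 by positivity]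
  have hr0 : 0 < r := by linarith
  have hY2 : 2 ≤ Y := by rw [hY]; linarith [show 0 ≤ 1 / ε ^ 3 * X by positivity]
  have hrX : 2 * (C₃ * X) ≤ ε ^ 2 * r := by
    rw [hr, mul_add, mul_div_cancel₀ _ (by positivity)]
    nlinarith [sq_nonneg ε]
  -- As ε ≤ 1, ε⁻² ≤ ε⁻³; so r is comparable with the argument of the logarithm in the claim.
  have hrY : r ≤ (1 + 2 * C₃) * Y := by
    have h1 : 2 * (C₃ * X) / ε ^ 2 ≤ 2 * C₃ * (1 / ε ^ 3 * X) := by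
      have : 2 * C₃ * (1 / ε ^ 3 * X) = 2 * (C₃ * X) / ε ^ 3 := by ring
      rw [this]
      exact div_le_div_of_nonneg_left (by positivity) (by positivity)
        (pow_le_pow_of_le_one hε.le hε1 (by norm_num))
    have h2 : 0 ≤ 1 / ε ^ 3 * X := by positivity
    rw [hr, hY]
    nlinarith
  have hlog2 : 1 / 2 ≤ Real.log Y := by
    have := Real.log_le_log (by norm_num) hY2
    linarith [Real.log_two_gt_d9]
  have hl0 : 0 ≤ Real.log (1 + 2 * C₃) := Real.log_nonneg (by linarith)
  -- The additive constant log(1 + 2C₃) is absorbed because log Y ≥ 1/2.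
  have hlog : Real.log r ≤ (1 + 2 * Real.log (1 + 2 * C₃)) * Real.log Y := by
    have h1 := Real.log_le_log hr0 hrY
    rw [Real.log_mul (by positivity) (by positivity)] at h1
    nlinarith
  have hs : √((r⁻¹) ^ 2) = r⁻¹ := Real.sqrt_sq (by positivity)
  have hinv : r⁻¹ ≤ 1 := inv_le_one_of_one_le₀ hr1
  have hd : 2 * (C₃ * X) / r ≤ ε ^ 2 := (div_le_iff₀ hr0).2 hrX
  have hsq : (r⁻¹) ^ 2 ≤ 1 := pow_le_one₀ (by positivity) hinv
  refine ⟨(r⁻¹) ^ 2, r, by positivity, hsq, hsq.trans hr1, fun M hM => ?_⟩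
  have e : Real.log (r / (r⁻¹) ^ 2) = 3 * Real.log r := by
    have : r / (r⁻¹) ^ 2 = r ^ 3 := by field_simp
    rw [this, Real.log_pow]; norm_num
  rw [hs, e, ← div_eq_mul_inv]
  have := mul_le_mul_of_nonneg_left hlog hM
  linarith

theorem FlatField.exists_sobolevBound_three (A : ℝ≥0) : ∃ C : ℝ≥0, ∀ {L : ℝ} [Fact (0 < L)]
    {γ : ℝ → ℝ} {v : ℝ × ℝ → ℝ × ℝ} {w : ℝ × ℝ → ℝ} {V₁ V₂ a₁ a₂ b₁ b₂ : FlatL2 L} {X : ℝ≥0},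
    CoeffBound L 4 A γ → FlatField γ v w V₁ V₂ a₁ a₂ b₁ b₂ →
    SobolevBound L γ 3 (fun z => (v z).1) X → SobolevBound L γ 3 (fun z => (v z).2) X →
    SobolevBound L 0 3 V₁ (C * X) ∧ SobolevBound L 0 3 V₂ (C * X) := by
  obtain ⟨C, -, hC⟩ := SobolevBound.comp_shear 3 A
  refine ⟨C + 2 ^ 3 * A * C, fun {L hL γ v w V₁ V₂ a₁ a₂ b₁ b₂ X} hγ hf h1 h2 => ?_⟩
  have e : ∀ {f : ℝ × ℝ → ℝ}, SobolevBound L γ 3 f X →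
      SobolevBound L 0 3 (fun z => f (shear γ z)) (C * X) := fun {f} h =>
    hC (γ := 0) (κ := γ) hL.out continuous_const (hγ.of_le (by norm_num)) (by rwa [zero_add])
  have t1 := e h1
  have t2 := (e h2).sub continuous_const (t1.coeff_mul continuous_const hγ.deriv)
  refine ⟨(t1.congr hf.eq_fst.symm).mono ?_, (t2.congr hf.eq_snd.symm).mono (le_of_eq ?_)⟩
  · gcongr; exact le_self_add
  · ring

theorem ae_of_ae_comp_shear {A : ℝ≥0} {k : ℕ} (hγ : CoeffBound L k A γ) {P : ℝ × ℝ → Prop}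
    (h : ∀ᵐ z ∂cellMeasure L 0, P (shear γ z)) : ∀ᵐ z ∂cellMeasure L γ, P z := by
  have hc := hγ.smooth.continuous
  have hm : MeasurePreserving (shear (-γ)) (cellMeasure L γ) (cellMeasure L 0) := by
    have := measurePreserving_shear (L := L) (γ := γ) (κ := -γ) hc hc.neg
    rwa [add_neg_cancel] at this
  filter_upwards [hm.quasiMeasurePreserving.ae h] with z hz
  rwa [shear_shear_neg] at hz

/-- Pointwise algebra. The flat curl differs from w by four products, each containing a factor γ' or
γ'' of size σ; hence the error (3 + A) σ N. Conversely, bounds for a₁, b₁ and the curl determine a₂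
= b₁ - curl, then b₂ = -a₁, then all derivatives of v. -/
theorem gradient_bound_of_flat {A σ K M N p₁ p₂ q₁ q₂ v₁ w g g' a₁ a₂ b₁ b₂ : ℝ} (hA : 0 ≤ A)
    (hσ : 0 ≤ σ) (hσA : σ ≤ A) (hN : 0 ≤ N) (hg : |g| ≤ σ) (hg' : |g'| ≤ σ) (hv₁ : |v₁| ≤ N)
    (hp₁ : |p₁| ≤ N) (hp₂ : |p₂| ≤ N) (hq₂ : |q₂| ≤ N) (hw : |w| ≤ M) (hw' : w = q₁ - p₂)
    (ha₁ : a₁ = p₁ + g * p₂) (ha₂ : a₂ = p₂)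
    (hb₁ : b₁ = q₁ + g * q₂ - g * (p₁ + g * p₂) - g' * v₁) (hb₂ : b₂ = q₂ - g * p₂)
    (hdiv : a₁ + b₂ = 0) :
    |b₁ - a₂| ≤ M + (3 + A) * (σ * N) ∧
    (|a₁| ≤ K → |b₁| ≤ K → ∀ W, |b₁ - a₂| ≤ W → M ≤ W →
      |p₁| ≤ (2 + A) * (K + W) ∧ |p₂| ≤ (2 + A) * (K + W) ∧ |q₁| ≤ (2 + A) * (K + W) ∧
      |q₂| ≤ (2 + A) * (K + W)) := by
  have hmul : ∀ {x y s t : ℝ}, |x| ≤ s → |y| ≤ t → |x * y| ≤ s * t := fun {x y s t} hx hy => by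
    rw [abs_mul]
    exact mul_le_mul hx hy (abs_nonneg _) ((abs_nonneg _).trans hx)
  constructor
  · have e : b₁ - a₂ = w + g * q₂ - g * p₁ - g * (g * p₂) - g' * v₁ := by
      rw [hb₁, ha₂, hw']; ring
    have h1 := abs_le.1 (hmul hg hq₂)
    have h2 := abs_le.1 (hmul hg hp₁)
    have h3 := abs_le.1 (hmul hg (hmul hg hp₂))
    have h4 := abs_le.1 (hmul hg' hv₁)
    have h5 := abs_le.1 hw
    have h6 : σ * (σ * N) ≤ A * (σ * N) := mul_le_mul_of_nonneg_right hσA (by positivity)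
    rw [e, abs_le]
    constructor <;> nlinarith
  · intro h1 h2 W hW hM
    have hK : 0 ≤ K := (abs_nonneg _).trans h1
    have hW0 : 0 ≤ W := (abs_nonneg _).trans hW
    have hp : |p₂| ≤ K + W := by
      have e : p₂ = b₁ - (b₁ - a₂) := by rw [← ha₂]; ring
      rw [e]
      exact (abs_sub _ _).trans (add_le_add h2 hW)
    have hgA := hg.trans hσA
    have hgp := abs_le.1 (hmul hgA hp)
    have h3 := abs_le.1 h1
    have h4 := abs_le.1 hp
    have h5 := abs_le.1 hw
    have h6 : 0 ≤ A * (K + W) := by positivity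
    have ep : p₁ = a₁ - g * p₂ := by rw [ha₁]; ring
    have eq₂ : q₂ = -a₁ + g * p₂ := by linarith
    have eq₁ : q₁ = w + p₂ := by rw [hw']; ring
    refine ⟨?_, ?_, ?_, ?_⟩
    · rw [ep, abs_le]; constructor <;> linarith
    · rw [abs_le]; constructor <;> linarith
    · rw [eq₁, abs_le]; constructor <;> linarith
    · rw [eq₂, abs_le]; constructor <;> linarith

theorem exists_gradient_bound (A : ℝ≥0) : ∃ C : ℝ, 0 ≤ C ∧ ∀ {L : ℝ} [Fact (0 < L)]
    {γ : ℝ → ℝ} {v : ℝ × ℝ → ℝ × ℝ} {w p₁ p₂ q₁ q₂ : ℝ × ℝ → ℝ} {X : ℝ≥0} {s ε M N : ℝ},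
    1 ≤ L → 0 < ε → ε ≤ 1 → 0 ≤ s → s ≤ 1 → 0 ≤ M → 0 ≤ N →
    CoeffBound L 4 A γ → CoeffBound L 3 (s.toNNReal * A) γ →
    HasGradient L γ (fun z => (v z).1) p₁ p₂ → HasGradient L γ (fun z => (v z).2) q₁ q₂ →
    IsDivFree L γ v → IsTangent L γ v → IsCurl L γ v w →
    SobolevBound L γ 3 (fun z => (v z).1) X → SobolevBound L γ 3 (fun z => (v z).2) X →
    (∀ᵐ z ∂cellMeasure L γ, |w z| ≤ M) → (∀ᵐ z ∂cellMeasure L γ, |(v z).1| ≤ N) →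
    (∀ᵐ z ∂cellMeasure L γ, |p₁ z| ≤ N) → (∀ᵐ z ∂cellMeasure L γ, |p₂ z| ≤ N) →
    (∀ᵐ z ∂cellMeasure L γ, |q₂ z| ≤ N) →
    ∀ᵐ z ∂cellMeasure L γ,
      |p₁ z| ≤ C * (ε ^ 2 + (M + s * N) * Real.log (2 + 1 / ε ^ 3 * X)) ∧
      |p₂ z| ≤ C * (ε ^ 2 + (M + s * N) * Real.log (2 + 1 / ε ^ 3 * X)) ∧
      |q₁ z| ≤ C * (ε ^ 2 + (M + s * N) * Real.log (2 + 1 / ε ^ 3 * X)) ∧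
      |q₂ z| ≤ C * (ε ^ 2 + (M + s * N) * Real.log (2 + 1 / ε ^ 3 * X)) := by
  obtain ⟨C₁, hC₁0, hC₁⟩ := FlatField.exists_ae_bound
  obtain ⟨C₃, hC₃⟩ := FlatField.exists_sobolevBound_three A
  -- With σ = s A, the bound M + (3 + A) s A N for the flat curl is at most κ (M + s N).
  set κ : ℝ := 1 + (3 + A) * A with hκ
  have hκ1 : 1 ≤ κ := by
    rw [hκ]; linarith [show 0 ≤ (3 + (A : ℝ)) * A by positivity]
  set ℓ : ℝ := 3 * (1 + 2 * Real.log (1 + 2 * C₃)) with hℓ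
  have hℓ0 : 0 ≤ ℓ := by
    have := Real.log_nonneg (show (1 : ℝ) ≤ 1 + 2 * C₃ by linarith [C₃.coe_nonneg])
    rw [hℓ]; positivity
  refine ⟨(2 + A) * (2 * C₁ + C₁ * ℓ * κ + 2 * κ), by positivity,
    fun {L hL γ v w p₁ p₂ q₁ q₂ X s ε M N} hL1 hε hε1 hs hs1 hM hN hγ hγs hv1 hv2 hdiv htan hcurl
      s1 s2 bw bv b1 b2 b4 => ?_⟩
  have hc := hγ.smooth.continuous
  obtain ⟨V₁, V₂, a₁, a₂, b₁, b₂, hf, ea₁, ea₂, eb₁, eb₂⟩ :=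
    exists_flatField (hγ.of_le (by norm_num)) hv1 hv2 hdiv htan hcurl
  obtain ⟨t1, t2⟩ := hC₃ hγ hf s1 s2
  obtain ⟨δ, T, hδ, hδ1, hT, hscale⟩ := exists_scales C₃.coe_nonneg hε hε1 X.coe_nonneg
  have hcd := ae_comp_shear hc (ae_curl_eq hc hγ.periodic hcurl hv1.deriv2 hv2.deriv1)
  have hdiv0 : ∀ᵐ z ∂cellMeasure L 0, a₁ z + b₂ z = 0 := by
    filter_upwards [Lp.coeFn_add a₁ b₂, Lp.eq_zero_iff_ae_eq_zero.1 hf.system.div] with z h1 h2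
    rw [h2, Pi.add_apply] at h1
    exact h1.symm
  set Q := M + s * N with hQ
  have hsN : 0 ≤ s * N := by positivity
  have hQ0 : 0 ≤ Q := by positivity
  have hσ : ((s.toNNReal * A : ℝ≥0) : ℝ) = s * A := by simp [hs]
  have hsA : s * A ≤ A := mul_le_of_le_one_left A.coe_nonneg hs1
  have hd1 := hγs.deriv
  have hMω : M + (3 + A) * (s * A * N) ≤ κ * Q := by
    have e : κ * Q = M + (3 + A) * A * M + (1 + (3 + A) * A) * (s * N) := by rw [hκ, hQ]; ring
    have : 0 ≤ (3 + (A : ℝ)) * A * M := by positivity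
    rw [e]; nlinarith
  have hkey : ∀ᵐ z ∂cellMeasure L 0, |b₁ z - a₂ z| ≤ κ * Q ∧
      ∀ K, |a₁ z| ≤ K → |b₁ z| ≤ K →
        |p₁ (shear γ z)| ≤ (2 + A) * (K + κ * Q) ∧ |p₂ (shear γ z)| ≤ (2 + A) * (K + κ * Q) ∧
        |q₁ (shear γ z)| ≤ (2 + A) * (K + κ * Q) ∧ |q₂ (shear γ z)| ≤ (2 + A) * (K + κ * Q) := by
    filter_upwards [ea₁, ea₂, eb₁, eb₂, hdiv0, hcd, ae_comp_shear hc bw, ae_comp_shear hc bv,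
      ae_comp_shear hc b1, ae_comp_shear hc b2, ae_comp_shear hc b4]
      with z h1 h2 h3 h4 h5 h6 h7 h8 h9 h10 h11
    have hg := hd1.abs_le z.1
    have hg' := hd1.deriv.abs_le z.1
    rw [hσ] at hg hg'
    have main := fun K => gradient_bound_of_flat (K := K) A.coe_nonneg (by positivity) hsA hN hg hg'
      h8 h9 h10 h11 h7 h6 h1 h2 h3 h4 h5
    refine ⟨(main 0).1.trans hMω, fun K k1 k2 => (main K).2 k1 k2 _ ((main 0).1.trans hMω) ?_⟩
    rw [hQ]; nlinarith
  have hb := hC₁ hL1 hf t1 t2 (hkey.mono fun z hz => hz.1) hδ hδ1 hT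
  refine ae_of_ae_comp_shear hγ ?_
  filter_upwards [hkey, hb] with z hz hz'
  have hlog2 : 1 / 2 ≤ Real.log (2 + 1 / ε ^ 3 * X) := by
    have := Real.log_le_log (x := 2) (y := 2 + 1 / ε ^ 3 * X) (by norm_num)
      (by linarith [show 0 ≤ 1 / ε ^ 3 * (X : ℝ) by positivity])
    linarith [Real.log_two_gt_d9]
  set Λ := Real.log (2 + 1 / ε ^ 3 * X) with hΛ
  set K := C₁ * (2 * ε ^ 2 + ℓ * (κ * Q * Λ)) with hK
  have hle := hscale (κ * Q) (by positivity)
  have k1 : |a₁ z| ≤ K := hz'.1.trans (mul_le_mul_of_nonneg_left (by push_cast; exact hle) hC₁0)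
  have k2 : |b₁ z| ≤ K := hz'.2.trans (mul_le_mul_of_nonneg_left (by push_cast; exact hle) hC₁0)
  have hfin : (2 + A) * (K + κ * Q)
      ≤ (2 + A) * (2 * C₁ + C₁ * ℓ * κ + 2 * κ) * (ε ^ 2 + Q * Λ) := by
    rw [mul_assoc]
    refine mul_le_mul_of_nonneg_left ?_ (by positivity)
    have e : (2 * C₁ + C₁ * ℓ * κ + 2 * κ) * (ε ^ 2 + Q * Λ)
        = K + 2 * κ * Q * Λ + ((C₁ * ℓ * κ + 2 * κ) * ε ^ 2 + 2 * C₁ * (Q * Λ)) := by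
      rw [hK]; ring
    have h1 : 0 ≤ (C₁ * ℓ * κ + 2 * κ) * ε ^ 2 + 2 * C₁ * (Q * Λ) := by positivity
    -- The term κQ without logarithm is absorbed by means of Λ ≥ 1/2.
    have h2 : κ * Q * 1 ≤ κ * Q * (2 * Λ) :=
      mul_le_mul_of_nonneg_left (by linarith) (by positivity)
    rw [e]; linarith
  obtain ⟨r1, r2, r3, r4⟩ := hz.2 K k1 k2
  exact ⟨r1.trans hfin, r2.trans hfin, r3.trans hfin, r4.trans hfin⟩

end

/-! ### The L^∞ estimate in terms of extended norms -/

section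

variable {L : ℝ} {γ : ℝ → ℝ}

theorem ae_abs_le_of_eLpNorm_top_le {μ : Measure (ℝ × ℝ)} {f : ℝ × ℝ → ℝ} {N : ℝ≥0}
    (h : eLpNorm f ⊤ μ ≤ N) : ∀ᵐ z ∂μ, |f z| ≤ N := by
  rw [eLpNorm_exponent_top] at h
  filter_upwards [ae_le_eLpNormEssSup (f := f) (μ := μ)] with z hz
  have := hz.trans h
  rw [enorm_le_coe, ← NNReal.coe_le_coe, coe_nnnorm] at this
  exact this

theorem eLpNorm_top_le_of_ae_abs_le {μ : Measure (ℝ × ℝ)} {f : ℝ × ℝ → ℝ} {N : ℝ}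
    (h : ∀ᵐ z ∂μ, |f z| ≤ N) : eLpNorm f ⊤ μ ≤ ENNReal.ofReal N := by
  rw [eLpNorm_exponent_top]
  exact eLpNormEssSup_le_of_ae_bound h

theorem derivNorm_le_derivSup {j : ℕ} {β : ℕ × ℕ} (hβ : β ∈ Finset.HasAntidiagonal.antidiagonal j)
    (v : ℝ × ℝ → ℝ × ℝ) :
    derivNorm L γ ⊤ β (fun z => (v z).1) ≤ derivSup L γ j v ∧
    derivNorm L γ ⊤ β (fun z => (v z).2) ≤ derivSup L γ j v := by
  have h := Finset.le_sup (f := fun β => max (derivNorm L γ ⊤ β fun z => (v z).1)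
    (derivNorm L γ ⊤ β fun z => (v z).2)) hβ
  exact ⟨(le_max_left _ _).trans h, (le_max_right _ _).trans h⟩

/-- The 2 inside the logarithm keeps it positive, so an infinite factor in front of it makes the
right-hand side infinite despite 0 · ∞ = 0. -/
theorem toENNReal_log_two_add_ne_zero (x : ℝ≥0∞) : (ENNReal.log (2 + x)).toENNReal ≠ 0 := by
  rw [Ne, EReal.toENNReal_eq_zero_iff, not_le, ← ENNReal.log_one]
  exact ENNReal.log_strictMono (lt_of_lt_of_le (by norm_num) le_self_add)

theorem toENNReal_log_eq {ε : ℝ} (hε : 0 < ε) (X : ℝ≥0) :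
    (ENNReal.log (2 + ENNReal.ofReal (1 / ε ^ 3) * X)).toENNReal
      = ENNReal.ofReal (Real.log (2 + 1 / ε ^ 3 * X)) := by
  have e : 2 + ENNReal.ofReal (1 / ε ^ 3) * X = ENNReal.ofReal (2 + 1 / ε ^ 3 * X) := by
    rw [ENNReal.ofReal_add (by norm_num) (by positivity), ENNReal.ofReal_mul (by positivity),
      ENNReal.ofReal_coe_nnreal]
    norm_num
  rw [e, ENNReal.log_ofReal_of_pos (by positivity), EReal.toENNReal_of_ne_top (EReal.coe_ne_top _),
    EReal.toReal_coe]

theorem exists_lipschitz_estimate (A : ℝ≥0) : ∃ C : ℝ≥0, ∀ {L : ℝ} [Fact (0 < L)] {γ : ℝ → ℝ}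
    {v : ℝ × ℝ → ℝ × ℝ} {w p₁ p₂ q₁ q₂ : ℝ × ℝ → ℝ} {s ε : ℝ},
    1 ≤ L → 0 < ε → ε ≤ 1 → 0 < s → s ≤ 1 →
    CoeffBound L 4 A γ → CoeffBound L 3 (s.toNNReal * A) γ →
    HasGradient L γ (fun z => (v z).1) p₁ p₂ → HasGradient L γ (fun z => (v z).2) q₁ q₂ →
    IsDivFree L γ v → IsTangent L γ v → IsCurl L γ v w →
    derivSup L γ 1 v ≤ C * (ENNReal.ofReal (ε ^ 2) +
      (eLpNorm w ⊤ (cellMeasure L γ) + ENNReal.ofReal s * w1InftyNorm L γ v) *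
        (ENNReal.log (2 + ENNReal.ofReal (1 / ε ^ 3) * hNormVec L γ 3 v)).toENNReal) := by
  obtain ⟨C, hC0, hC⟩ := exists_gradient_bound A
  refine ⟨1 + C.toNNReal, fun {L hL γ v w p₁ p₂ q₁ q₂ s ε} hL1 hε hε1 hs hs1 hγ hγs hv1 hv2 hdiv
    htan hcurl => ?_⟩
  have hc := hγ.smooth.continuous
  have hp := hγ.periodic
  have hC1 : ((1 + C.toNNReal : ℝ≥0) : ℝ≥0∞) ≠ 0 := by simp
  have hs0 : ENNReal.ofReal s ≠ 0 := by simpa using hs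
  set lg := (ENNReal.log (2 + ENNReal.ofReal (1 / ε ^ 3) * hNormVec L γ 3 v)).toENNReal with hlg
  have hlg0 : lg ≠ 0 := toENNReal_log_two_add_ne_zero _
  by_cases hQ : eLpNorm w ⊤ (cellMeasure L γ) + ENNReal.ofReal s * w1InftyNorm L γ v = ⊤
  · rw [hQ, ENNReal.top_mul hlg0, add_top, ENNReal.mul_top hC1]
    exact le_top
  obtain ⟨hw, hN⟩ := ENNReal.add_ne_top.1 hQ
  have hN' : w1InftyNorm L γ v ≠ ⊤ := fun h => hN (by rw [h, ENNReal.mul_top hs0])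
  -- Here the logarithm is infinite. The convention 0 · ∞ = 0 matters only if the factor in front
  -- vanishes, but then ‖v‖_{W^{1,∞}} = 0 and the left-hand side is zero.
  by_cases hX : hNormVec L γ 3 v = ⊤
  · have hε3 : ENNReal.ofReal (1 / ε ^ 3) ≠ 0 := by
      simp only [ne_eq, ENNReal.ofReal_eq_zero, not_le]; positivity
    have htop : lg = ⊤ := by
      rw [hlg, hX, ENNReal.mul_top hε3, add_top, ENNReal.log_top, EReal.toENNReal_top]
    by_cases hQ0 : eLpNorm w ⊤ (cellMeasure L γ) + ENNReal.ofReal s * w1InftyNorm L γ v = 0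
    · have h1 : w1InftyNorm L γ v = 0 :=
        (mul_eq_zero.1 (add_eq_zero.1 hQ0).2).resolve_left hs0
      have h2 : derivSup L γ 1 v = 0 := (add_eq_zero.1 h1).2
      rw [h2]; exact zero_le
    · rw [htop, ENNReal.mul_top hQ0, add_top, ENNReal.mul_top hC1]
      exact le_top
  lift eLpNorm w ⊤ (cellMeasure L γ) to ℝ≥0 using hw with M hM
  set N' := w1InftyNorm L γ v with hNdef
  lift N' to ℝ≥0 using hN' with N
  lift hNormVec L γ 3 v to ℝ≥0 using hX with X hX'
  have d0 : derivSup L γ 0 v ≤ N := by rw [hNdef]; exact le_self_add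
  have d1 : derivSup L γ 1 v ≤ N := by rw [hNdef]; exact le_add_self
  have m00 : ((0, 0) : ℕ × ℕ) ∈ Finset.HasAntidiagonal.antidiagonal 0 := by simp
  have m10 : ((1, 0) : ℕ × ℕ) ∈ Finset.HasAntidiagonal.antidiagonal 1 := by simp
  have m01 : ((0, 1) : ℕ × ℕ) ∈ Finset.HasAntidiagonal.antidiagonal 1 := by simp
  have e1 := derivNorm_eq hL.out hc hp (p := ⊤) hv1.deriv1
  have e2 := derivNorm_eq hL.out hc hp (p := ⊤) hv1.deriv2
  have e3 := derivNorm_eq hL.out hc hp (p := ⊤) hv2.deriv1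
  have e4 := derivNorm_eq hL.out hc hp (p := ⊤) hv2.deriv2
  have e0 := derivNorm_eq hL.out hc hp (p := ⊤) (IsWeakDeriv.zero_order hv1.deriv1.locInt_left)
  have b0 := ae_abs_le_of_eLpNorm_top_le
    (e0.symm.trans_le ((derivNorm_le_derivSup m00 v).1.trans d0))
  have b1 := ae_abs_le_of_eLpNorm_top_le
    (e1.symm.trans_le ((derivNorm_le_derivSup m10 v).1.trans d1))
  have b2 := ae_abs_le_of_eLpNorm_top_le
    (e2.symm.trans_le ((derivNorm_le_derivSup m01 v).1.trans d1))
  have b4 := ae_abs_le_of_eLpNorm_top_le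
    (e4.symm.trans_le ((derivNorm_le_derivSup m01 v).2.trans d1))
  have bw := ae_abs_le_of_eLpNorm_top_le hM.symm.le
  have s1 : SobolevBound L γ 3 (fun z => (v z).1) X :=
    sobolevBound_of_sobolevNorm_le hL.out hc hp ((le_hNormVec_fst 3 v).trans hX'.symm.le)
  have s2 : SobolevBound L γ 3 (fun z => (v z).2) X :=
    sobolevBound_of_sobolevNorm_le hL.out hc hp ((le_hNormVec_snd 3 v).trans hX'.symm.le)
  have main := hC hL1 hε hε1 hs.le hs1 M.coe_nonneg N.coe_nonneg hγ hγs hv1 hv2 hdiv htan hcurl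
    s1 s2 bw b0 b1 b2 b4
  set R := C * (ε ^ 2 + (M + s * N) * Real.log (2 + 1 / ε ^ 3 * X)) with hR
  have hlog0 : 0 ≤ Real.log (2 + 1 / ε ^ 3 * X) := Real.log_nonneg (by
    linarith [show 0 ≤ 1 / ε ^ 3 * (X : ℝ) by positivity])
  have hRle : ENNReal.ofReal R ≤ ((1 + C.toNNReal : ℝ≥0) : ℝ≥0∞) * (ENNReal.ofReal (ε ^ 2)
      + (M + ENNReal.ofReal s * N) * lg) := by
    rw [hlg, toENNReal_log_eq hε, hR, ENNReal.ofReal_mul hC0,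
      ENNReal.ofReal_add (by positivity) (by positivity), ENNReal.ofReal_mul (by positivity),
      ENNReal.ofReal_add (by positivity) (by positivity), ENNReal.ofReal_mul hs.le,
      ENNReal.ofReal_coe_nnreal, ENNReal.ofReal_coe_nnreal]
    gcongr
    push_cast
    exact le_add_self
  refine le_trans ?_ hRle
  rw [derivSup]
  refine Finset.sup_le fun β hβ => ?_
  have hβ' : β = (0, 1) ∨ β = (1, 0) := by
    simpa [Finset.Nat.antidiagonal_succ] using hβ
  rcases hβ' with rfl | rfl
  · rw [e2, e4]
    exact max_le (eLpNorm_top_le_of_ae_abs_le (main.mono fun z hz => hz.2.1))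
      (eLpNorm_top_le_of_ae_abs_le (main.mono fun z hz => hz.2.2.2))
  · rw [e1, e3]
    exact max_le (eLpNorm_top_le_of_ae_abs_le (main.mono fun z hz => hz.1))
      (eLpNorm_top_le_of_ae_abs_le (main.mono fun z hz => hz.2.2.1))

end

end

end RoughDomain

/-- Uniform elliptic estimates in the rescaled rough domain
`{z₁ ∈ ℝ/(1/ε)ℤ, z₂ > ε^α η(z₁)}`, where `1/ε` is an integer.  All norms take values
in `[0, ∞]`. -/
theorem propositionC2 (η : ℝ → ℝ) (hη : ContDiff ℝ ∞ η) (hη_per : ∀ s, η (s + 1) = η s)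
    (hη_pos : ∀ s, 0 < η s) (α : ℝ) (hα : 0 < α) :
    ∃ (C : ℝ≥0) (ε₀ : ℝ), 0 < ε₀ ∧
      ∀ ε : ℝ, 0 < ε → ε ≤ ε₀ → (∃ N : ℕ, 1 / ε = N) →
      ∀ (v : ℝ × ℝ → ℝ × ℝ) (w : ℝ × ℝ → ℝ),
        hNormVec (1 / ε) (profile η α ε) 2 v < ⊤ →
        IsDivFree (1 / ε) (profile η α ε) v →
        IsTangent (1 / ε) (profile η α ε) v →
        IsCurl (1 / ε) (profile η α ε) v w →
        (∀ k : ℕ, k ≤ 3 →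
          hNormVec (1 / ε) (profile η α ε) k v ≤
            C * (hNorm (1 / ε) (profile η α ε) ((k : ℤ) - 1) w
              + hNormVec (1 / ε) (profile η α ε) 0 v)) ∧
        derivSup (1 / ε) (profile η α ε) 1 v ≤
          C * (ENNReal.ofReal (ε ^ 2) +
            (eLpNorm w ⊤ (cellMeasure (1 / ε) (profile η α ε))
              + ENNReal.ofReal (ε ^ α) * w1InftyNorm (1 / ε) (profile η α ε) v) *
            (ENNReal.log (2 + ENNReal.ofReal (1 / ε ^ 3) *
              hNormVec (1 / ε) (profile η α ε) 3 v)).toENNReal) := by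
  -- Order 2 suffices: an H³ bound of v needs the curl in H².
  obtain ⟨A, s₀, hs₀, hs₀1, hgood⟩ := exists_goodProfile hη hη_per 2
  choose C hC using fun k => hNormVec_succ_le k A
  obtain ⟨C', hC'⟩ := exists_lipschitz_estimate A
  -- The threshold ensures ε^α ≤ s₀ and L = 1/ε ≥ 1. In the constant, 1 serves k = 0, the C k serve
  -- k = 1, 2, 3, and C' the gradient bound.
  refine ⟨1 + C 0 + C 1 + C 2 + C', min 1 (s₀ ^ (1 / α)),
    lt_min one_pos (Real.rpow_pos_of_pos hs₀ _), ?_⟩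
  rintro ε hε hεle ⟨N, hN⟩ v w hv hdiv htan hcurl
  have hε1 : ε ≤ 1 := hεle.trans (min_le_left _ _)
  have hL1 : 1 ≤ 1 / ε := (one_le_div hε).2 hε1
  have hL : Fact (0 < 1 / ε) := ⟨by linarith⟩
  have hs : 0 < ε ^ α := Real.rpow_pos_of_pos hε α
  have hss : ε ^ α ≤ s₀ := by
    calc ε ^ α ≤ (s₀ ^ (1 / α)) ^ α :=
          Real.rpow_le_rpow hε.le (hεle.trans (min_le_right _ _)) hα.le
      _ = s₀ := by rw [← Real.rpow_mul hs₀.le, one_div_mul_cancel hα.ne', Real.rpow_one]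
  obtain ⟨hg, hγs⟩ := hgood _ hs hss N
  rw [← hN] at hg hγs
  change GoodProfile (1 / ε) 2 A (profile η α ε) at hg
  change CoeffBound (1 / ε) 3 _ (profile η α ε) at hγs
  have hc := hg.profile.smooth.continuous
  have hp := hg.profile.periodic
  obtain ⟨B, hB⟩ : ∃ B : ℝ≥0, (B : ℝ≥0∞) = hNormVec (1 / ε) (profile η α ε) 2 v :=
    ⟨_, ENNReal.coe_toNNReal hv.ne⟩
  have s1 : SobolevBound (1 / ε) (profile η α ε) 2 (fun z => (v z).1) B :=
    sobolevBound_of_sobolevNorm_le hL.out hc hp ((le_hNormVec_fst 2 v).trans hB.symm.le)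
  have s2 : SobolevBound (1 / ε) (profile η α ε) 2 (fun z => (v z).2) B :=
    sobolevBound_of_sobolevNorm_le hL.out hc hp ((le_hNormVec_snd 2 v).trans hB.symm.le)
  obtain ⟨p₁, p₂, hv1⟩ := s1.exists_hasGradient
  obtain ⟨q₁, q₂, hv2⟩ := s2.exists_hasGradient
  obtain ⟨V₁, V₂, a₁, a₂, b₁, b₂, hf, -⟩ :=
    exists_flatField (hg.profile.of_le (by norm_num)) hv1 hv2 hdiv htan hcurl
  constructor
  · rintro (_ | k) hk
    · calc hNormVec (1 / ε) (profile η α ε) 0 v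
          ≤ 1 * (hNorm (1 / ε) (profile η α ε) (((0 : ℕ) : ℤ) - 1) w
            + hNormVec (1 / ε) (profile η α ε) 0 v) := by rw [one_mul]; exact le_add_self
        _ ≤ _ := by
          gcongr
          simp only [add_assoc, ENNReal.coe_add, ENNReal.coe_one]
          exact le_self_add
    · have h := hC k (hg.of_le (by omega)) hf
      have e : ((k + 1 : ℕ) : ℤ) - 1 = k := by push_cast; ring
      rw [e]
      refine h.trans ?_
      gcongr
      have hk' : k ≤ 2 := by omega
      interval_cases k
      · exact le_add_right (le_add_right (le_add_right le_add_self))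
      · exact le_add_right (le_add_right le_add_self)
      · exact le_add_right le_add_self
  · refine (hC' hL1 hε hε1 hs (hss.trans hs₀1) (hg.profile.of_le (by norm_num)) hγs hv1 hv2 hdiv
      htan hcurl).trans ?_
    gcongr
    exact le_add_self
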